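/- **Words.** For a set $A$ let $T(A)$ be the $\mathbb{Q}$-vector space spanned by the words over $A$ (empty word $1$), with the shuffle product $\ast $, i.e. the bilinear product with $1 \ast w = w \ast 1 = w$ and $(\sigma u) \ast (\tau v) = \sigma(u \ast \tau v)+\tau(\sigma u \ast v)$ for letters $\sigma,\tau$ and words $u,v$. **Hyperlogarithms.** For a word $w$ in letters from $\mathbb{C}\setminus(0,\infty)$ and real $z>0$ put $L_{0^n}(z)=\frac{\log^n z}{n!}$ for the word $0^n$ ($n\ge 0$), and $L_{\sigma w'}(z)=\int_0^z \frac{L_{w'}(x)}{x-\sigma}\,dx$ if $w=\sigma w'$ is not of this form; extend $w\mapsto L_w(z)$ linearly. **Regularized limits.** If for all large real $z$ one has $F(z)=\sum_{i=0}^n f_i(1/z)\log^i z$ with $f_0,\dots,f_n$ holomorphic at $0$, put $\operatorname{Reg}_{z\to\infty}F(z)=f_0(0)$. If for all small $t>0$ one has $F(t)=\sum_{i=0}^n f_i(t)\log^i t$ with $f_0,\dots,f_n$ holomorphic at $0$, put $\operatorname{Reg}_{t\to0}F(t)=f_0(0)$. (These values do not depend on the choice of the $f_i$.) **Leading coefficients.**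 For $0\ne\sigma\in\mathbb{C}(t)$ with Laurent series $\sigma=\sum_{n\ge N}a_nt^n$ at $t=0$, $a_N\neq0$, put $\deg\sigma=N$ and $\operatorname{lc}(\sigma)=a_N$; put $\deg 0=\infty$. For a word, $\deg(\sigma_1\cdots\sigma_n)=\min_i\deg\sigma_i$. For $\Sigma\subset\mathbb{C}(t)$ put $\operatorname{lc}(\Sigma)=\{0\}\cup\{\operatorname{lc}(\sigma):\sigma\in\Sigma\setminus\{0\}\}$. **Theorem.** Let $\Sigma\subset\mathbb{C}(t)$ contain no positive real constant, and suppose $\operatorname{lc}(\Sigma)\cap(0,\infty)=\emptyset$. Then there is a unique $\mathbb{Q}$-linear map $\ell\colon T(\Sigma)\to T(\operatorname{lc}(\Sigma))$ such that * $\ell(1)=1$ and $\ell(u\ast v)=\ell(u)\ast \ell(v)$ for all $u,v\in T(\Sigma)$; * $\ell(0)=0$ for the one-letter word $0$, if $0\in\Sigma$; * $\ell(\sigma_1\cdots\sigma_n)=\sigma_1'\cdots\sigma_n'$ with $\sigma_i'=\lim_{t\to0}t^{-d}\sigma_i(t)$, whenever $n\ge1$, $\sigma_n\neq0$ and $d=\deg(\sigma_1\cdots\sigma_n)=\deg\sigma_n$.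 For every $w\in T(\Sigma)$, let $w(t)$ be obtained from $w$ by evaluating all letters at $t$. Then $\operatorname{Reg}_{z\to\infty}L_{w(t)}(z)$ exists for all sufficiently small $t>0$, this function of $t$ has a regularized limit at $t\to0$, $\operatorname{Reg}_{z\to\infty}L_{\ell(w)}(z)$ exists, and $$\operatorname{Reg}_{t\to0}\ \operatorname{Reg}_{z\to\infty}L_{w(t)}(z)=\operatorname{Reg}_{z\to\infty}L_{\ell(w)}(z).$$ -/

import Mathlib

namespace Hyperlogarithm

noncomputable section

/-! ### The shuffle algebra -/

/-- `T(Σ)`: rational linear combinations of words over the alphabet `α`.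
The empty word `single [] 1` is the unit. -/
abbrev WordSpace (α : Type*) : Type _ := List α →₀ ℚ

/-- A word, as an element of `T(Σ)`. -/
def ofWord {α : Type*} (w : List α) : WordSpace α := Finsupp.single w 1

/-- The shuffle product of two words,
`(a u) ⧢ (b v) = a (u ⧢ b v) + b (a u ⧢ v)`. -/
def shuffleWord {α : Type*} : List α → List α → WordSpace α
  | [], v => ofWord v
  | a :: u, [] => ofWord (a :: u)
  | a :: u, b :: v =>
      Finsupp.mapDomain (List.cons a) (shuffleWord u (b :: v)) +
        Finsupp.mapDomain (List.cons b) (shuffleWord (a :: u) v)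
termination_by u v => u.length + v.length

/-- The shuffle product on `T(Σ)`, the bilinear extension of `shuffleWord`. -/
def shuffle {α : Type*} (x y : WordSpace α) : WordSpace α :=
  x.sum fun u p => y.sum fun v q => (p * q) • shuffleWord u v

/-! ### Hyperlogarithms on the positive real axis -/

open Classical in
/-- The hyperlogarithm `L_w(z)` for `z > 0`: `L_{0^n}(z) = log^n z / n!`, and
`L_{σ w}(z) = ∫_0^z L_w(x) / (x - σ) dx` for any other nonempty word. -/
def hyperlogWord : List ℂ → ℝ → ℂ
  | [], _ => 1
  | σ :: w, z =>
      if ∀ τ ∈ σ :: w, τ = 0 then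
        (Real.log z : ℂ) ^ (σ :: w).length / ((σ :: w).length.factorial : ℂ)
      else
        ∫ x in (0 : ℝ)..z, hyperlogWord w x / ((x : ℂ) - σ)

/-- The linear extension of `w ↦ L_w(z)` to `T(Σ)`. The letters are read as complex numbers
through `ev`. -/
def hyperlog {α : Type*} (ev : α → ℂ) (w : WordSpace α) (z : ℝ) : ℂ :=
  w.sum fun v q => (q : ℂ) * hyperlogWord (v.map ev) z

/-! ### Regularized limits -/

/-- `c` is a regularized limit of `F(z)` as `z → ∞`: for all large `z` one has
`F(z) = ∑ i ≤ n, f i (1 / z) * log^i z` with all `f i` holomorphic at `0`, and `c = f 0 0`. -/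
def HasRegLimAtTop (F : ℝ → ℂ) (c : ℂ) : Prop :=
  ∃ (n : ℕ) (f : ℕ → ℂ → ℂ),
    (∀ i, AnalyticAt ℂ (f i) 0) ∧
    (∀ᶠ z : ℝ in Filter.atTop,
      F z = ∑ i ∈ Finset.range (n + 1), f i (1 / (z : ℂ)) * (Real.log z : ℂ) ^ i) ∧
    f 0 0 = c

/-- `c` is a regularized limit of `F(t)` as `t → 0` through positive values: for all small `t > 0`
one has `F(t) = ∑ i ≤ n, f i t * log^i t` with all `f i` holomorphic at `0`, and `c = f 0 0`. -/
def HasRegLimAtZero (F : ℝ → ℂ) (c : ℂ) : Prop :=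
  ∃ (n : ℕ) (f : ℕ → ℂ → ℂ),
    (∀ i, AnalyticAt ℂ (f i) 0) ∧
    (∀ᶠ t : ℝ in nhdsWithin 0 (Set.Ioi 0),
      F t = ∑ i ∈ Finset.range (n + 1), f i (t : ℂ) * (Real.log t : ℂ) ^ i) ∧
    f 0 0 = c

/-- The regularized limit of `F(z)` as `z → ∞` (meaningful if one exists). -/
def regLimAtTop (F : ℝ → ℂ) : ℂ := Classical.epsilon (HasRegLimAtTop F)

/-- The regularized limit of `F(t)` as `t → 0` (meaningful if one exists). -/
def regLimAtZero (F : ℝ → ℂ) : ℂ := Classical.epsilon (HasRegLimAtZero F)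

/-! ### Letters that depend rationally on `t` -/

/-- The Laurent series at `t = 0` of a rational function of `t`. -/
def laurent (σ : RatFunc ℂ) : LaurentSeries ℂ := (σ : LaurentSeries ℂ)

/-- The vanishing degree of `σ` at `t = 0`, with `deg 0 = ⊤`. -/
def vanishingDeg (σ : RatFunc ℂ) : WithTop ℤ := (laurent σ).orderTop

/-- The leading coefficient of `σ` at `t = 0`. -/
def leadingCoeff (σ : RatFunc ℂ) : ℂ := (laurent σ).leadingCoeff

/-- The vanishing degree of a word, the minimum over its letters. -/
def wordDeg (w : List (RatFunc ℂ)) : WithTop ℤ := (w.map vanishingDeg).foldr min ⊤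

/-- The alphabet of leading coefficients: `0` and the leading coefficients of all nonzero
letters. -/
def leadingAlphabet (S : Set (RatFunc ℂ)) : Set ℂ :=
  {0} ∪ leadingCoeff '' (S \ {0})

/-- The value at a point `t` of a rational function of `t`. -/
def evalAt {S : Set (RatFunc ℂ)} (t : ℝ) (σ : S) : ℂ :=
  RatFunc.eval (RingHom.id ℂ) (t : ℂ) (σ : RatFunc ℂ)

/-- The limit at `t → 0` of the rescaled letter `t ^ (-d) * σ`, for `d` at most the vanishing
degree of `σ`: it is the coefficient of `t ^ d` in the Laurent series of `σ`. -/
def rescaledLimit (d : ℤ) (σ : RatFunc ℂ) : ℂ := (laurent σ).coeff d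

/-- `ℓ` is a morphism of shuffle algebras `T(S) → T(leadingAlphabet S)` with `ℓ(0) = 0` that sends
each word whose final letter is nonzero and has the vanishing degree `d` of the whole word to the
limit at `t → 0` of the word with all letters rescaled by `t ^ (-d)`. -/
structure IsReglimWord {S : Set (RatFunc ℂ)}
    (ℓ : WordSpace S →ₗ[ℚ] WordSpace (leadingAlphabet S)) : Prop where
  map_one : ℓ (ofWord []) = ofWord []
  map_shuffle : ∀ x y : WordSpace S, ℓ (shuffle x y) = shuffle (ℓ x) (ℓ y)
  map_zero_letter : ∀ σ : S, (σ : RatFunc ℂ) = 0 → ℓ (ofWord [σ]) = 0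
  map_minimal : ∀ (u : List S) (σ : S) (d : ℤ),
    vanishingDeg (σ : RatFunc ℂ) = d →
    wordDeg ((u ++ [σ]).map Subtype.val) = d →
    Finsupp.mapDomain (List.map Subtype.val) (ℓ (ofWord (u ++ [σ]))) =
      ofWord ((u ++ [σ]).map fun τ => rescaledLimit d (τ : RatFunc ℂ))

end

end Hyperlogarithm

namespace Hyperlogarithm

noncomputable section

/-! ### Shuffle algebra: bilinearity, commutativity, associativity -/

variable {α β M : Type*}

/-- Prepending a letter, as a linear map. -/
def consL (a : α) : WordSpace α →ₗ[ℚ] WordSpace α := Finsupp.lmapDomain ℚ ℚ (List.cons a)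

theorem consL_ofWord (a : α) (w : List α) : consL a (ofWord w) = ofWord (a :: w) := by
  simp [consL, ofWord]

/-- The shuffle product as a bilinear map. -/
def shuffleL : WordSpace α →ₗ[ℚ] WordSpace α →ₗ[ℚ] WordSpace α :=
  Finsupp.linearCombination ℚ fun u => Finsupp.linearCombination ℚ (shuffleWord u)

theorem shuffleL_apply (x y : WordSpace α) : shuffleL x y = shuffle x y := by
  simp only [shuffleL, shuffle, Finsupp.linearCombination_apply, Finsupp.sum,
    LinearMap.sum_apply, LinearMap.smul_apply, Finset.smul_sum, smul_smul]

@[simp] theorem shuffleL_ofWord (u v : List α) :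
    shuffleL (ofWord u) (ofWord v) = shuffleWord u v := by
  simp [shuffleL, ofWord, Finsupp.linearCombination_single]

theorem shuffleWord_nil_left (v : List α) : shuffleWord [] v = ofWord v := by
  rw [shuffleWord]

theorem shuffleWord_nil_right (u : List α) : shuffleWord u [] = ofWord u := by
  cases u <;> rw [shuffleWord]

theorem shuffleWord_cons_cons (a b : α) (u v : List α) :
    shuffleWord (a :: u) (b :: v) =
      consL a (shuffleWord u (b :: v)) + consL b (shuffleWord (a :: u) v) := by
  rw [shuffleWord]; rfl

theorem wordSpace_hom_ext [AddCommGroup M] [Module ℚ M] {f g : WordSpace α →ₗ[ℚ] M}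
    (h : ∀ w, f (ofWord w) = g (ofWord w)) : f = g :=
  Finsupp.lhom_ext' fun w => LinearMap.ext_ring (h w)

@[simp] theorem shuffleL_one_left (x : WordSpace α) : shuffleL (ofWord []) x = x := by
  have : shuffleL (ofWord ([] : List α)) = LinearMap.id :=
    wordSpace_hom_ext fun w => by simp [shuffleWord_nil_left]
  rw [this]; rfl

@[simp] theorem shuffleL_one_right (x : WordSpace α) : shuffleL x (ofWord []) = x := by
  have : shuffleL.flip (ofWord ([] : List α)) = LinearMap.id :=
    wordSpace_hom_ext fun w => by simp [shuffleWord_nil_right]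
  exact LinearMap.congr_fun this x

theorem shuffleL_consL_consL (a b : α) (x y : WordSpace α) :
    shuffleL (consL a x) (consL b y) =
      consL a (shuffleL x (consL b y)) + consL b (shuffleL (consL a x) y) := by
  have : shuffleL.compl₁₂ (consL a) (consL b) =
      (shuffleL.compl₁₂ LinearMap.id (consL b)).compr₂ (consL a) +
        (shuffleL.compl₁₂ (consL a) LinearMap.id).compr₂ (consL b) := by
    refine wordSpace_hom_ext fun u => wordSpace_hom_ext fun v => ?_
    simp [consL_ofWord, shuffleWord_cons_cons]
  exact LinearMap.congr_fun (LinearMap.congr_fun this x) y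

theorem shuffleWord_comm (u v : List α) : shuffleWord u v = shuffleWord v u := by
  induction u generalizing v with
  | nil => rw [shuffleWord_nil_left, shuffleWord_nil_right]
  | cons a u ihu =>
    induction v with
    | nil => rw [shuffleWord_nil_left, shuffleWord_nil_right]
    | cons b v ihv =>
      rw [shuffleWord_cons_cons, shuffleWord_cons_cons, ihu, ihv, add_comm]

theorem shuffleL_comm (x y : WordSpace α) : shuffleL x y = shuffleL y x := by
  have : (shuffleL : WordSpace α →ₗ[ℚ] _) = shuffleL.flip :=
    wordSpace_hom_ext fun u => wordSpace_hom_ext fun v => by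
      simp [shuffleWord_comm u v]
  exact LinearMap.congr_fun (LinearMap.congr_fun this x) y

theorem shuffleL_assoc_ofWord (u v w : List α) :
    shuffleL (shuffleL (ofWord u) (ofWord v)) (ofWord w) =
      shuffleL (ofWord u) (shuffleL (ofWord v) (ofWord w)) := by
  induction u generalizing v w with
  | nil => simp [shuffleWord_nil_left]
  | cons a u ihu =>
    induction v generalizing w with
    | nil => simp [shuffleWord_nil_left]
    | cons b v ihv =>
      induction w with
      | nil => simp only [shuffleL_one_right]
      | cons c w ihw =>
        simp only [← consL_ofWord] at ihu ihv ihw ⊢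
        have hu := ihu (b :: v) (c :: w)
        have hv := ihv (c :: w)
        rw [← consL_ofWord, ← consL_ofWord] at hu
        rw [← consL_ofWord] at hv
        have lhs : shuffleL (shuffleL (consL a (ofWord u)) (consL b (ofWord v)))
              (consL c (ofWord w)) =
            consL a (shuffleL (shuffleL (ofWord u) (consL b (ofWord v))) (consL c (ofWord w))) +
            consL b (shuffleL (shuffleL (consL a (ofWord u)) (ofWord v)) (consL c (ofWord w))) +
            consL c (shuffleL (shuffleL (consL a (ofWord u)) (consL b (ofWord v)))
              (ofWord w)) := by
          simp only [shuffleL_consL_consL, map_add, LinearMap.add_apply]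
          abel
        have rhs : shuffleL (consL a (ofWord u)) (shuffleL (consL b (ofWord v))
              (consL c (ofWord w))) =
            consL a (shuffleL (ofWord u) (shuffleL (consL b (ofWord v)) (consL c (ofWord w)))) +
            consL b (shuffleL (consL a (ofWord u)) (shuffleL (ofWord v) (consL c (ofWord w)))) +
            consL c (shuffleL (consL a (ofWord u)) (shuffleL (consL b (ofWord v))
              (ofWord w))) := by
          simp only [shuffleL_consL_consL, map_add]
          abel
        rw [lhs, rhs, hu, hv, ihw]

theorem shuffleL_assoc (x y z : WordSpace α) :
    shuffleL (shuffleL x y) z = shuffleL x (shuffleL y z) := by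
  have : (shuffleL : WordSpace α →ₗ[ℚ] _).compr₂ shuffleL =
      ((LinearMap.llcomp ℚ (WordSpace α) (WordSpace α) (WordSpace α)).flip.comp
        shuffleL).flip.comp (shuffleL : WordSpace α →ₗ[ℚ] _) := by
    refine wordSpace_hom_ext fun u => wordSpace_hom_ext fun v => wordSpace_hom_ext fun w => ?_
    exact shuffleL_assoc_ofWord u v w
  exact LinearMap.congr_fun (LinearMap.congr_fun (LinearMap.congr_fun this x) y) z

theorem shuffleL_shuffleL_shuffleL_comm (x y z w : WordSpace α) :
    shuffleL (shuffleL x y) (shuffleL z w) = shuffleL (shuffleL x z) (shuffleL y w) := by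
  rw [shuffleL_assoc, ← shuffleL_assoc y z w, shuffleL_comm y z, shuffleL_assoc z y w,
    ← shuffleL_assoc]

/-! ### Deconcatenation and convolution -/

/-- The sum of `h p s` over all factorizations `w = p ++ s`. -/
def cutSum [AddCommMonoid M] : (List α → List α → M) → List α → M
  | h, [] => h [] []
  | h, a :: w => h [] (a :: w) + cutSum (fun p s => h (a :: p) s) w

theorem cutSum_congr [AddCommMonoid M] {h h' : List α → List α → M} {w : List α}
    (H : ∀ p s, p ++ s = w → h p s = h' p s) : cutSum h w = cutSum h' w := by
  induction w generalizing h h' with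
  | nil => exact H [] [] rfl
  | cons a w ih =>
    simp only [cutSum]
    rw [H [] (a :: w) rfl, ih fun p s hps => H (a :: p) s (by simp [hps])]

theorem cutSum_add [AddCommMonoid M] (h h' : List α → List α → M) (w : List α) :
    cutSum (fun p s => h p s + h' p s) w = cutSum h w + cutSum h' w := by
  induction w generalizing h h' with
  | nil => rfl
  | cons a w ih => simp only [cutSum, ih]; abel

theorem cutSum_zero [AddCommMonoid M] (w : List α) :
    cutSum (fun _ _ => (0 : M)) w = 0 := by
  induction w with
  | nil => rfl
  | cons a w ih => simp [cutSum, ih]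

theorem map_cutSum [AddCommMonoid M] {N F : Type*} [AddCommMonoid N] [FunLike F M N]
    [AddMonoidHomClass F M N] (φ : F) (h : List α → List α → M) (w : List α) :
    φ (cutSum h w) = cutSum (fun p s => φ (h p s)) w := by
  induction w generalizing h with
  | nil => rfl
  | cons a w ih => simp only [cutSum, map_add, ih]

theorem cutSum_eq_right [AddCommMonoid M] {h : List α → List α → M} {w : List α}
    (H : ∀ p s, p ++ s = w → p ≠ [] → h p s = 0) : cutSum h w = h [] w := by
  cases w with
  | nil => rfl
  | cons a w =>
    rw [cutSum, cutSum_congr (h' := fun _ _ => 0) (fun p s hps => H _ _ (by simp [hps]) (by simp)),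
      cutSum_zero, add_zero]

theorem cutSum_eq_left [AddCommMonoid M] {h : List α → List α → M} {w : List α}
    (H : ∀ p s, p ++ s = w → s ≠ [] → h p s = 0) : cutSum h w = h w [] := by
  induction w generalizing h with
  | nil => rfl
  | cons a w ih =>
    rw [cutSum, H [] (a :: w) rfl (by simp), zero_add,
      ih fun p s hps hs => H _ _ (by simp [hps]) hs]

/-- The linear extension of `w ↦ ∑_{w = p ++ s} H p s`. -/
def cutSumL [AddCommGroup M] [Module ℚ M] (H : WordSpace α →ₗ[ℚ] WordSpace α →ₗ[ℚ] M) :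
    WordSpace α →ₗ[ℚ] M :=
  Finsupp.linearCombination ℚ (cutSum fun p s => H (ofWord p) (ofWord s))

theorem cutSumL_ofWord [AddCommGroup M] [Module ℚ M]
    (H : WordSpace α →ₗ[ℚ] WordSpace α →ₗ[ℚ] M) (w : List α) :
    cutSumL H (ofWord w) = cutSum (fun p s => H (ofWord p) (ofWord s)) w := by
  simp [cutSumL, ofWord, Finsupp.linearCombination_single]

theorem cutSumL_consL [AddCommGroup M] [Module ℚ M]
    (H : WordSpace α →ₗ[ℚ] WordSpace α →ₗ[ℚ] M) (a : α) (x : WordSpace α) :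
    cutSumL H (consL a x) = H (ofWord []) (consL a x) + cutSumL (H.comp (consL a)) x := by
  have : (cutSumL H).comp (consL a) =
      (H (ofWord [])).comp (consL a) + cutSumL (H.comp (consL a)) :=
    wordSpace_hom_ext fun w => by simp [consL_ofWord, cutSumL_ofWord, cutSum]
  exact LinearMap.congr_fun this x

/-- Deconcatenation is compatible with shuffles. -/
theorem cutSumL_shuffleWord [AddCommGroup M] [Module ℚ M]
    (H : WordSpace α →ₗ[ℚ] WordSpace α →ₗ[ℚ] M) (u v : List α) :
    cutSumL H (shuffleWord u v) =
      cutSum (fun p₁ s₁ => cutSum (fun p₂ s₂ => H (shuffleWord p₁ p₂) (shuffleWord s₁ s₂)) v) u := by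
  induction u generalizing v H with
  | nil =>
    simp [shuffleWord_nil_left, cutSumL_ofWord, cutSum]
  | cons a u ihu =>
    induction v generalizing H with
    | nil =>
      simp [shuffleWord_nil_right, cutSumL_ofWord, cutSum]
    | cons b v ihv =>
      rw [shuffleWord_cons_cons, map_add, cutSumL_consL, cutSumL_consL, ihu, ihv]
      simp only [cutSum, LinearMap.comp_apply, shuffleWord_nil_left, shuffleWord_nil_right,
        consL_ofWord, shuffleWord_cons_cons, map_add, LinearMap.add_apply, cutSum_add]
      abel

/-- A linear map compatible with the units and with shuffles. -/
structure IsShuffleHom (f : WordSpace α →ₗ[ℚ] WordSpace β) : Prop where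
  map_one : f (ofWord []) = ofWord []
  map_shuffleWord : ∀ u v, f (shuffleWord u v) = shuffleL (f (ofWord u)) (f (ofWord v))

/-- The convolution product of two linear maps. -/
def conv (f g : WordSpace α →ₗ[ℚ] WordSpace β) : WordSpace α →ₗ[ℚ] WordSpace β :=
  cutSumL (shuffleL.compl₁₂ f g)

theorem conv_ofWord (f g : WordSpace α →ₗ[ℚ] WordSpace β) (w : List α) :
    conv f g (ofWord w) = cutSum (fun p s => shuffleL (f (ofWord p)) (g (ofWord s))) w := by
  simp [conv, cutSumL_ofWord]

theorem IsShuffleHom.conv {f g : WordSpace α →ₗ[ℚ] WordSpace β}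
    (hf : IsShuffleHom f) (hg : IsShuffleHom g) : IsShuffleHom (conv f g) where
  map_one := by simp [conv_ofWord, cutSum, hf.map_one, hg.map_one]
  map_shuffleWord u v := by
    rw [conv_ofWord, conv_ofWord, Hyperlogarithm.conv, cutSumL_shuffleWord,
      ← LinearMap.flip_apply, map_cutSum]
    refine cutSum_congr fun p₁ s₁ _ => ?_
    rw [LinearMap.flip_apply, map_cutSum]
    refine cutSum_congr fun p₂ s₂ _ => ?_
    rw [LinearMap.compl₁₂_apply, hf.map_shuffleWord, hg.map_shuffleWord,
      shuffleL_shuffleL_shuffleL_comm]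

/-- The word map that replaces every letter `a` by `c • φ a`, where `none` stands for zero. -/
def substWord (c : ℚ) (φ : α → Option β) : List α → WordSpace β
  | [] => ofWord []
  | a :: w => match φ a with
    | none => 0
    | some b => c • consL b (substWord c φ w)

/-- The linear extension of `substWord`. -/
def subst (c : ℚ) (φ : α → Option β) : WordSpace α →ₗ[ℚ] WordSpace β :=
  Finsupp.linearCombination ℚ (substWord c φ)

theorem subst_ofWord (c : ℚ) (φ : α → Option β) (w : List α) :
    subst c φ (ofWord w) = substWord c φ w := by
  simp [subst, ofWord]

theorem subst_consL_none (c : ℚ) {φ : α → Option β} {a : α} (h : φ a = none)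
    (x : WordSpace α) : subst c φ (consL a x) = 0 := by
  have : (subst c φ).comp (consL a) = 0 :=
    wordSpace_hom_ext fun w => by simp [consL_ofWord, subst_ofWord, substWord, h]
  exact LinearMap.congr_fun this x

theorem subst_consL_some (c : ℚ) {φ : α → Option β} {a : α} {b : β} (h : φ a = some b)
    (x : WordSpace α) : subst c φ (consL a x) = c • consL b (subst c φ x) := by
  have : (subst c φ).comp (consL a) = c • (consL b).comp (subst c φ) :=
    wordSpace_hom_ext fun w => by simp [consL_ofWord, subst_ofWord, substWord, h]
  exact LinearMap.congr_fun this x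

theorem isShuffleHom_subst (c : ℚ) (φ : α → Option β) : IsShuffleHom (subst c φ) where
  map_one := by simp [subst_ofWord, substWord]
  map_shuffleWord u v := by
    induction u generalizing v with
    | nil => simp [shuffleWord_nil_left, subst_ofWord, substWord]
    | cons a u ihu =>
      induction v with
      | nil => simp [shuffleWord_nil_right, subst_ofWord, substWord]
      | cons b v ihv =>
        rw [shuffleWord_cons_cons, map_add]
        simp only [← consL_ofWord] at ihv ⊢
        have hu := ihu (b :: v)
        rw [← consL_ofWord] at hu
        rcases ha : φ a with _ | a' <;> rcases hb : φ b with _ | b'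
        · simp [subst_consL_none c ha, subst_consL_none c hb]
        · simp [subst_consL_none c ha, subst_consL_some c hb, ihv]
        · simp [subst_consL_some c ha, subst_consL_none c hb, hu]
        · simp only [subst_consL_some c ha, subst_consL_some c hb, hu, ihv, map_smul,
            LinearMap.smul_apply, shuffleL_consL_consL, smul_add]

theorem substWord_eq_zero (c : ℚ) {φ : α → Option β} {w : List α} {a : α} (ha : a ∈ w)
    (h : φ a = none) : substWord c φ w = 0 := by
  induction w with
  | nil => simp at ha
  | cons b w ih =>
    rw [substWord]
    rcases List.mem_cons.1 ha with rfl | ha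
    · rw [h]
    · cases φ b <;> simp [ih ha]

theorem substWord_of_some (c : ℚ) {φ : α → Option β} (f : α → β) {w : List α}
    (h : ∀ a ∈ w, φ a = some (f a)) : substWord c φ w = c ^ w.length • ofWord (w.map f) := by
  induction w with
  | nil => simp [substWord]
  | cons b w ih =>
    rw [substWord, h b (by simp), ih fun a ha => h a (by simp [ha])]
    simp [consL_ofWord, pow_succ', smul_smul]

/-! ### Powers of a letter -/

theorem shuffleWord_replicate (a : α) (m n : ℕ) :
    shuffleWord (List.replicate m a) (List.replicate n a) =
      ((m + n).choose m : ℚ) • ofWord (List.replicate (m + n) a) := by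
  induction m generalizing n with
  | zero => simp [shuffleWord_nil_left]
  | succ m ihm =>
    induction n with
    | zero => simp [shuffleWord_nil_right]
    | succ n ihn =>
      have h1 := ihm (n + 1)
      rw [List.replicate_succ] at h1
      rw [List.replicate_succ] at ihn
      rw [List.replicate_succ, List.replicate_succ, shuffleWord_cons_cons, h1, ihn,
        map_smul, map_smul, consL_ofWord, consL_ofWord, ← List.replicate_succ,
        ← List.replicate_succ, show m + 1 + n + 1 = m + (n + 1) + 1 by ring,
        show m + 1 + (n + 1) = m + (n + 1) + 1 by ring, ← add_smul,
        Nat.choose_succ_succ' (m + (n + 1)) m, show m + 1 + n = m + (n + 1) by ring]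
      push_cast
      rfl

theorem cutSum_replicate [AddCommMonoid M] (h : List α → List α → M) (a : α) (n : ℕ) :
    cutSum h (List.replicate n a) =
      ∑ i ∈ Finset.range (n + 1), h (List.replicate i a) (List.replicate (n - i) a) := by
  induction n generalizing h with
  | zero => simp [cutSum]
  | succ n ih =>
    rw [List.replicate_succ, cutSum, ih, Finset.sum_range_succ' _ (n + 1)]
    simp [List.replicate_succ, add_comm]

theorem cutSum_map [AddCommMonoid M] (h : List β → List β → M) (f : α → β) (w : List α) :
    cutSum h (w.map f) = cutSum (fun p s => h (p.map f) (s.map f)) w := by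
  induction w generalizing h with
  | nil => rfl
  | cons a w ih => simp [cutSum, ih]

theorem cutSum_alternating_replicate (a : α) {n : ℕ} (hn : n ≠ 0) :
    cutSum (fun p s => shuffleL (ofWord p) ((-1 : ℚ) ^ s.length • ofWord s))
      (List.replicate n a) = 0 := by
  rw [cutSum_replicate]
  have : ∀ i ∈ Finset.range (n + 1),
      shuffleL (ofWord (List.replicate i a)) ((-1 : ℚ) ^ (List.replicate (n - i) a).length •
        ofWord (List.replicate (n - i) a)) =
      ((-1 : ℚ) ^ n * (((-1) ^ i * n.choose i : ℤ) : ℚ)) • ofWord (List.replicate n a) := by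
    intro i hi
    have hi : i ≤ n := by simpa [Nat.lt_succ_iff] using hi
    rw [map_smul, shuffleL_ofWord, shuffleWord_replicate, smul_smul, List.length_replicate,
      Nat.add_sub_cancel' hi]
    congr 1
    obtain ⟨k, rfl⟩ := Nat.exists_eq_add_of_le hi
    have h2 : ((-1 : ℚ) ^ i) * (-1) ^ i = 1 := by rw [← mul_pow]; simp
    push_cast
    rw [Nat.add_sub_cancel_left, pow_add]
    linear_combination (-((-1 : ℚ) ^ k) * (i + k).choose i) * h2
  rw [Finset.sum_congr rfl this, ← Finset.sum_smul, ← Finset.mul_sum, ← Int.cast_sum,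
    Int.alternating_sum_range_choose_of_ne hn]
  simp

end

end Hyperlogarithm

namespace Hyperlogarithm

noncomputable section

variable {α β M : Type*}

/-! ### Generation of the shuffle algebra by minimal words -/

theorem shuffleWord_mem_span (u v : List α) :
    shuffleWord u v ∈ Submodule.span ℚ {x | ∃ w : List α, w.Perm (u ++ v) ∧ x = ofWord w} := by
  induction u generalizing v with
  | nil =>
    rw [shuffleWord_nil_left]
    exact Submodule.subset_span ⟨v, List.Perm.refl _, rfl⟩
  | cons a u ihu =>
    induction v with
    | nil =>
      rw [shuffleWord_nil_right]
      exact Submodule.subset_span ⟨a :: u, by simp, rfl⟩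
    | cons b v ihv =>
      rw [shuffleWord_cons_cons]
      refine Submodule.add_mem _ ?_ ?_
      · refine Submodule.mem_comap.1
          ((Submodule.span_le (p := Submodule.comap (consL a) _)).2 ?_ (ihu (b :: v)))
        rintro _ ⟨w, hw, rfl⟩
        exact Submodule.subset_span ⟨a :: w, by simpa using hw, consL_ofWord _ _⟩
      · refine Submodule.mem_comap.1
          ((Submodule.span_le (p := Submodule.comap (consL b) _)).2 ?_ ihv)
        rintro _ ⟨w, hw, rfl⟩
        refine Submodule.subset_span ⟨b :: w, ?_, consL_ofWord _ _⟩
        exact (hw.cons b).trans List.perm_middle.symm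

theorem shuffleWord_snoc_sub_mem_span (u : List α) (σ : α) (v : List α) :
    shuffleWord (u ++ [σ]) v - ofWord (u ++ σ :: v) ∈ Submodule.span ℚ
      {x | ∃ p s : List α, s.length < v.length ∧ (p ++ s).Perm (u ++ v) ∧
        x = ofWord (p ++ σ :: s)} := by
  have step : ∀ (b : α) (u v : List α) (x : WordSpace α),
      x ∈ Submodule.span ℚ {x | ∃ p s : List α, s.length < v.length ∧
        (p ++ s).Perm (u ++ v) ∧ x = ofWord (p ++ σ :: s)} →
      ∀ u' v' : List α, v.length ≤ v'.length → (b :: (u ++ v)).Perm (u' ++ v') →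
      consL b x ∈ Submodule.span ℚ {x | ∃ p s : List α, s.length < v'.length ∧
        (p ++ s).Perm (u' ++ v') ∧ x = ofWord (p ++ σ :: s)} := by
    intro b u v x hx u' v' hl hperm
    refine Submodule.mem_comap.1
          ((Submodule.span_le (p := Submodule.comap (consL b) _)).2 ?_ hx)
    rintro _ ⟨p, s, hs, hps, rfl⟩
    exact Submodule.subset_span ⟨b :: p, s, hs.trans_le hl,
      (hps.cons b).trans hperm, consL_ofWord _ _⟩
  induction v generalizing u with
  | nil => simp [shuffleWord_nil_right]
  | cons b v ihv =>
    have second : ∀ u' : List α,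
        consL b (shuffleWord (u' ++ [σ]) v) ∈ Submodule.span ℚ {x | ∃ p s : List α,
          s.length < (b :: v).length ∧ (p ++ s).Perm (u' ++ b :: v) ∧
          x = ofWord (p ++ σ :: s)} := by
      intro u'
      have h := step b u' v _ (ihv u') u' (b :: v) (by simp) List.perm_middle.symm
      rw [map_sub, consL_ofWord] at h
      refine (Submodule.sub_mem_iff_left _ ?_).1 h
      exact Submodule.subset_span ⟨b :: u', v, by simp, List.perm_middle.symm, rfl⟩
    induction u with
    | nil =>
      have := second []
      simp only [List.nil_append] at this ⊢
      rw [shuffleWord_cons_cons, shuffleWord_nil_left, consL_ofWord, add_sub_cancel_left]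
      exact this
    | cons a u ihu =>
      have h1 := step a u (b :: v) _ ihu (a :: u) (b :: v) le_rfl (List.Perm.refl _)
      have h2 := second (a :: u)
      simp only [List.cons_append] at h1 h2 ⊢
      rw [shuffleWord_cons_cons]
      rw [map_sub, consL_ofWord] at h1
      convert Submodule.add_mem _ h1 h2 using 1
      abel

/-- The shuffle algebra is generated by the letters of infinite degree and the words whose last
letter has finite minimal degree. -/
theorem eq_top_of_minimal_mem (deg : α → WithTop ℤ)
    (hdeg : ∀ a b, deg a = ⊤ → deg b = ⊤ → a = b) (p : Submodule ℚ (WordSpace α))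
    (hone : ofWord [] ∈ p) (hzero : ∀ a, deg a = ⊤ → ofWord [a] ∈ p)
    (hmin : ∀ (u : List α) (a : α) (d : ℤ), deg a = d → (∀ b ∈ u, deg a ≤ deg b) →
      ofWord (u ++ [a]) ∈ p)
    (hmul : ∀ x ∈ p, ∀ y ∈ p, shuffleL x y ∈ p) : p = ⊤ := by
  have key : ∀ (n : ℕ) (w : List α), w.length = n → ofWord w ∈ p := by
    intro n
    induction n using Nat.strong_induction_on with
    | _ n ih =>
    intro w hw
    by_cases hfin : ∃ a ∈ w, deg a ≠ ⊤
    · have hex : ∃ a ∈ w, ∀ b ∈ w, deg a ≤ deg b := by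
        classical
        obtain ⟨a, ha, hmin⟩ := Finset.exists_min_image w.toFinset deg
          ⟨hfin.choose, by simpa using hfin.choose_spec.1⟩
        exact ⟨a, by simpa using ha, fun b hb => hmin b (by simpa using hb)⟩
      obtain ⟨a, ha, hle⟩ := hex
      obtain ⟨b, hb, hbt⟩ := hfin
      obtain ⟨d, hd⟩ := WithTop.ne_top_iff_exists.1 (ne_top_of_le_ne_top hbt (hle b hb))
      obtain ⟨x, y, rfl⟩ := List.append_of_mem ha
      have tail : ∀ (m : ℕ) (x y : List α), y.length = m → (x ++ a :: y).length = n →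
          (∀ b ∈ x ++ a :: y, deg a ≤ deg b) → ofWord (x ++ a :: y) ∈ p := by
        intro m
        induction m using Nat.strong_induction_on with
        | _ m ihm =>
        intro x y hy hn hle
        rcases Nat.eq_zero_or_pos m with rfl | hm
        · rw [List.length_eq_zero_iff] at hy
          subst hy
          exact hmin x a d hd.symm fun b hb => hle b (by simp [hb])
        · have h1 : ofWord (x ++ [a]) ∈ p :=
            hmin x a d hd.symm fun b hb => hle b (by simp [hb])
          have h2 : ofWord y ∈ p := by
            refine ih y.length ?_ y rfl
            rw [← hn]; simp; omega
          have h3 := hmul _ h1 _ h2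
          rw [shuffleL_ofWord] at h3
          have h4 := shuffleWord_snoc_sub_mem_span x a y
          have h5 : shuffleWord (x ++ [a]) y - ofWord (x ++ a :: y) ∈ p := by
            refine Submodule.span_le.2 ?_ h4
            rintro _ ⟨x', y', hl, hperm, rfl⟩
            refine ihm y'.length (hy ▸ hl) x' y' rfl ?_ ?_
            · have := hperm.length_eq
              simp only [List.length_append, List.length_cons] at this hn ⊢
              omega
            · intro b hb
              refine hle b ?_
              have := hperm.mem_iff (a := b)
              simp only [List.mem_append, List.mem_cons] at this hb ⊢
              tauto
          exact (Submodule.sub_mem_iff_right _ h3).1 h5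
      exact tail y.length x y rfl hw hle
    · push Not at hfin
      cases w with
      | nil => exact hone
      | cons a w =>
        have hrep : w = List.replicate w.length a :=
          List.eq_replicate_of_mem fun b hb =>
            hdeg b a (hfin b (by simp [hb])) (hfin a (by simp))
        have h1 := hmul _ (hzero a (hfin a (by simp))) _
          (ih w.length (by rw [← hw]; simp) w rfl)
        rw [shuffleL_ofWord, hrep, show [a] = List.replicate 1 a from rfl,
          shuffleWord_replicate] at h1
        rw [hrep, ← List.replicate_succ, add_comm]
        rwa [Submodule.smul_mem_iff] at h1
        simp only [Nat.choose_one_right]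
        positivity
  rw [eq_top_iff]
  intro x _
  induction x using Finsupp.induction_linear with
  | zero => exact p.zero_mem
  | add x y hx hy => exact p.add_mem (hx trivial) (hy trivial)
  | single w c =>
    have := p.smul_mem c (key _ w rfl)
    simpa [ofWord] using this

/-! ### The leading-word morphism -/

/-- The counit, followed by the unit. -/
def counit : WordSpace α →ₗ[ℚ] WordSpace β := subst 1 fun _ => none

theorem counit_of_ne_nil {w : List α} (hw : w ≠ []) :
    (counit : WordSpace α →ₗ[ℚ] WordSpace β) (ofWord w) = 0 := by
  obtain ⟨a, w, rfl⟩ := List.exists_cons_of_ne_nil hw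
  rw [counit, subst_ofWord, substWord_eq_zero 1 (a := a) (by simp) rfl]

variable (deg : α → WithTop ℤ) (lc : α → β) (z : β)

/-- The limit of a letter rescaled by its degree `d`; letters of smaller degree are sent to
zero. -/
def limitLetter (d : ℤ) (a : α) : Option β :=
  open Classical in
  if (d : WithTop ℤ) ≤ deg a then some (if deg a = d then lc a else z) else none

/-- Letters of degree greater than `d` are sent to the letter `z`, all others to zero. -/
def vanishingLetter (d : ℤ) (a : α) : Option β :=
  open Classical in if (d : WithTop ℤ) < deg a then some z else none

/-- The limit of words rescaled in degree `d`, regularized at the last letter. -/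
def scaleHom (d : ℤ) : WordSpace α →ₗ[ℚ] WordSpace β :=
  conv (subst 1 (limitLetter deg lc z d)) (subst (-1) (vanishingLetter deg z d))

theorem isShuffleHom_scaleHom (d : ℤ) : IsShuffleHom (scaleHom deg lc z d) :=
  (isShuffleHom_subst _ _).conv (isShuffleHom_subst _ _)

theorem scaleHom_of_lt {d : ℤ} {w : List α} {a : α} (ha : a ∈ w) (h : deg a < d) :
    scaleHom deg lc z d (ofWord w) = 0 := by
  rw [scaleHom, conv_ofWord, cutSum_congr (h' := fun _ _ => 0), cutSum_zero]
  intro p s hps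
  rw [← hps, List.mem_append] at ha
  rw [subst_ofWord, subst_ofWord]
  rcases ha with ha | ha
  · rw [substWord_eq_zero 1 ha (by simp [limitLetter, not_le.2 h]), map_zero, LinearMap.zero_apply]
  · rw [substWord_eq_zero (-1) ha (by simp [vanishingLetter, not_lt.2 h.le]), map_zero]

theorem scaleHom_eq_counit {d : ℤ} {w : List α} (h : ∀ a ∈ w, deg a ≠ d) :
    scaleHom deg lc z d (ofWord w) = counit (ofWord w) := by
  rcases eq_or_ne w [] with rfl | hw
  · rw [(isShuffleHom_scaleHom deg lc z d).map_one, counit, (isShuffleHom_subst _ _).map_one]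
  rw [counit_of_ne_nil hw]
  by_cases hlt : ∃ a ∈ w, deg a < d
  · obtain ⟨a, ha, hlt⟩ := hlt
    exact scaleHom_of_lt deg lc z ha hlt
  push Not at hlt
  have hgt : ∀ a ∈ w, (d : WithTop ℤ) < deg a := fun a ha => (hlt a ha).lt_of_ne (h a ha).symm
  rw [scaleHom, conv_ofWord]
  have := cutSum_alternating_replicate z (n := w.length) (by simpa using hw)
  rw [← List.map_const', cutSum_map] at this
  rw [← this]
  refine cutSum_congr fun p s hps => ?_
  rw [subst_ofWord, subst_ofWord, substWord_of_some 1 (fun _ => z), substWord_of_some (-1)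
    (fun _ => z)]
  · simp
  · intro a ha
    simp [vanishingLetter, hgt a (by simp [← hps, ha])]
  · intro a ha
    have ha' : a ∈ w := by simp [← hps, ha]
    simp [limitLetter, hlt a ha', h a ha']

theorem scaleHom_minimal {d : ℤ} {u : List α} {a : α} (ha : deg a = d)
    (hu : ∀ b ∈ u, deg a ≤ deg b) :
    open Classical in scaleHom deg lc z d (ofWord (u ++ [a])) =
      ofWord ((u ++ [a]).map fun b => if deg b = d then lc b else z) := by
  classical
  rw [scaleHom, conv_ofWord, cutSum_eq_left]
  · rw [(isShuffleHom_subst _ _).map_one, shuffleL_one_right, subst_ofWord,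
      substWord_of_some 1 fun b => if deg b = d then lc b else z]
    · simp
    · intro b hb
      have : (d : WithTop ℤ) ≤ deg b := by
        rcases List.mem_append.1 hb with hb | hb
        · exact ha ▸ hu b hb
        · simp only [List.mem_singleton] at hb; simp [hb, ha]
      simp [limitLetter, this]
  · intro p s hps hs
    have has : a ∈ s := by
      obtain ⟨s', b, rfl⟩ := s.eq_nil_or_concat.resolve_left hs
      rw [List.concat_eq_append, ← List.append_assoc] at hps
      have := (List.append_inj' hps rfl).2
      simp only [List.cons.injEq, and_true] at this
      simp [this]
    rw [subst_ofWord (-1), substWord_eq_zero (-1) has (by simp [vanishingLetter, ha]), map_zero]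

/-- The convolution product of the maps `scaleHom d` for `d` in a list. -/
def scaleHoms : List ℤ → (WordSpace α →ₗ[ℚ] WordSpace β)
  | [] => counit
  | d :: ds => conv (scaleHom deg lc z d) (scaleHoms ds)

theorem isShuffleHom_scaleHoms (ds : List ℤ) : IsShuffleHom (scaleHoms deg lc z ds) := by
  induction ds with
  | nil => exact isShuffleHom_subst _ _
  | cons d ds ih => exact (isShuffleHom_scaleHom deg lc z d).conv ih

theorem conv_counit_left {f g : WordSpace α →ₗ[ℚ] WordSpace β} {w : List α}
    (hf : ∀ p s, p ++ s = w → f (ofWord p) = counit (ofWord p)) :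
    conv f g (ofWord w) = g (ofWord w) := by
  rw [conv_ofWord, cutSum_eq_right, hf [] w rfl, counit, (isShuffleHom_subst _ _).map_one,
    shuffleL_one_left]
  intro p s hps hp
  rw [hf p s hps, counit_of_ne_nil hp, map_zero, LinearMap.zero_apply]

theorem scaleHoms_filter (E : Finset ℤ) (ds : List ℤ) {w : List α}
    (h : ∀ a ∈ w, ∀ d : ℤ, deg a = d → d ∈ E) :
    scaleHoms deg lc z ds (ofWord w) = scaleHoms deg lc z (ds.filter (· ∈ E)) (ofWord w) := by
  induction ds generalizing w with
  | nil => rfl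
  | cons d ds ih =>
    by_cases hd : d ∈ E
    · rw [List.filter_cons_of_pos (by simpa using hd), scaleHoms, scaleHoms, conv_ofWord,
        conv_ofWord]
      refine cutSum_congr fun p s hps => ?_
      rw [ih fun a ha => h a (by simp [← hps, ha])]
    · rw [List.filter_cons_of_neg (by simpa using hd), ← ih h, scaleHoms, conv_counit_left]
      intro p s hps
      refine scaleHom_eq_counit deg lc z fun a ha had => hd ?_
      exact h a (by simp [← hps, ha]) d had

theorem scaleHoms_of_last_lt {ds : List ℤ} {a : α} (h : ∀ d ∈ ds, deg a < d) (u : List α) :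
    scaleHoms deg lc z ds (ofWord (u ++ [a])) = 0 := by
  induction ds generalizing u with
  | nil => exact counit_of_ne_nil (by simp)
  | cons d ds ih =>
    rw [scaleHoms, conv_ofWord, cutSum_congr (h' := fun _ _ => 0), cutSum_zero]
    intro p s hps
    rcases s.eq_nil_or_concat with rfl | ⟨s', b, rfl⟩
    · rw [scaleHom_of_lt deg lc z (a := a) (by rw [← List.append_nil p, hps]; simp)
        (h d (by simp)), map_zero, LinearMap.zero_apply]
    · rw [List.concat_eq_append, ← List.append_assoc] at hps
      have := (List.append_inj' hps rfl).2
      simp only [List.cons.injEq, and_true] at this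
      subst this
      rw [List.concat_eq_append, ih fun d hd => h d (by simp [hd]), map_zero]

theorem scaleHoms_minimal {d : ℤ} {u : List α} {a : α} (ha : deg a = d)
    (hu : ∀ b ∈ u, deg a ≤ deg b) {ds : List ℤ} (hds : ds.Pairwise (· < ·)) (hd : d ∈ ds) :
    open Classical in scaleHoms deg lc z ds (ofWord (u ++ [a])) =
      ofWord ((u ++ [a]).map fun b => if deg b = d then lc b else z) := by
  classical
  induction ds with
  | nil => simp at hd
  | cons e ds ih =>
    rw [List.pairwise_cons] at hds
    rcases List.mem_cons.1 hd with rfl | hd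
    · rw [scaleHoms, conv_ofWord, cutSum_eq_left, (isShuffleHom_scaleHoms _ _ _ _).map_one,
        shuffleL_one_right, scaleHom_minimal deg lc z ha hu]
      intro p s hps hs
      obtain ⟨s', b, rfl⟩ := s.eq_nil_or_concat.resolve_left hs
      rw [List.concat_eq_append, ← List.append_assoc] at hps
      have := (List.append_inj' hps rfl).2
      simp only [List.cons.injEq, and_true] at this
      subst this
      rw [List.concat_eq_append, scaleHoms_of_last_lt, map_zero]
      intro e he
      rw [ha]
      exact_mod_cast hds.1 e he
    · rw [scaleHoms, conv_counit_left, ih hds.2 hd]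
      intro p s hps
      refine scaleHom_eq_counit deg lc z fun b hb hbe => ?_
      have h1 : b ∈ u ++ [a] := by rw [← hps]; simp [hb]
      have h2 : deg a ≤ deg b := by
        rcases List.mem_append.1 h1 with h1 | h1
        · exact hu b h1
        · simp only [List.mem_singleton] at h1; simp [h1]
      rw [ha, hbe] at h2
      have h3 : d ≤ e := by exact_mod_cast h2
      exact absurd (hds.1 d hd) (not_lt.2 h3)

/-- The set of finite degrees of the letters of a word. -/
def degSet (w : List α) : Finset ℤ :=
  Set.Finite.toFinset (s := {d : ℤ | ∃ a ∈ w, deg a = d}) <| by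
    refine Set.Finite.subset ((List.finite_toSet w).image fun a => (deg a).untopD 0) ?_
    rintro d ⟨a, ha, had⟩
    exact ⟨a, ha, by simp [had]⟩

theorem mem_degSet {w : List α} {d : ℤ} : d ∈ degSet deg w ↔ ∃ a ∈ w, deg a = d := by
  simp [degSet]

/-- The morphism sending a word to its leading word as all letters degenerate. -/
def leadingHom : WordSpace α →ₗ[ℚ] WordSpace β :=
  Finsupp.linearCombination ℚ fun w => scaleHoms deg lc z ((degSet deg w).sort (· ≤ ·)) (ofWord w)

theorem leadingHom_ofWord (w : List α) : leadingHom deg lc z (ofWord w) =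
    scaleHoms deg lc z ((degSet deg w).sort (· ≤ ·)) (ofWord w) := by
  simp [leadingHom, ofWord]

theorem leadingHom_ofWord_of_subset {E : Finset ℤ} {w : List α} (h : degSet deg w ⊆ E) :
    leadingHom deg lc z (ofWord w) = scaleHoms deg lc z (E.sort (· ≤ ·)) (ofWord w) := by
  rw [leadingHom_ofWord, scaleHoms_filter deg lc z (degSet deg w) (E.sort (· ≤ ·))]
  · congr 2
    refine List.Perm.eq_of_pairwise' ?_ ?_ ?_ (r := (· ≤ ·))
    · exact Finset.pairwise_sort _ _
    · exact (Finset.pairwise_sort _ _).filter _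
    · refine (List.perm_ext_iff_of_nodup (Finset.sort_nodup _ _)
        ((Finset.sort_nodup _ _).filter _)).2 fun d => ?_
      simp only [Finset.mem_sort, List.mem_filter, decide_eq_true_eq]
      exact ⟨fun hd => ⟨h hd, hd⟩, fun hd => hd.2⟩
  · intro a ha d had
    exact (mem_degSet deg).2 ⟨a, ha, had⟩

theorem isShuffleHom_leadingHom : IsShuffleHom (leadingHom deg lc z) where
  map_one := by rw [leadingHom_ofWord, (isShuffleHom_scaleHoms _ _ _ _).map_one]
  map_shuffleWord u v := by
    have hu : degSet deg u ⊆ degSet deg (u ++ v) := fun d hd => by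
      obtain ⟨a, ha, had⟩ := (mem_degSet deg).1 hd
      exact (mem_degSet deg).2 ⟨a, by simp [ha], had⟩
    have hv : degSet deg v ⊆ degSet deg (u ++ v) := fun d hd => by
      obtain ⟨a, ha, had⟩ := (mem_degSet deg).1 hd
      exact (mem_degSet deg).2 ⟨a, by simp [ha], had⟩
    rw [leadingHom_ofWord_of_subset deg lc z hu, leadingHom_ofWord_of_subset deg lc z hv,
      ← (isShuffleHom_scaleHoms deg lc z _).map_shuffleWord]
    refine (Submodule.span_le (p := LinearMap.eqLocus _ _)).2 ?_ (shuffleWord_mem_span u v)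
    rintro _ ⟨w, hw, rfl⟩
    refine leadingHom_ofWord_of_subset deg lc z fun d hd => ?_
    obtain ⟨a, ha, had⟩ := (mem_degSet deg).1 hd
    exact (mem_degSet deg).2 ⟨a, hw.mem_iff.1 ha, had⟩

theorem leadingHom_minimal {d : ℤ} {u : List α} {a : α} (ha : deg a = d)
    (hu : ∀ b ∈ u, deg a ≤ deg b) :
    open Classical in leadingHom deg lc z (ofWord (u ++ [a])) =
      ofWord ((u ++ [a]).map fun b => if deg b = d then lc b else z) := by
  rw [leadingHom_ofWord]
  refine scaleHoms_minimal deg lc z ha hu ?_ ?_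
  · exact Finset.sortedLT_sort _ |>.pairwise
  · rw [Finset.mem_sort]
    exact (mem_degSet deg).2 ⟨a, by simp, ha⟩

theorem leadingHom_of_top {a : α} (ha : deg a = ⊤) : leadingHom deg lc z (ofWord [a]) = 0 := by
  have : degSet deg [a] = ∅ := by
    ext d
    simp [mem_degSet, ha]
  rw [leadingHom_ofWord, this, Finset.sort_empty, scaleHoms, counit_of_ne_nil (by simp)]

end

end Hyperlogarithm

namespace Hyperlogarithm

noncomputable section

open Filter Topology

/-! ### Regularized limits -/

theorem exists_abs_log_pow_le (k : ℕ) :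
    ∃ C : ℝ, 0 ≤ C ∧ ∀ x : ℝ, 0 < x → |Real.log x| ^ k * √x ≤ C * (1 + x) := by
  rcases Nat.eq_zero_or_pos k with rfl | hk
  · refine ⟨1, zero_le_one, fun x hx => ?_⟩
    have := Real.sq_sqrt hx.le
    nlinarith [sq_nonneg (√x - 1)]
  have hk' : (0 : ℝ) < k := by exact_mod_cast hk
  have large : ∀ x : ℝ, 1 ≤ x → |Real.log x| ^ k ≤ (2 * k) ^ k * √x := by
    intro x hx
    have hx0 : 0 < x := by linarith
    have h1 : |Real.log x| ≤ (2 * k) * x ^ (1 / (2 * k) : ℝ) := by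
      rw [abs_of_nonneg (Real.log_nonneg hx)]
      have := Real.log_le_rpow_div hx0.le (ε := 1 / (2 * k)) (by positivity)
      rw [div_div_eq_mul_div, div_one, mul_comm] at this
      exact this
    calc |Real.log x| ^ k ≤ ((2 * k) * x ^ (1 / (2 * k) : ℝ)) ^ k :=
          pow_le_pow_left₀ (abs_nonneg _) h1 k
      _ = (2 * k) ^ k * √x := by
          rw [mul_pow, ← Real.rpow_natCast (x ^ _), ← Real.rpow_mul hx0.le, Real.sqrt_eq_rpow]
          congr 2
          field_simp
  refine ⟨(2 * k) ^ k, by positivity, fun x hx => ?_⟩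
  have hs := Real.sq_sqrt hx.le
  have hspos := Real.sqrt_pos.2 hx
  rcases le_total 1 x with h | h
  · have := mul_le_mul_of_nonneg_right (large x h) hspos.le
    have hp : (0 : ℝ) ≤ (2 * k) ^ k := by positivity
    nlinarith
  · have := large x⁻¹ ((one_le_inv₀ hx).2 h)
    rw [Real.log_inv, abs_neg, Real.sqrt_inv, ← div_eq_mul_inv, le_div_iff₀ hspos] at this
    have hp : (0 : ℝ) ≤ (2 * k) ^ k := by positivity
    nlinarith

theorem tendsto_mul_log_pow (k : ℕ) :
    Tendsto (fun t : ℝ => t * |Real.log t| ^ k) (𝓝[>] 0) (𝓝 0) := by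
  obtain ⟨C, -, hC⟩ := exists_abs_log_pow_le k
  have h0 : Tendsto (fun t : ℝ => √t * (C * (1 + t))) (𝓝[>] 0) (𝓝 0) := by
    have : ContinuousAt (fun t : ℝ => √t * (C * (1 + t))) 0 := by fun_prop
    have := this.tendsto
    simp only [Real.sqrt_zero, zero_mul] at this
    exact this.mono_left nhdsWithin_le_nhds
  refine squeeze_zero' ?_ ?_ h0
  · filter_upwards [self_mem_nhdsWithin] with t (ht : 0 < t)
    positivity
  · filter_upwards [self_mem_nhdsWithin] with t (ht : 0 < t)
    have := mul_le_mul_of_nonneg_left (hC t ht) (Real.sqrt_nonneg t)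
    calc t * |Real.log t| ^ k = √t * (|Real.log t| ^ k * √t) := by
          nth_rewrite 1 [← Real.mul_self_sqrt ht.le]; ring
      _ ≤ _ := this

theorem hasRegLimAtTop_iff {F : ℝ → ℂ} {c : ℂ} :
    HasRegLimAtTop F c ↔ HasRegLimAtZero (fun s => F (1 / s)) c := by
  constructor
  · rintro ⟨n, f, hf, hF, hc⟩
    refine ⟨n, fun i z => (-1) ^ i * f i z, fun i => analyticAt_const.mul (hf i), ?_, by simpa⟩
    filter_upwards [tendsto_inv_nhdsGT_zero.eventually hF] with s hs
    rw [one_div, hs]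
    refine Finset.sum_congr rfl fun i _ => ?_
    rw [Real.log_inv]
    push_cast
    rw [one_div, inv_inv, neg_pow]
    ring
  · rintro ⟨n, f, hf, hF, hc⟩
    refine ⟨n, fun i z => (-1) ^ i * f i z, fun i => analyticAt_const.mul (hf i), ?_, by simpa⟩
    filter_upwards [tendsto_inv_atTop_nhdsGT_zero.eventually hF] with s hs
    rw [one_div, inv_inv] at hs
    rw [hs]
    refine Finset.sum_congr rfl fun i _ => ?_
    rw [Real.log_inv]
    push_cast
    rw [one_div, neg_pow]
    ring

namespace HasRegLimAtZero

variable {F G : ℝ → ℂ} {c d : ℂ}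

theorem congr (h : HasRegLimAtZero F c) (hFG : ∀ᶠ t in 𝓝[>] 0, F t = G t) :
    HasRegLimAtZero G c := by
  obtain ⟨n, f, hf, hF, hc⟩ := h
  refine ⟨n, f, hf, ?_, hc⟩
  filter_upwards [hF, hFG] with t h1 h2
  rw [← h2, h1]

theorem exists_forall_le (h : HasRegLimAtZero F c) :
    ∃ (n : ℕ) (f : ℕ → ℂ → ℂ), (∀ i, AnalyticAt ℂ (f i) 0) ∧
      (∀ N, n ≤ N → ∀ᶠ t : ℝ in 𝓝[>] 0,
        F t = ∑ i ∈ Finset.range (N + 1), f i (t : ℂ) * (Real.log t : ℂ) ^ i) ∧ f 0 0 = c := by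
  obtain ⟨n, f, hf, hF, hc⟩ := h
  refine ⟨n, fun i => if i ≤ n then f i else 0, fun i => ?_, fun N hN => ?_, by simpa⟩
  · by_cases hi : i ≤ n
    · simpa [hi] using hf i
    · simp only [hi, if_false]
      exact (analyticAt_const : AnalyticAt ℂ (fun _ : ℂ => (0 : ℂ)) 0)
  · filter_upwards [hF] with t ht
    rw [ht]
    refine (Finset.sum_subset_zero_on_sdiff (Finset.range_mono (by omega)) ?_ ?_)
    · intro i hi
      simp only [Finset.mem_sdiff, Finset.mem_range] at hi
      simp [show ¬ i ≤ n by omega]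
    · intro i hi
      simp only [Finset.mem_range] at hi
      simp [show i ≤ n by omega]

theorem add (hF : HasRegLimAtZero F c) (hG : HasRegLimAtZero G d) :
    HasRegLimAtZero (fun t => F t + G t) (c + d) := by
  obtain ⟨n, f, hf, hF, hc⟩ := hF.exists_forall_le
  obtain ⟨m, g, hg, hG, hd⟩ := hG.exists_forall_le
  refine ⟨max n m, fun i z => f i z + g i z, fun i => (hf i).add (hg i), ?_, by simp [hc, hd]⟩
  filter_upwards [hF _ (le_max_left n m), hG _ (le_max_right n m)] with t h1 h2
  simp only [h1, h2, add_mul, Finset.sum_add_distrib]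

theorem analytic_mul {g : ℂ → ℂ} (hg : AnalyticAt ℂ g 0) (hF : HasRegLimAtZero F c) :
    HasRegLimAtZero (fun t => g t * F t) (g 0 * c) := by
  obtain ⟨n, f, hf, hF, hc⟩ := hF
  refine ⟨n, fun i z => g z * f i z, fun i => hg.mul (hf i), ?_, by simp [hc]⟩
  filter_upwards [hF] with t h1
  simp only [h1, Finset.mul_sum, mul_assoc]

theorem log_mul (hF : HasRegLimAtZero F c) :
    HasRegLimAtZero (fun t => (Real.log t : ℂ) * F t) 0 := by
  obtain ⟨n, f, hf, hF, hc⟩ := hF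
  refine ⟨n + 1, fun i => if i = 0 then 0 else f (i - 1), fun i => ?_, ?_, by simp⟩
  · by_cases hi : i = 0
    · simp only [hi, if_true]
      exact (analyticAt_const : AnalyticAt ℂ (fun _ : ℂ => (0 : ℂ)) 0)
    · simpa [hi] using hf (i - 1)
  · filter_upwards [hF] with t h1
    rw [h1, Finset.sum_range_succ' _ (n + 1), Finset.mul_sum]
    simp only [Nat.add_eq_zero_iff, one_ne_zero, and_false, if_false, Nat.add_sub_cancel,
      if_true, Pi.zero_apply, zero_mul, add_zero]
    exact Finset.sum_congr rfl fun i _ => by ring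

theorem of_analytic {g : ℂ → ℂ} (hg : AnalyticAt ℂ g 0) :
    HasRegLimAtZero (fun t => g t) (g 0) :=
  ⟨0, fun _ => g, fun _ => hg, by simp, rfl⟩

theorem const (c : ℂ) : HasRegLimAtZero (fun _ => c) c :=
  of_analytic (g := fun _ => c) analyticAt_const

theorem const_mul (a : ℂ) (hF : HasRegLimAtZero F c) :
    HasRegLimAtZero (fun t => a * F t) (a * c) :=
  analytic_mul (g := fun _ => a) analyticAt_const hF

theorem neg (hF : HasRegLimAtZero F c) : HasRegLimAtZero (fun t => - F t) (-c) := by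
  simpa using hF.const_mul (-1)

theorem sub (hF : HasRegLimAtZero F c) (hG : HasRegLimAtZero G d) :
    HasRegLimAtZero (fun t => F t - G t) (c - d) := by
  simpa only [sub_eq_add_neg] using hF.add hG.neg

theorem log_pow_mul (k : ℕ) (hF : HasRegLimAtZero F c) :
    HasRegLimAtZero (fun t => (Real.log t : ℂ) ^ k * F t) (if k = 0 then c else 0) := by
  induction k with
  | zero => simpa using hF
  | succ k ih =>
    refine ih.log_mul.congr (Eventually.of_forall fun t => ?_)
    simp only [pow_succ']
    ring

theorem sum {ι : Type*} (s : Finset ι) {F : ι → ℝ → ℂ} {c : ι → ℂ}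
    (h : ∀ i ∈ s, HasRegLimAtZero (F i) (c i)) :
    HasRegLimAtZero (fun t => ∑ i ∈ s, F i t) (∑ i ∈ s, c i) := by
  classical
  induction s using Finset.induction_on with
  | empty => simpa using const 0
  | insert i s hi ih =>
    simp only [Finset.sum_insert hi]
    exact (h i (by simp)).add (ih fun j hj => h j (by simp [hj]))

theorem mul (hF : HasRegLimAtZero F c) (hG : HasRegLimAtZero G d) :
    HasRegLimAtZero (fun t => F t * G t) (c * d) := by
  obtain ⟨n, f, hf, hF, hc⟩ := hF
  have h := sum (Finset.range (n + 1)) fun i _ => (hG.log_pow_mul i).analytic_mul (hf i)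
  rw [Finset.sum_range_succ'] at h
  simp only [Nat.add_eq_zero_iff, one_ne_zero, and_false, if_false, mul_zero,
    Finset.sum_const_zero, zero_add, if_true, hc] at h
  refine h.congr ?_
  filter_upwards [hF] with t ht
  rw [ht, Finset.sum_mul]
  exact Finset.sum_congr rfl fun i _ => by ring

theorem eq_of_tendsto (hF : HasRegLimAtZero F c) (hd : Tendsto F (𝓝[>] 0) (𝓝 d)) : c = d := by
  obtain ⟨n, f, hf, hF, hc⟩ := hF
  let P : Polynomial ℂ := ∑ i ∈ Finset.range (n + 1), Polynomial.monomial i (f i 0)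
  have hP : ∀ z : ℂ, P.eval z = ∑ i ∈ Finset.range (n + 1), f i 0 * z ^ i := fun z => by
    simp [P, Polynomial.eval_finsetSum]
  have hP0 : P.coeff 0 = c := by
    simp [P, Polynomial.coeff_monomial, hc]
  have hdiff : Tendsto (fun t : ℝ => F t - P.eval (Real.log t : ℂ)) (𝓝[>] 0) (𝓝 0) := by
    have h1 : Tendsto (fun t : ℝ => ∑ i ∈ Finset.range (n + 1),
        (f i t - f i 0) * (Real.log t : ℂ) ^ i) (𝓝[>] 0) (𝓝 0) := by
      suffices h : Tendsto (fun t : ℝ => ∑ i ∈ Finset.range (n + 1),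
          (f i t - f i 0) * (Real.log t : ℂ) ^ i) (𝓝[>] 0)
          (𝓝 (∑ _i ∈ Finset.range (n + 1), 0)) by rwa [Finset.sum_const_zero] at h
      refine tendsto_finsetSum _ fun i _ => ?_
      have hO : (fun t : ℝ => f i t - f i 0) =O[𝓝[>] 0] fun t : ℝ => t := by
        have h2 : (fun z : ℂ => f i z - f i 0) =O[𝓝 0] fun z => z - 0 :=
          (hf i).differentiableAt.isBigO_sub
        have h3 : Tendsto (fun t : ℝ => (t : ℂ)) (𝓝[>] 0) (𝓝 0) := by
          have : Tendsto (fun t : ℝ => (t : ℂ)) (𝓝 0) (𝓝 ((0 : ℝ) : ℂ)) :=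
            Complex.continuous_ofReal.tendsto 0
          simpa using this.mono_left nhdsWithin_le_nhds
        refine (h2.comp_tendsto h3).trans ?_
        refine Asymptotics.IsBigO.of_bound 1 (Eventually.of_forall fun t => ?_)
        simp
      have hO2 : (fun t : ℝ => (f i t - f i 0) * (Real.log t : ℂ) ^ i) =O[𝓝[>] 0]
          fun t : ℝ => t * |Real.log t| ^ i := by
        refine hO.mul (Asymptotics.IsBigO.of_bound 1 (Eventually.of_forall fun t => ?_))
        simp
      exact hO2.trans_tendsto (tendsto_mul_log_pow i)
    refine h1.congr' ?_
    filter_upwards [hF] with t ht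
    rw [ht, hP, ← Finset.sum_sub_distrib]
    exact Finset.sum_congr rfl fun i _ => by ring
  have hPlim : Tendsto (fun t : ℝ => P.eval (Real.log t : ℂ)) (𝓝[>] 0) (𝓝 d) := by
    have := hd.sub hdiff
    simpa using this
  have hdeg : P.degree ≤ 0 := by
    by_contra hcon
    have hlog : Tendsto (fun t : ℝ => ‖(Real.log t : ℂ)‖) (𝓝[>] 0) atTop := by
      simp only [Complex.norm_real]
      exact tendsto_abs_atBot_atTop.comp Real.tendsto_log_nhdsGT_zero
    exact not_tendsto_nhds_of_tendsto_atTop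
      (P.tendsto_norm_atTop (not_le.1 hcon) hlog) _ hPlim.norm
  rw [Polynomial.eq_C_of_degree_le_zero hdeg, hP0] at hPlim
  simp only [Polynomial.eval_C] at hPlim
  exact tendsto_nhds_unique tendsto_const_nhds hPlim

theorem unique (h : HasRegLimAtZero F c) (h' : HasRegLimAtZero F d) : c = d := by
  have := (h.sub h').eq_of_tendsto (d := 0) (by simp)
  exact sub_eq_zero.1 this

end HasRegLimAtZero

theorem HasRegLimAtZero.regLimAtZero_eq {F : ℝ → ℂ} {c : ℂ} (h : HasRegLimAtZero F c) :
    regLimAtZero F = c :=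
  (Classical.epsilon_spec ⟨c, h⟩ : HasRegLimAtZero F (regLimAtZero F)).unique h

theorem HasRegLimAtTop.unique {F : ℝ → ℂ} {c d : ℂ} (h : HasRegLimAtTop F c)
    (h' : HasRegLimAtTop F d) : c = d :=
  (hasRegLimAtTop_iff.1 h).unique (hasRegLimAtTop_iff.1 h')

theorem HasRegLimAtTop.regLimAtTop_eq {F : ℝ → ℂ} {c : ℂ} (h : HasRegLimAtTop F c) :
    regLimAtTop F = c :=
  (Classical.epsilon_spec ⟨c, h⟩ : HasRegLimAtTop F (regLimAtTop F)).unique h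

/-! ### Integration of logarithmic expansions -/

theorem exists_analytic_primitive {g : ℂ → ℂ} (hg : AnalyticAt ℂ g 0) :
    ∃ P : ℂ → ℂ, AnalyticAt ℂ P 0 ∧ ∀ᶠ z in 𝓝 0, HasDerivAt P (g z) z := by
  obtain ⟨r, hr, hball⟩ := Metric.eventually_nhds_iff_ball.1 hg.eventually_analyticAt
  have hd : DifferentiableOn ℂ g (Metric.ball 0 r) :=
    fun z hz => (hball z hz).differentiableAt.differentiableWithinAt
  obtain ⟨P, hP⟩ := hd.isExactOn_ball
  refine ⟨P, ?_, ?_⟩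
  · have : DifferentiableOn ℂ P (Metric.ball 0 r) :=
      fun z hz => (hP z hz).differentiableAt.differentiableWithinAt
    exact this.analyticAt (Metric.ball_mem_nhds 0 hr)
  · exact Filter.mem_of_superset (Metric.ball_mem_nhds 0 hr) hP

theorem exists_analytic_eq_add_mul {g : ℂ → ℂ} (hg : AnalyticAt ℂ g 0) :
    ∃ h : ℂ → ℂ, AnalyticAt ℂ h 0 ∧ ∀ z, g z = g 0 + z * h z := by
  obtain ⟨p, hp⟩ := hg
  refine ⟨dslope g 0, ⟨_, hp.has_fpower_series_dslope_fslope⟩, fun z => ?_⟩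
  have := sub_smul_dslope g 0 z
  simp only [sub_zero, smul_eq_mul] at this
  rw [this]; ring

theorem tendsto_ofReal_nhdsGT_zero : Tendsto (fun t : ℝ => (t : ℂ)) (𝓝[>] 0) (𝓝 0) := by
  have : Tendsto (fun t : ℝ => (t : ℂ)) (𝓝 0) (𝓝 ((0 : ℝ) : ℂ)) :=
    Complex.continuous_ofReal.tendsto 0
  simpa using this.mono_left nhdsWithin_le_nhds

theorem hasDerivAt_ofReal_log_pow (n : ℕ) {t : ℝ} (ht : 0 < t) :
    HasDerivAt (fun t : ℝ => (Real.log t : ℂ) ^ (n + 1))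
      ((n + 1) * (Real.log t : ℂ) ^ n / t) t := by
  have h := ((Real.hasDerivAt_log ht.ne').ofReal_comp).fun_pow (n + 1)
  refine h.congr_deriv ?_
  rw [Nat.add_sub_cancel]
  push_cast
  ring

theorem exists_primitive_log_pow (n : ℕ) {g : ℂ → ℂ} (hg : AnalyticAt ℂ g 0) :
    ∃ (F : ℝ → ℂ) (c : ℂ), HasRegLimAtZero F c ∧
      ∀ᶠ t : ℝ in 𝓝[>] 0, HasDerivAt F (g t * (Real.log t : ℂ) ^ n / t) t := by
  induction n generalizing g with
  | zero =>
    obtain ⟨h, hh, hgh⟩ := exists_analytic_eq_add_mul hg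
    obtain ⟨P, hP, hPd⟩ := exists_analytic_primitive hh
    refine ⟨fun t => g 0 * (Real.log t : ℂ) ^ (0 + 1) + P t, _,
      HasRegLimAtZero.add (c := g 0 * 0) (HasRegLimAtZero.const_mul _ ?_)
        (HasRegLimAtZero.of_analytic hP), ?_⟩
    · simpa using (HasRegLimAtZero.const 1).log_mul
    · filter_upwards [tendsto_ofReal_nhdsGT_zero.eventually hPd, self_mem_nhdsWithin]
        with t h1 (h2 : 0 < t)
      have := ((hasDerivAt_ofReal_log_pow 0 h2).const_mul (g 0)).add h1.comp_ofReal
      refine HasDerivAt.congr_deriv this ?_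
      have : (t : ℂ) ≠ 0 := by exact_mod_cast h2.ne'
      rw [hgh t]
      field_simp
      push_cast
      ring
  | succ n ih =>
    obtain ⟨h, hh, hgh⟩ := exists_analytic_eq_add_mul hg
    obtain ⟨P, hP, hPd⟩ := exists_analytic_primitive hh
    obtain ⟨F₁, c₁, hF₁, hF₁d⟩ := ih hP
    have hlog : HasRegLimAtZero (fun t => (Real.log t : ℂ) ^ (n + 1 + 1)) 0 := by
      simpa using (HasRegLimAtZero.const 1).log_pow_mul (n + 1 + 1)
    have hlog' : HasRegLimAtZero (fun t => (Real.log t : ℂ) ^ (n + 1)) 0 := by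
      simpa using (HasRegLimAtZero.const 1).log_pow_mul (n + 1)
    refine ⟨fun t => g 0 / (n + 2) * (Real.log t : ℂ) ^ (n + 1 + 1) +
      (P t * (Real.log t : ℂ) ^ (n + 1) - (n + 1) * F₁ t), _,
      (hlog.const_mul _).add ((hlog'.analytic_mul hP).sub (hF₁.const_mul (n + 1))), ?_⟩
    filter_upwards [tendsto_ofReal_nhdsGT_zero.eventually hPd, self_mem_nhdsWithin, hF₁d]
      with t h1 (h2 : 0 < t) h3
    have := ((hasDerivAt_ofReal_log_pow (n + 1) h2).const_mul (g 0 / (n + 2))).add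
      ((h1.comp_ofReal.mul (hasDerivAt_ofReal_log_pow n h2)).sub (h3.const_mul (n + 1 : ℂ)))
    refine HasDerivAt.congr_deriv this ?_
    have : (t : ℂ) ≠ 0 := by exact_mod_cast h2.ne'
    have h4 : (n : ℂ) + 2 ≠ 0 := by exact_mod_cast (by omega : n + 2 ≠ 0)
    rw [hgh t]
    push_cast
    field_simp
    ring

/-- A function whose logarithmic derivative has a logarithmic expansion has one itself. -/
theorem exists_hasRegLimAtZero_of_hasDerivAt {F F' : ℝ → ℂ} {c : ℂ}
    (hF : ∀ᶠ t : ℝ in 𝓝[>] 0, HasDerivAt F (F' t) t)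
    (h : HasRegLimAtZero (fun t => t * F' t) c) : ∃ d, HasRegLimAtZero F d := by
  obtain ⟨n, f, hf, hF', hc⟩ := h
  choose P p hP hPd using fun i => exists_primitive_log_pow i (hf i)
  have hsum := HasRegLimAtZero.sum (Finset.range (n + 1)) fun i _ => hP i
  have hder : ∀ᶠ t : ℝ in 𝓝[>] 0,
      HasDerivAt (fun t => F t - ∑ i ∈ Finset.range (n + 1), P i t) 0 t := by
    have hall : ∀ᶠ t : ℝ in 𝓝[>] 0, ∀ i ∈ Finset.range (n + 1),
        HasDerivAt (P i) (f i t * (Real.log t : ℂ) ^ i / t) t :=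
      (Finset.eventually_all _).2 fun i _ => hPd i
    filter_upwards [hF, hF', hall, self_mem_nhdsWithin] with t h1 h2 h3 (h4 : 0 < t)
    have := h1.sub (HasDerivAt.fun_sum h3)
    refine HasDerivAt.congr_deriv this ?_
    have ht : (t : ℂ) ≠ 0 := by exact_mod_cast h4.ne'
    rw [← Finset.sum_div, ← h2]
    field_simp
    ring
  obtain ⟨ε, hε, hsub⟩ := mem_nhdsGT_iff_exists_Ioo_subset.1 hder
  have hε : (0 : ℝ) < ε := hε
  have hconst : ∀ t ∈ Set.Ioo 0 ε, F t - ∑ i ∈ Finset.range (n + 1), P i t =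
      F (ε / 2) - ∑ i ∈ Finset.range (n + 1), P i (ε / 2) := by
    intro t ht
    refine isOpen_Ioo.is_const_of_deriv_eq_zero (𝕜 := ℝ)
      (f := fun t => F t - ∑ i ∈ Finset.range (n + 1), P i t) isPreconnected_Ioo
      (fun t ht => (hsub ht).differentiableAt.differentiableWithinAt)
      (fun t ht => (hsub ht).deriv) ht ⟨by linarith, by linarith⟩
  refine ⟨_, (hsum.add (HasRegLimAtZero.const
    (F (ε / 2) - ∑ i ∈ Finset.range (n + 1), P i (ε / 2)))).congr ?_⟩
  filter_upwards [Ioo_mem_nhdsGT hε] with t ht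
  rw [← hconst t ht]
  ring

end

end Hyperlogarithm

namespace Hyperlogarithm

noncomputable section

open Filter Topology MeasureTheory

/-! ### Estimates for hyperlogarithms -/

/-- `c (1 + x) ≤ |x - a|` for all `x > 0`. -/
def Good (c : ℝ) (a : ℂ) : Prop := ∀ x : ℝ, 0 < x → c * (1 + x) ≤ ‖(x : ℂ) - a‖

/-- `c x ≤ |x - a|` for all `x > 0`. -/
def Cone (c : ℝ) (a : ℂ) : Prop := ∀ x : ℝ, 0 < x → c * x ≤ ‖(x : ℂ) - a‖

/-- Words `u σ 0^k` such that `σ` satisfies `Good c` and the letters of `u` satisfy `Cone c`. -/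
inductive NonzeroWord (c : ℝ) : List ℂ → Prop
  | base (k : ℕ) {σ : ℂ} : Good c σ → NonzeroWord c (σ :: List.replicate k 0)
  | cons {τ : ℂ} {w : List ℂ} : Cone c τ → NonzeroWord c w → NonzeroWord c (τ :: w)

theorem Good.cone {c : ℝ} {a : ℂ} (hc : 0 < c) (h : Good c a) : Cone c a := fun x hx => by
  nlinarith [h x hx]

theorem Good.ne_zero {c : ℝ} {a : ℂ} (hc : 0 < c) (h : Good c a) : a ≠ 0 := by
  rintro rfl
  have := h (c / 2) (by positivity)
  rw [sub_zero, Complex.norm_real, Real.norm_of_nonneg (by positivity)] at this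
  nlinarith

theorem Cone.ne {c : ℝ} {a : ℂ} (hc : 0 < c) (h : Cone c a) {x : ℝ} (hx : 0 < x) :
    (x : ℂ) - a ≠ 0 := by
  have := h x hx
  intro h0
  rw [h0, norm_zero] at this
  nlinarith [mul_pos hc hx]

theorem Good.mono {c c' : ℝ} {a : ℂ} (h : Good c a) (hc : c' ≤ c) : Good c' a := fun x hx =>
  (mul_le_mul_of_nonneg_right hc (by linarith)).trans (h x hx)

theorem Cone.mono {c c' : ℝ} {a : ℂ} (h : Cone c a) (hc : c' ≤ c) : Cone c' a := fun x hx =>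
  (mul_le_mul_of_nonneg_right hc hx.le).trans (h x hx)

theorem cone_zero {c : ℝ} (hc : c ≤ 1) : Cone c 0 := fun x hx => by
  rw [sub_zero, Complex.norm_real, Real.norm_of_nonneg hx.le]
  nlinarith

theorem Good.of_dist_le {c : ℝ} {a b : ℂ} (hc : 0 ≤ c) (h : Good (2 * c) a) (hab : ‖b - a‖ ≤ c) :
    Good c b := fun x hx => by
  have h1 := h x hx
  have h2 : ‖(x : ℂ) - a‖ ≤ ‖(x : ℂ) - b‖ + ‖b - a‖ := by
    simpa using norm_add_le ((x : ℂ) - b) (b - a)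
  nlinarith

theorem Cone.mul_left {c s : ℝ} {a : ℂ} (h : Cone c a) (hs : 0 < s) : Cone c (s * a) :=
  fun x hx => by
  have h1 := h (x / s) (by positivity)
  have h2 : (x : ℂ) - s * a = s * ((x / s : ℝ) - a) := by
    have : (s : ℂ) ≠ 0 := by exact_mod_cast hs.ne'
    push_cast
    field_simp
  rw [h2, norm_mul, Complex.norm_real, Real.norm_of_nonneg hs.le]
  calc c * x = s * (c * (x / s)) := by field_simp
    _ ≤ _ := mul_le_mul_of_nonneg_left h1 hs.le

theorem exists_good {a : ℂ} (ha : ∀ x : ℝ, 0 ≤ x → a ≠ x) : ∃ c, 0 < c ∧ c ≤ 1 ∧ Good c a := by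
  have hcl : IsClosed ((fun x : ℝ => (x : ℂ)) '' Set.Ici 0) :=
    Complex.isometry_ofReal.isClosedEmbedding.isClosedMap _ isClosed_Ici
  have hne : ((fun x : ℝ => (x : ℂ)) '' Set.Ici 0).Nonempty := ⟨_, 0, Set.self_mem_Ici, rfl⟩
  have hnot : a ∉ (fun x : ℝ => (x : ℂ)) '' Set.Ici 0 := by
    rintro ⟨x, hx, rfl⟩
    exact ha x hx rfl
  have hd := (hcl.notMem_iff_infDist_pos hne).1 hnot
  set d := Metric.infDist a ((fun x : ℝ => (x : ℂ)) '' Set.Ici 0) with hddef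
  have hn : 0 ≤ ‖a‖ := norm_nonneg a
  refine ⟨d / (1 + ‖a‖ + d), by positivity, (div_le_one (by positivity)).2 (by linarith), ?_⟩
  intro x hx
  have h1 : d ≤ ‖(x : ℂ) - a‖ := by
    rw [← dist_eq_norm, dist_comm]
    exact Metric.infDist_le_dist_of_mem ⟨x, hx.le, rfl⟩
  have h2 : x - ‖a‖ ≤ ‖(x : ℂ) - a‖ := by
    have := norm_sub_norm_le (x : ℂ) a
    rwa [Complex.norm_real, Real.norm_of_nonneg hx.le] at this
  rw [div_mul_eq_mul_div, div_le_iff₀ (by positivity)]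
  nlinarith

theorem NonzeroWord.exists_ne_zero {c : ℝ} (hc : 0 < c) {w : List ℂ} (h : NonzeroWord c w) :
    ∃ τ ∈ w, τ ≠ 0 := by
  induction h with
  | base k hσ => exact ⟨_, by simp, hσ.ne_zero hc⟩
  | cons _ _ ih =>
    obtain ⟨τ, hτ, h0⟩ := ih
    exact ⟨τ, by simp [hτ], h0⟩

theorem NonzeroWord.cone {c : ℝ} (hc : 0 < c) (hc1 : c ≤ 1) {w : List ℂ} (h : NonzeroWord c w) :
    ∀ τ ∈ w, Cone c τ := by
  induction h with
  | base k hσ =>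
    intro τ hτ
    rcases List.mem_cons.1 hτ with rfl | hτ
    · exact hσ.cone hc
    · rw [List.eq_of_mem_replicate hτ]; exact cone_zero hc1
  | cons h1 _ ih =>
    intro τ hτ
    rcases List.mem_cons.1 hτ with rfl | hτ
    · exact h1
    · exact ih τ hτ

theorem hyperlogWord_nil (z : ℝ) : hyperlogWord [] z = 1 := rfl

theorem hyperlogWord_cons {σ : ℂ} {w : List ℂ} (h : ∃ τ ∈ σ :: w, τ ≠ 0) (z : ℝ) :
    hyperlogWord (σ :: w) z = ∫ x in (0 : ℝ)..z, hyperlogWord w x / ((x : ℂ) - σ) := by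
  have : ¬ ∀ τ ∈ σ :: w, τ = 0 := by push Not; exact h
  rw [hyperlogWord, if_neg this]

theorem hyperlogWord_replicate (k : ℕ) (z : ℝ) :
    hyperlogWord (List.replicate k 0) z = (Real.log z : ℂ) ^ k / (k.factorial : ℂ) := by
  cases k with
  | zero => simp [hyperlogWord_nil]
  | succ k =>
    have : ∀ τ ∈ (0 : ℂ) :: List.replicate k 0, τ = 0 := by
      intro τ hτ
      rw [← List.replicate_succ] at hτ
      exact List.eq_of_mem_replicate hτ
    rw [List.replicate_succ, hyperlogWord, if_pos this]
    simp

theorem continuousOn_log_pow_div (k : ℕ) :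
    ContinuousOn (fun z : ℝ => (Real.log z : ℂ) ^ k / (k.factorial : ℂ)) (Set.Ioi 0) := by
  have : ContinuousOn (fun z : ℝ => (Real.log z : ℂ)) (Set.Ioi 0) :=
    Complex.continuous_ofReal.comp_continuousOn
      (Real.continuousOn_log.mono fun x (hx : 0 < x) => hx.ne')
  exact (this.pow k).div_const _

theorem norm_log_pow_div_le (k : ℕ) (x : ℝ) :
    ‖(Real.log x : ℂ) ^ k / (k.factorial : ℂ)‖ ≤ |Real.log x| ^ k := by
  rw [norm_div, norm_pow, Complex.norm_real, Complex.norm_natCast, Real.norm_eq_abs]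
  exact div_le_self (by positivity) (by exact_mod_cast Nat.one_le_iff_ne_zero.2 k.factorial_ne_zero)

theorem norm_div_sub_le_of_cone {c C x : ℝ} {σ y : ℂ} (hc : 0 < c) (hx : 0 < x) (hσ : Cone c σ)
    (hC : 0 ≤ C) (hy : ‖y‖ ≤ C * √x) : ‖y / ((x : ℂ) - σ)‖ ≤ (C / c) / √x := by
  have hs := Real.sqrt_pos.2 hx
  have h3 := hσ x hx
  have h4 : 0 < c * x := by positivity
  rw [norm_div, div_div, div_le_div_iff₀ (h4.trans_le h3) (by positivity)]
  calc ‖y‖ * (c * √x) ≤ (C * √x) * (c * √x) :=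
        mul_le_mul_of_nonneg_right hy (by positivity)
    _ = C * (c * (√x * √x)) := by ring
    _ = C * (c * x) := by rw [Real.mul_self_sqrt hx.le]
    _ ≤ C * ‖(x : ℂ) - σ‖ := mul_le_mul_of_nonneg_left h3 hC

theorem norm_div_sub_le_of_good {c D x : ℝ} {σ y : ℂ} (hc : 0 < c) (hx : 0 < x) (hσ : Good c σ)
    (hD : 0 ≤ D) (hy : ‖y‖ * √x ≤ D * (1 + x)) : ‖y / ((x : ℂ) - σ)‖ ≤ (D / c) / √x := by
  have hs := Real.sqrt_pos.2 hx
  have h1 := hσ x hx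
  have h2 : 0 < c * (1 + x) := by positivity
  rw [norm_div, div_div, div_le_div_iff₀ (h2.trans_le h1) (by positivity)]
  calc ‖y‖ * (c * √x) = c * (‖y‖ * √x) := by ring
    _ ≤ c * (D * (1 + x)) := mul_le_mul_of_nonneg_left hy hc.le
    _ = D * (c * (1 + x)) := by ring
    _ ≤ D * ‖(x : ℂ) - σ‖ := mul_le_mul_of_nonneg_left h1 hD

/-- A uniform constant for `exists_abs_log_pow_le`. -/
theorem exists_norm_hyperlogWord_replicate_le (n : ℕ) :
    ∃ D : ℝ, 0 ≤ D ∧ ∀ k ≤ n, ∀ x : ℝ, 0 < x →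
      ‖hyperlogWord (List.replicate k 0) x‖ * √x ≤ D * (1 + x) := by
  choose D hD0 hD using exists_abs_log_pow_le
  refine ⟨∑ k ∈ Finset.range (n + 1), D k, Finset.sum_nonneg fun k _ => hD0 k,
    fun k hk x hx => ?_⟩
  have hDE : D k ≤ ∑ k ∈ Finset.range (n + 1), D k :=
    Finset.single_le_sum (fun i _ => hD0 i) (Finset.mem_range.2 (by omega))
  rw [hyperlogWord_replicate]
  calc _ ≤ |Real.log x| ^ k * √x :=
        mul_le_mul_of_nonneg_right (norm_log_pow_div_le k x) (Real.sqrt_nonneg x)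
    _ ≤ D k * (1 + x) := hD k x hx
    _ ≤ _ := mul_le_mul_of_nonneg_right hDE (by linarith)

theorem intervalIntegrable_div_sqrt (K : ℝ) {z : ℝ} :
    IntervalIntegrable (fun x : ℝ => K / √x) volume 0 z := by
  have h : IntervalIntegrable (fun x : ℝ => x ^ (-(1 / 2) : ℝ)) volume 0 z :=
    intervalIntegral.intervalIntegrable_rpow' (by norm_num)
  refine (h.const_mul K).congr_ae ?_
  refine (ae_restrict_mem measurableSet_uIoc).mono fun x hx => ?_
  simp only
  rcases le_or_gt 0 x with h0 | h0
  · rw [Real.rpow_neg h0, Real.sqrt_eq_rpow, div_eq_mul_inv K]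
  · rw [Real.sqrt_eq_zero_of_nonpos h0.le, div_zero, Real.rpow_def_of_neg h0,
      show -(1 / 2) * Real.pi = -(Real.pi / 2) by ring, Real.cos_neg, Real.cos_pi_div_two]
    simp

theorem integral_div_sqrt (K : ℝ) {z : ℝ} (hz : 0 < z) :
    ∫ x in (0 : ℝ)..z, K / √x = 2 * K * √z := by
  have h1 : ∀ x ∈ Set.uIcc 0 z, K / √x = K * x ^ (-(1 / 2) : ℝ) := by
    intro x hx
    rw [Set.uIcc_of_le hz.le] at hx
    rw [Real.rpow_neg hx.1, Real.sqrt_eq_rpow, div_eq_mul_inv K]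
  rw [intervalIntegral.integral_congr h1, intervalIntegral.integral_const_mul,
    integral_rpow (Or.inl (by norm_num)), Real.sqrt_eq_rpow,
    show (-(1 / 2) + 1 : ℝ) = 1 / 2 by norm_num, Real.zero_rpow (by norm_num)]
  ring

section Primitive

variable {g : ℝ → ℂ} {K : ℝ}

theorem intervalIntegrable_of_norm_le (hc : ContinuousOn g (Set.Ioi 0))
    (hb : ∀ x, 0 < x → ‖g x‖ ≤ K / √x) {z : ℝ} (hz : 0 < z) :
    IntervalIntegrable g volume 0 z := by
  refine (intervalIntegrable_div_sqrt K).mono_fun' ?_ ?_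
  · rw [Set.uIoc_of_le hz.le]
    exact (hc.mono fun x hx => hx.1).aestronglyMeasurable measurableSet_Ioc
  · refine (ae_restrict_mem measurableSet_uIoc).mono fun x hx => hb x ?_
    rw [Set.uIoc_of_le hz.le] at hx
    exact hx.1

theorem hasDerivAt_integral_of_norm_le (hc : ContinuousOn g (Set.Ioi 0))
    (hb : ∀ x, 0 < x → ‖g x‖ ≤ K / √x) {z : ℝ} (hz : 0 < z) :
    HasDerivAt (fun z => ∫ x in (0 : ℝ)..z, g x) (g z) z :=
  intervalIntegral.integral_hasDerivAt_right (intervalIntegrable_of_norm_le hc hb hz)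
    (hc.stronglyMeasurableAtFilter isOpen_Ioi z hz) (hc.continuousAt (Ioi_mem_nhds hz))

theorem norm_integral_le_sqrt (hb : ∀ x, 0 < x → ‖g x‖ ≤ K / √x) {z : ℝ} (hz : 0 < z) :
    ‖∫ x in (0 : ℝ)..z, g x‖ ≤ 2 * K * √z := by
  rw [← integral_div_sqrt K hz]
  refine intervalIntegral.norm_integral_le_of_norm_le hz.le ?_ (intervalIntegrable_div_sqrt K)
  exact Eventually.of_forall fun x hx => hb x hx.1

end Primitive

theorem continuousOn_div_sub {c : ℝ} (hc : 0 < c) {σ : ℂ} (hσ : Cone c σ) {f : ℝ → ℂ}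
    (hf : ContinuousOn f (Set.Ioi 0)) :
    ContinuousOn (fun x : ℝ => f x / ((x : ℂ) - σ)) (Set.Ioi 0) :=
  hf.div (by fun_prop) fun _ hx => hσ.ne hc hx

/-- Uniform estimates for hyperlogarithms of words that do not consist of zeros only. -/
theorem exists_hyperlogWord_bound {c : ℝ} (hc : 0 < c) (n : ℕ) :
    ∃ C : ℝ, 0 ≤ C ∧ ∀ w : List ℂ, w.length ≤ n → NonzeroWord c w →
      ContinuousOn (hyperlogWord w) (Set.Ioi 0) ∧ ∀ x, 0 < x → ‖hyperlogWord w x‖ ≤ C * √x := by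
  induction n with
  | zero =>
    refine ⟨0, le_rfl, fun w hw h => ?_⟩
    rw [Nat.le_zero, List.length_eq_zero_iff] at hw
    subst hw
    cases h
  | succ n ih =>
    obtain ⟨C, hC0, hC⟩ := ih
    obtain ⟨E, hE0, hE⟩ := exists_norm_hyperlogWord_replicate_le n
    have key : ∀ (σ : ℂ) (w : List ℂ), NonzeroWord c (σ :: w) → Cone c σ →
        ContinuousOn (hyperlogWord w) (Set.Ioi 0) →
        (∀ x : ℝ, 0 < x → ‖hyperlogWord w x / ((x : ℂ) - σ)‖ ≤ ((C + E) / c) / √x) →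
        ContinuousOn (hyperlogWord (σ :: w)) (Set.Ioi 0) ∧
          ∀ x, 0 < x → ‖hyperlogWord (σ :: w) x‖ ≤ 2 * ((C + E) / c) * √x := by
      intro σ w hw hσ hcont hb
      have hcont' := continuousOn_div_sub hc hσ hcont
      have heq : hyperlogWord (σ :: w) =
          fun z => ∫ x in (0 : ℝ)..z, hyperlogWord w x / ((x : ℂ) - σ) :=
        funext (hyperlogWord_cons (hw.exists_ne_zero hc))
      rw [heq]
      exact ⟨fun z hz => (hasDerivAt_integral_of_norm_le hcont' hb hz).continuousAt.continuousWithinAt,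
        fun z hz => norm_integral_le_sqrt hb hz⟩
    refine ⟨2 * ((C + E) / c), by positivity, fun w hw h => ?_⟩
    cases h with
    | @base k σ hσ =>
      refine key _ _ (.base k hσ) (hσ.cone hc) ?_ ?_
      · exact (continuousOn_log_pow_div k).congr fun z _ => hyperlogWord_replicate k z
      · intro x hx
        refine (norm_div_sub_le_of_good hc hx hσ hE0 (hE k (by simpa using hw) x hx)).trans ?_
        gcongr
        linarith
    | @cons τ w hτ hw' =>
      obtain ⟨h1, h2⟩ := hC w (by simpa using hw) hw'
      refine key _ _ (.cons hτ hw') hτ h1 ?_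
      intro x hx
      refine (norm_div_sub_le_of_cone hc hx hτ hC0 (h2 x hx)).trans ?_
      gcongr
      linarith

/-! ### Differentiation and expansions of hyperlogarithms -/

/-- Letters off the positive real axis. -/
def Admissible (a : ℂ) : Prop := ∀ x : ℝ, 0 < x → a ≠ x

theorem Admissible.exists_good {a : ℂ} (ha : Admissible a) (h0 : a ≠ 0) :
    ∃ c, 0 < c ∧ c ≤ 1 ∧ Good c a :=
  Hyperlogarithm.exists_good fun x hx => by
    rcases hx.eq_or_lt with rfl | hx
    · simpa using h0
    · exact ha x hx

theorem Admissible.sub_ne {a : ℂ} (ha : Admissible a) {x : ℝ} (hx : 0 < x) : (x : ℂ) - a ≠ 0 :=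
  sub_ne_zero.2 (ha x hx).symm

theorem Cone.admissible {c : ℝ} {a : ℂ} (hc : 0 < c) (h : Cone c a) : Admissible a :=
  fun _ hx hax => h.ne hc hx (by rw [hax, sub_self])

/-- A word with `Good` nonzero letters consists of zeros only or is a `NonzeroWord`. -/
theorem eq_replicate_or_nonzeroWord {c : ℝ} (hc : 0 < c) (hc1 : c ≤ 1) {w : List ℂ}
    (hw : ∀ a ∈ w, a = 0 ∨ Good c a) : w = List.replicate w.length 0 ∨ NonzeroWord c w := by
  induction w with
  | nil => exact Or.inl rfl
  | cons a w ih =>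
    rcases ih fun b hb => hw b (by simp [hb]) with h | h
    · rcases hw a (by simp) with rfl | ha
      · left
        rw [List.length_cons, List.replicate_succ, ← h]
      · right
        rw [h]
        exact .base _ ha
    · right
      refine .cons ?_ h
      rcases hw a (by simp) with rfl | ha
      · exact cone_zero hc1
      · exact ha.cone hc

theorem exists_good_of_admissible {w : List ℂ} (hw : ∀ a ∈ w, Admissible a) :
    ∃ c, 0 < c ∧ c ≤ 1 ∧ ∀ a ∈ w, a = 0 ∨ Good c a := by
  induction w with
  | nil => exact ⟨1, one_pos, le_rfl, by simp⟩
  | cons a w ih =>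
    obtain ⟨c, hc, hc1, h⟩ := ih fun b hb => hw b (by simp [hb])
    by_cases ha : a = 0
    · refine ⟨c, hc, hc1, fun b hb => ?_⟩
      rcases List.mem_cons.1 hb with rfl | hb
      · exact Or.inl ha
      · exact h b hb
    · obtain ⟨c', hc', hc1', h'⟩ := (hw a (by simp)).exists_good ha
      refine ⟨min c c', lt_min hc hc', (min_le_left _ _).trans hc1, fun b hb => ?_⟩
      rcases List.mem_cons.1 hb with rfl | hb
      · exact Or.inr (h'.mono (min_le_right _ _))
      · exact (h b hb).imp_right fun h => h.mono (min_le_left _ _)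

theorem exists_nonzeroWord {w : List ℂ} (hw : ∀ a ∈ w, Admissible a) :
    ∃ c, 0 < c ∧ c ≤ 1 ∧ (w = List.replicate w.length 0 ∨ NonzeroWord c w) := by
  obtain ⟨c, hc, hc1, h⟩ := exists_good_of_admissible hw
  exact ⟨c, hc, hc1, eq_replicate_or_nonzeroWord hc hc1 h⟩

theorem continuousOn_hyperlogWord {w : List ℂ} (hw : ∀ a ∈ w, Admissible a) :
    ContinuousOn (hyperlogWord w) (Set.Ioi 0) := by
  obtain ⟨c, hc, hc1, h | h⟩ := exists_nonzeroWord hw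
  · rw [h]
    exact (continuousOn_log_pow_div _).congr fun z _ => hyperlogWord_replicate _ z
  · obtain ⟨C, -, hC⟩ := exists_hyperlogWord_bound hc w.length
    exact (hC w le_rfl h).1

theorem exists_norm_div_sub_le {σ : ℂ} {w : List ℂ} {c : ℝ} (hc : 0 < c)
    (h : NonzeroWord c (σ :: w)) :
    ∃ K, ∀ x : ℝ, 0 < x → ‖hyperlogWord w x / ((x : ℂ) - σ)‖ ≤ K / √x := by
  cases h with
  | base k hσ =>
    obtain ⟨D, hD0, hD⟩ := exists_norm_hyperlogWord_replicate_le k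
    exact ⟨D / c, fun x hx => norm_div_sub_le_of_good hc hx hσ hD0 (hD k le_rfl x hx)⟩
  | cons hτ hw' =>
    obtain ⟨C, hC0, hC⟩ := exists_hyperlogWord_bound hc w.length
    exact ⟨C / c, fun x hx => norm_div_sub_le_of_cone hc hx hτ hC0 ((hC w le_rfl hw').2 x hx)⟩

theorem hasDerivAt_hyperlogWord {σ : ℂ} {w : List ℂ} (hw : ∀ a ∈ σ :: w, Admissible a)
    {z : ℝ} (hz : 0 < z) :
    HasDerivAt (hyperlogWord (σ :: w)) (hyperlogWord w z / ((z : ℂ) - σ)) z := by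
  obtain ⟨c, hc, hc1, h | h⟩ := exists_nonzeroWord hw
  · rw [List.length_cons, List.replicate_succ, List.cons.injEq] at h
    obtain ⟨rfl, h⟩ := h
    rw [h, hyperlogWord_replicate, ← List.replicate_succ]
    have h1 := (hasDerivAt_ofReal_log_pow w.length hz).div_const ((w.length + 1).factorial : ℂ)
    have h2 : hyperlogWord (List.replicate (w.length + 1) 0) = fun t : ℝ =>
        (Real.log t : ℂ) ^ (w.length + 1) / ((w.length + 1).factorial : ℂ) :=
      funext fun z => hyperlogWord_replicate _ z
    rw [h2]
    refine h1.congr_deriv ?_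
    rw [Nat.factorial_succ]
    have h3 : ((w.length : ℂ) + 1) ≠ 0 := by exact_mod_cast Nat.succ_ne_zero w.length
    have h4 : (w.length.factorial : ℂ) ≠ 0 := by exact_mod_cast Nat.factorial_ne_zero w.length
    have h5 : (z : ℂ) ≠ 0 := by exact_mod_cast hz.ne'
    push_cast
    rw [sub_zero]
    field_simp
  · obtain ⟨K, hK⟩ := exists_norm_div_sub_le hc h
    rw [show hyperlogWord (σ :: w) = _ from funext (hyperlogWord_cons (h.exists_ne_zero hc))]
    refine hasDerivAt_integral_of_norm_le (continuousOn_div_sub hc (h.cone hc hc1 σ (by simp)) ?_)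
      hK hz
    exact continuousOn_hyperlogWord fun a ha => hw a (by simp [ha])

theorem analyticAt_div_sub {a : ℂ} (ha : a ≠ 0) : AnalyticAt ℂ (fun z : ℂ => z / (z - a)) 0 :=
  analyticAt_id.div (analyticAt_id.sub analyticAt_const) (by simpa using ha)

theorem exists_hasRegLimAtZero_mul_div {F : ℝ → ℂ} {c : ℂ} (hF : HasRegLimAtZero F c) (a : ℂ) :
    ∃ d, HasRegLimAtZero (fun x => x * (F x / ((x : ℂ) - a))) d := by
  by_cases ha : a = 0
  · refine ⟨c, hF.congr ?_⟩
    filter_upwards [self_mem_nhdsWithin] with x (hx : 0 < x)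
    have : (x : ℂ) ≠ 0 := by exact_mod_cast hx.ne'
    rw [ha, sub_zero]
    field_simp
  · refine ⟨_, (hF.analytic_mul (analyticAt_div_sub ha)).congr ?_⟩
    exact Eventually.of_forall fun x => by ring

/-- Hyperlogarithms of nonempty words have regularized limit zero at the origin. -/
theorem hasRegLimAtZero_hyperlogWord {w : List ℂ} (hw : ∀ a ∈ w, Admissible a) :
    HasRegLimAtZero (hyperlogWord w) (if w = [] then 1 else 0) := by
  induction w with
  | nil =>
    rw [if_pos rfl]
    exact HasRegLimAtZero.const 1
  | cons σ w ih =>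
    have ih := ih fun a ha => hw a (by simp [ha])
    rw [if_neg (by simp)]
    obtain ⟨c, hc, hc1, h | h⟩ := exists_nonzeroWord hw
    · rw [h]
      have h1 := ((HasRegLimAtZero.const 1).log_pow_mul (w.length + 1)).const_mul
        ((w.length + 1).factorial : ℂ)⁻¹
      simp only [Nat.add_eq_zero_iff, one_ne_zero, and_false, if_false, mul_zero] at h1
      refine h1.congr (Eventually.of_forall fun t => ?_)
      rw [hyperlogWord_replicate, List.length_cons]
      ring
    · obtain ⟨d, hd⟩ := exists_hasRegLimAtZero_mul_div ih σ
      obtain ⟨e, he⟩ := exists_hasRegLimAtZero_of_hasDerivAt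
        (F := hyperlogWord (σ :: w)) (F' := fun x => hyperlogWord w x / ((x : ℂ) - σ))
        (by filter_upwards [self_mem_nhdsWithin] with t ht using hasDerivAt_hyperlogWord hw ht) hd
      obtain ⟨C, -, hC⟩ := exists_hyperlogWord_bound hc (σ :: w).length
      have h0 : Tendsto (hyperlogWord (σ :: w)) (𝓝[>] 0) (𝓝 0) := by
        have h1 : Tendsto (fun t : ℝ => C * √t) (𝓝[>] 0) (𝓝 0) := by
          have : ContinuousAt (fun t : ℝ => C * √t) 0 := by fun_prop
          have := this.tendsto
          simp only [Real.sqrt_zero, mul_zero] at this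
          exact this.mono_left nhdsWithin_le_nhds
        refine squeeze_zero_norm' ?_ h1
        filter_upwards [self_mem_nhdsWithin] with t ht using (hC _ le_rfl h).2 t ht
      rwa [he.eq_of_tendsto h0] at he

theorem exists_hasRegLimAtTop_hyperlogWord {w : List ℂ} (hw : ∀ a ∈ w, Admissible a) :
    ∃ c, HasRegLimAtTop (hyperlogWord w) c := by
  simp only [hasRegLimAtTop_iff]
  induction w with
  | nil => exact ⟨1, HasRegLimAtZero.const 1⟩
  | cons σ w ih =>
    obtain ⟨c, hc⟩ := ih fun a ha => hw a (by simp [ha])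
    have hA : AnalyticAt ℂ (fun s : ℂ => -(1 - σ * s)⁻¹) 0 :=
      ((analyticAt_const.sub (analyticAt_const.mul analyticAt_id)).inv (by simp)).neg
    refine exists_hasRegLimAtZero_of_hasDerivAt
      (F' := fun s : ℝ => hyperlogWord w (1 / s) / (((1 / s : ℝ) : ℂ) - σ) * (-(s ^ 2)⁻¹ : ℝ)) ?_
      ((hc.analytic_mul hA).congr ?_)
    · filter_upwards [self_mem_nhdsWithin] with s (hs : 0 < s)
      have h1 : HasDerivAt (fun s : ℝ => 1 / s) (-(s ^ 2)⁻¹) s := by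
        simpa [one_div] using hasDerivAt_inv hs.ne'
      have h2 := (hasDerivAt_hyperlogWord hw (one_div_pos.2 hs)).scomp s h1
      refine h2.congr_deriv ?_
      rw [Complex.real_smul, mul_comm]
    · filter_upwards [self_mem_nhdsWithin] with s (hs : 0 < s)
      have h1 : (s : ℂ) ≠ 0 := by exact_mod_cast hs.ne'
      have h2 := (hw σ (by simp)).sub_ne (one_div_pos.2 hs)
      push_cast at h2 ⊢
      have h3 : 1 - σ * (s : ℂ) ≠ 0 := by
        intro h0
        apply h2
        field_simp
        linear_combination h0
      have h4 : 1 / (s : ℂ) - σ = (1 - σ * s) / s := by field_simp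
      rw [h4]
      field_simp

/-! ### The shuffle relation for hyperlogarithms -/

/-- The evaluation of hyperlogarithms, as a linear map. -/
def hyperlogL {α : Type*} (ev : α → ℂ) (z : ℝ) : WordSpace α →ₗ[ℚ] ℂ :=
  Finsupp.linearCombination ℚ fun w => hyperlogWord (w.map ev) z

theorem hyperlog_eq {α : Type*} (ev : α → ℂ) (x : WordSpace α) (z : ℝ) :
    hyperlog ev x z = hyperlogL ev z x := by
  simp only [hyperlog, hyperlogL, Finsupp.linearCombination_apply, Rat.smul_def]

theorem hyperlogL_ofWord {α : Type*} (ev : α → ℂ) (z : ℝ) (w : List α) :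
    hyperlogL ev z (ofWord w) = hyperlogWord (w.map ev) z := by
  simp [hyperlogL, ofWord]

/-- The span of all words with admissible letters. -/
def admissibleSpan {α : Type*} (ev : α → ℂ) : Submodule ℚ (WordSpace α) :=
  Submodule.span ℚ {x | ∃ w : List α, (∀ a ∈ w, Admissible (ev a)) ∧ x = ofWord w}

section Shuffle

variable {α : Type*} {ev : α → ℂ}

theorem shuffleWord_mem_admissibleSpan {u v : List α} (hu : ∀ a ∈ u, Admissible (ev a))
    (hv : ∀ a ∈ v, Admissible (ev a)) : shuffleWord u v ∈ admissibleSpan ev := by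
  refine Submodule.span_mono ?_ (shuffleWord_mem_span u v)
  rintro _ ⟨w, hw, rfl⟩
  refine ⟨w, fun a ha => ?_, rfl⟩
  rcases List.mem_append.1 (hw.mem_iff.1 ha) with h | h
  · exact hu a h
  · exact hv a h

theorem hasDerivAt_hyperlogL_consL {a : α} (ha : Admissible (ev a)) {x : WordSpace α}
    (hx : x ∈ admissibleSpan ev) {z : ℝ} (hz : 0 < z) :
    HasDerivAt (fun z => hyperlogL ev z (consL a x)) (hyperlogL ev z x / ((z : ℂ) - ev a)) z := by
  induction hx using Submodule.span_induction with
  | mem x hx =>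
    obtain ⟨w, hw, rfl⟩ := hx
    simp only [consL_ofWord, hyperlogL_ofWord, List.map_cons]
    refine hasDerivAt_hyperlogWord ?_ hz
    intro b hb
    rcases List.mem_cons.1 hb with rfl | hb
    · exact ha
    · obtain ⟨b', hb', rfl⟩ := List.mem_map.1 hb
      exact hw b' hb'
  | zero => simpa using hasDerivAt_const z (0 : ℂ)
  | add x y _ _ hx hy =>
    simp only [map_add, add_div]
    exact hx.add hy
  | smul q x _ hx =>
    simp only [map_smul, Rat.smul_def, mul_div_assoc]
    exact hx.const_mul _

theorem hasRegLimAtZero_hyperlogL_consL {a : α} (ha : Admissible (ev a)) {x : WordSpace α}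
    (hx : x ∈ admissibleSpan ev) :
    HasRegLimAtZero (fun z => hyperlogL ev z (consL a x)) 0 := by
  induction hx using Submodule.span_induction with
  | mem x hx =>
    obtain ⟨w, hw, rfl⟩ := hx
    simp only [consL_ofWord, hyperlogL_ofWord, List.map_cons]
    have h := hasRegLimAtZero_hyperlogWord (w := ev a :: w.map ev) ?_
    · simpa using h
    intro b hb
    rcases List.mem_cons.1 hb with rfl | hb
    · exact ha
    · obtain ⟨b', hb', rfl⟩ := List.mem_map.1 hb
      exact hw b' hb'
  | zero => simpa using HasRegLimAtZero.const 0
  | add x y _ _ hx hy =>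
    simp only [map_add]
    simpa using hx.add hy
  | smul q x _ hx =>
    simp only [map_smul, Rat.smul_def]
    simpa using hx.const_mul q

theorem eqOn_of_hasDerivAt {F G F' : ℝ → ℂ} (hF : ∀ z, 0 < z → HasDerivAt F (F' z) z)
    (hG : ∀ z, 0 < z → HasDerivAt G (F' z) z) {c : ℂ} (hFc : HasRegLimAtZero F c)
    (hGc : HasRegLimAtZero G c) {z : ℝ} (hz : 0 < z) : F z = G z := by
  have hconst : ∀ t, 0 < t → F t - G t = F z - G z := by
    intro t ht
    refine isOpen_Ioi.is_const_of_deriv_eq_zero (𝕜 := ℝ) (f := fun t => F t - G t)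
      isPreconnected_Ioi (s := Set.Ioi 0)
      (fun t ht => ((hF t ht).sub (hG t ht)).differentiableAt.differentiableWithinAt)
      (fun t ht => ?_) ht hz
    have := ((hF t ht).sub (hG t ht)).deriv
    rw [sub_self] at this
    exact this
  have h1 : HasRegLimAtZero (fun t => F t - G t) (F z - G z) :=
    (HasRegLimAtZero.const _).congr <| by
      filter_upwards [self_mem_nhdsWithin] with t ht using (hconst t ht).symm
  have h2 := h1.unique (hFc.sub hGc)
  rw [sub_self] at h2
  exact sub_eq_zero.1 h2

theorem hyperlogL_shuffleWord {u v : List α} (hu : ∀ a ∈ u, Admissible (ev a))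
    (hv : ∀ a ∈ v, Admissible (ev a)) {z : ℝ} (hz : 0 < z) :
    hyperlogL ev z (shuffleWord u v) =
      hyperlogWord (u.map ev) z * hyperlogWord (v.map ev) z := by
  have map_adm : ∀ {w : List α}, (∀ a ∈ w, Admissible (ev a)) →
      ∀ b ∈ w.map ev, Admissible b := by
    intro w hw b hb
    obtain ⟨b', hb', rfl⟩ := List.mem_map.1 hb
    exact hw b' hb'
  induction u generalizing v z with
  | nil => simp [shuffleWord_nil_left, hyperlogL_ofWord, hyperlogWord_nil]
  | cons a u ihu =>
    induction v generalizing z with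
    | nil => simp [shuffleWord_nil_right, hyperlogL_ofWord, hyperlogWord_nil]
    | cons b v ihv =>
      have hu' : ∀ a ∈ u, Admissible (ev a) := fun c hc => hu c (by simp [hc])
      have hv' : ∀ a ∈ v, Admissible (ev a) := fun c hc => hv c (by simp [hc])
      have ha := hu a (by simp)
      have hb := hv b (by simp)
      simp only [shuffleWord_cons_cons, map_add]
      refine eqOn_of_hasDerivAt
        (F := fun z => hyperlogL ev z (consL a (shuffleWord u (b :: v))) +
          hyperlogL ev z (consL b (shuffleWord (a :: u) v)))
        (G := fun z => hyperlogWord ((a :: u).map ev) z * hyperlogWord ((b :: v).map ev) z)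
        (F' := fun z => hyperlogL ev z (shuffleWord u (b :: v)) / ((z : ℂ) - ev a) +
          hyperlogL ev z (shuffleWord (a :: u) v) / ((z : ℂ) - ev b)) (c := 0)
        (fun z hz => ?_) (fun z hz => ?_) ?_ ?_ hz
      · exact (hasDerivAt_hyperlogL_consL ha (shuffleWord_mem_admissibleSpan hu' hv) hz).add
          (hasDerivAt_hyperlogL_consL hb (shuffleWord_mem_admissibleSpan hu hv') hz)
      · rw [ihu hu' hv hz, ihv hv' hz]
        have h1 := hasDerivAt_hyperlogWord (σ := ev a) (w := u.map ev) (map_adm hu) hz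
        have h2 := hasDerivAt_hyperlogWord (σ := ev b) (w := v.map ev) (map_adm hv) hz
        refine (h1.mul h2).congr_deriv ?_
        simp only [List.map_cons]
        ring
      · simpa using (hasRegLimAtZero_hyperlogL_consL ha (shuffleWord_mem_admissibleSpan hu' hv)).add
          (hasRegLimAtZero_hyperlogL_consL hb (shuffleWord_mem_admissibleSpan hu hv'))
      · have h1 := hasRegLimAtZero_hyperlogWord (map_adm hu)
        have h2 := hasRegLimAtZero_hyperlogWord (map_adm hv)
        simpa using h1.mul h2

end Shuffle

end

end Hyperlogarithm

namespace Hyperlogarithm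

noncomputable section

open Filter Topology MeasureTheory

/-! ### Regularization at infinity -/

/-- The sum of `e j * Λ (w.drop j)` over all suffixes of `w`. -/
def suffixSum {α : Type*} (Λ : List α → ℂ) (e : ℕ → ℂ) (w : List α) : ℂ :=
  ∑ j ∈ Finset.range (w.length + 1), e j * Λ (w.drop j)

/-- The divided powers of `y`. -/
def dividedPow (y : ℂ) (j : ℕ) : ℂ := y ^ j / (j.factorial : ℂ)

/-- The hyperlogarithm with its logarithmic divergence at infinity removed. -/
def regHyperlog (w : List ℂ) (z : ℝ) : ℂ :=
  suffixSum (fun v => hyperlogWord v z) (dividedPow (-(Real.log z : ℂ))) w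

/-- The regularized limit at infinity of the hyperlogarithm of a word. -/
def regValue (w : List ℂ) : ℂ := regLimAtTop (hyperlogWord w)

theorem dividedPow_zero (y : ℂ) : dividedPow y 0 = 1 := by simp [dividedPow]

theorem dividedPow_add (x y : ℂ) (j : ℕ) :
    dividedPow (x + y) j = ∑ k ∈ Finset.range (j + 1), dividedPow x k * dividedPow y (j - k) := by
  rw [dividedPow, add_pow, Finset.sum_div]
  refine Finset.sum_congr rfl fun k hk => ?_
  have hk : k ≤ j := by simpa [Nat.lt_succ_iff] using hk
  rw [Nat.cast_choose ℂ hk, dividedPow, dividedPow]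
  have h1 : (j.factorial : ℂ) ≠ 0 := by exact_mod_cast j.factorial_ne_zero
  field_simp

theorem hasDerivAt_dividedPow_neg_log (j : ℕ) {z : ℝ} (hz : 0 < z) :
    HasDerivAt (fun z : ℝ => dividedPow (-(Real.log z : ℂ)) (j + 1))
      (-dividedPow (-(Real.log z : ℂ)) j / z) z := by
  have h := ((((Real.hasDerivAt_log hz.ne').ofReal_comp).neg).fun_pow (j + 1)).div_const
    ((j + 1).factorial : ℂ)
  refine HasDerivAt.congr_deriv h ?_
  have h1 : (j.factorial : ℂ) ≠ 0 := by exact_mod_cast j.factorial_ne_zero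
  have h2 : ((j : ℂ) + 1) ≠ 0 := by exact_mod_cast j.succ_ne_zero
  have h3 : (z : ℂ) ≠ 0 := by exact_mod_cast hz.ne'
  rw [Nat.add_sub_cancel, Nat.factorial_succ, dividedPow]
  simp only [Pi.neg_apply]
  push_cast
  field_simp

theorem admissible_drop {w : List ℂ} (hw : ∀ a ∈ w, Admissible a) (j : ℕ) :
    ∀ a ∈ w.drop j, Admissible a := fun a ha => hw a (List.mem_of_mem_drop ha)

theorem drop_eq_getD_cons {w : List ℂ} {j : ℕ} (hj : j < w.length) :
    w.drop j = w.getD j 0 :: w.drop (j + 1) := by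
  rw [List.drop_eq_getElem_cons hj, List.getD_eq_getElem _ _ hj]

theorem hasDerivAt_regHyperlog {w : List ℂ} (hw : ∀ a ∈ w, Admissible a) {z : ℝ} (hz : 0 < z) :
    HasDerivAt (regHyperlog w)
      (∑ j ∈ Finset.range w.length, dividedPow (-(Real.log z : ℂ)) j *
        (hyperlogWord (w.drop (j + 1)) z * (1 / ((z : ℂ) - w.getD j 0) - 1 / z))) z := by
  have hz0 : (z : ℂ) ≠ 0 := by exact_mod_cast hz.ne'
  have h1 : ∀ j ∈ Finset.range (w.length + 1), HasDerivAt
      (fun z : ℝ => dividedPow (-(Real.log z : ℂ)) j * hyperlogWord (w.drop j) z)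
      ((if j = 0 then 0 else -dividedPow (-(Real.log z : ℂ)) (j - 1) / z) *
          hyperlogWord (w.drop j) z +
        dividedPow (-(Real.log z : ℂ)) j *
          (if j < w.length then
            hyperlogWord (w.drop (j + 1)) z / ((z : ℂ) - w.getD j 0) else 0)) z := by
    intro j hj
    refine HasDerivAt.mul ?_ ?_
    · cases j with
      | zero =>
        simp only [dividedPow_zero, if_true]
        exact hasDerivAt_const z (1 : ℂ)
      | succ j => simpa using hasDerivAt_dividedPow_neg_log j hz
    · by_cases hjw : j < w.length
      · rw [if_pos hjw]
        have := hasDerivAt_hyperlogWord (σ := w.getD j 0) (w := w.drop (j + 1))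
          (drop_eq_getD_cons hjw ▸ admissible_drop hw j) hz
        rwa [← drop_eq_getD_cons hjw] at this
      · rw [if_neg hjw, List.drop_eq_nil_of_le (not_lt.1 hjw)]
        exact hasDerivAt_const z (1 : ℂ)
  refine (HasDerivAt.fun_sum h1).congr_deriv ?_
  rw [Finset.sum_add_distrib, Finset.sum_range_succ', Finset.sum_range_succ _ w.length]
  simp only [lt_irrefl, if_false, mul_zero, add_zero, if_true, zero_mul, Nat.add_eq_zero_iff,
    one_ne_zero, and_false, Nat.add_sub_cancel]
  rw [← Finset.sum_add_distrib]
  refine Finset.sum_congr rfl fun j hj => ?_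
  rw [if_pos (Finset.mem_range.1 hj)]
  ring

theorem hasRegLimAtTop_regValue {w : List ℂ} (hw : ∀ a ∈ w, Admissible a) :
    HasRegLimAtTop (hyperlogWord w) (regValue w) := by
  obtain ⟨c, hc⟩ := exists_hasRegLimAtTop_hyperlogWord hw
  rwa [regValue, hc.regLimAtTop_eq]

theorem hasRegLimAtZero_regHyperlog_inv {w : List ℂ} (hw : ∀ a ∈ w, Admissible a) :
    HasRegLimAtZero (fun s => regHyperlog w (1 / s)) (regValue w) := by
  have h1 : ∀ j ∈ Finset.range (w.length + 1), HasRegLimAtZero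
      (fun s : ℝ => dividedPow (-(Real.log (1 / s) : ℂ)) j * hyperlogWord (w.drop j) (1 / s))
      (if j = 0 then regValue w else 0) := by
    intro j _
    have h2 := ((hasRegLimAtTop_iff.1
      (hasRegLimAtTop_regValue (admissible_drop hw j))).log_pow_mul j).const_mul
        (j.factorial : ℂ)⁻¹
    have h3 : ((j.factorial : ℂ)⁻¹ * if j = 0 then regValue (w.drop j) else 0) =
        if j = 0 then regValue w else 0 := by
      rcases j with _ | j <;> simp
    rw [h3] at h2
    refine h2.congr (Eventually.of_forall fun s => ?_)
    simp only [dividedPow, one_div, Real.log_inv, Complex.ofReal_neg, neg_neg]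
    ring
  have h2 := HasRegLimAtZero.sum _ h1
  rw [show (∑ j ∈ Finset.range (w.length + 1), if j = 0 then regValue w else 0) = regValue w by
    simp] at h2
  exact h2

/-! ### Uniform estimates at infinity -/

/-- Words that consist of zeros only or satisfy the estimates of `NonzeroWord`. -/
def Tame (c : ℝ) (w : List ℂ) : Prop := w = List.replicate w.length 0 ∨ NonzeroWord c w

theorem Tame.tail {c : ℝ} {a : ℂ} {w : List ℂ} (h : Tame c (a :: w)) : Tame c w := by
  rcases h with h | h
  · left
    rw [List.length_cons, List.replicate_succ, List.cons.injEq] at h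
    exact h.2
  · cases h with
    | base k _ => left; simp
    | cons _ h => exact Or.inr h

theorem Tame.drop {c : ℝ} {w : List ℂ} (h : Tame c w) (j : ℕ) : Tame c (w.drop j) := by
  induction j generalizing w with
  | zero => simpa using h
  | succ j ih =>
    cases w with
    | nil => simpa using h
    | cons a w => simpa using ih h.tail

theorem Tame.cone {c : ℝ} (hc : 0 < c) (hc1 : c ≤ 1) {w : List ℂ} (h : Tame c w) :
    ∀ a ∈ w, Cone c a := by
  rcases h with h | h
  · intro a ha
    rw [h] at ha
    rw [List.eq_of_mem_replicate ha]
    exact cone_zero hc1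
  · exact h.cone hc hc1

theorem Tame.admissible {c : ℝ} (hc : 0 < c) (hc1 : c ≤ 1) {w : List ℂ} (h : Tame c w) :
    ∀ a ∈ w, Admissible a := fun a ha => (h.cone hc hc1 a ha).admissible hc

theorem exists_norm_le_of_tame {c : ℝ} (hc : 0 < c) (n : ℕ) :
    ∃ C : ℝ, 0 ≤ C ∧ ∀ w : List ℂ, w.length ≤ n → Tame c w →
      ∀ x, 1 ≤ x → ‖hyperlogWord w x‖ ≤ C * √x := by
  obtain ⟨C, hC0, hC⟩ := exists_hyperlogWord_bound hc n
  obtain ⟨D, hD0, hD⟩ := exists_norm_hyperlogWord_replicate_le n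
  refine ⟨C + 2 * D, by positivity, fun w hw h x hx => ?_⟩
  have hx0 : 0 < x := by linarith
  have hs := Real.sqrt_pos.2 hx0
  rcases h with h | h
  · rw [h]
    have h1 := hD _ hw x hx0
    have h2 : ‖hyperlogWord (List.replicate w.length 0) x‖ * √x ≤ (2 * D * √x) * √x := by
      rw [mul_assoc (2 * D), Real.mul_self_sqrt hx0.le]
      nlinarith
    have h3 := le_of_mul_le_mul_right h2 hs
    nlinarith
  · have := (hC w hw h).2 x hx0
    nlinarith

theorem exists_norm_dividedPow_le (n : ℕ) :
    ∃ E : ℝ, 0 ≤ E ∧ ∀ j ≤ n, ∀ x : ℝ, 1 ≤ x →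
      ‖dividedPow (-(Real.log x : ℂ)) j‖ ≤ E * √(√x) := by
  obtain ⟨D, hD0, hD⟩ := exists_norm_hyperlogWord_replicate_le n
  refine ⟨2 ^ n * (2 * D), by positivity, fun j hj x hx => ?_⟩
  have hx0 : 0 < x := by linarith
  have hs := Real.sqrt_pos.2 hx0
  have hs1 : 1 ≤ √x := Real.one_le_sqrt.2 hx
  have hss := Real.sqrt_pos.2 hs
  have h1 := hD j hj (√x) hs
  have h2 : ‖hyperlogWord (List.replicate j 0) (√x)‖ ≤ 2 * D * √(√x) := by
    refine le_of_mul_le_mul_right ?_ hss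
    rw [mul_assoc (2 * D), Real.mul_self_sqrt hs.le]
    nlinarith
  have h3 : dividedPow (-(Real.log x : ℂ)) j =
      (-2) ^ j * hyperlogWord (List.replicate j 0) (√x) := by
    rw [hyperlogWord_replicate, Real.log_sqrt hx0.le, dividedPow, ← mul_div_assoc, ← mul_pow]
    push_cast
    congr 2
    ring
  rw [h3, norm_mul, norm_pow, norm_neg, mul_assoc (2 ^ n)]
  have h4 : ‖(2 : ℂ)‖ ^ j ≤ 2 ^ n := by
    simpa using pow_le_pow_right₀ (one_le_two : (1 : ℝ) ≤ 2) hj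
  exact mul_le_mul h4 h2 (norm_nonneg _) (by positivity)

theorem exists_regHyperlog_sub_le {c : ℝ} (hc : 0 < c) (hc1 : c ≤ 1) (M : ℝ) (hM : 0 ≤ M)
    (n : ℕ) : ∃ K : ℝ, 0 ≤ K ∧ ∀ w : List ℂ, w.length ≤ n → Tame c w → (∀ a ∈ w, ‖a‖ ≤ M) →
      ∀ z z' : ℝ, 1 ≤ z → z ≤ z' →
        ‖regHyperlog w z' - regHyperlog w z‖ ≤ K * z ^ (-(1 / 4) : ℝ) := by
  obtain ⟨C, hC0, hC⟩ := exists_norm_le_of_tame hc n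
  obtain ⟨E, hE0, hE⟩ := exists_norm_dividedPow_le n
  set K := n * (E * (C * (M / c))) with hK
  have hK0 : 0 ≤ K := by positivity
  refine ⟨4 * K, by positivity, fun w hw ht hb z z' hz hzz' => ?_⟩
  have hadm := ht.admissible hc hc1
  have hpos : ∀ x ∈ Set.Icc z z', 0 < x := fun x hx => by linarith [hx.1]
  have hbound : ∀ x : ℝ, 1 ≤ x →
      ‖∑ j ∈ Finset.range w.length, dividedPow (-(Real.log x : ℂ)) j *
        (hyperlogWord (w.drop (j + 1)) x * (1 / ((x : ℂ) - w.getD j 0) - 1 / x))‖ ≤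
      K * x ^ (-(5 / 4) : ℝ) := by
    intro x hx
    have hx0 : 0 < x := by linarith
    have hterm : ∀ j ∈ Finset.range w.length, ‖dividedPow (-(Real.log x : ℂ)) j *
        (hyperlogWord (w.drop (j + 1)) x * (1 / ((x : ℂ) - w.getD j 0) - 1 / x))‖ ≤
        E * (C * (M / c)) * x ^ (-(5 / 4) : ℝ) := by
      intro j hj
      have hj := Finset.mem_range.1 hj
      have hmem : w.getD j 0 ∈ w := by
        rw [List.getD_eq_getElem _ _ hj]; exact List.getElem_mem hj
      have h1 := hE j (by omega) x hx
      have h2 := hC (w.drop (j + 1)) (by rw [List.length_drop]; omega) (ht.drop _) x hx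
      have h3 : ‖1 / ((x : ℂ) - w.getD j 0) - 1 / x‖ ≤ M / c * x ^ (-2 : ℝ) := by
        have hcone := ht.cone hc hc1 _ hmem
        have hne := hcone.ne hc hx0
        have hxc : (x : ℂ) ≠ 0 := by exact_mod_cast hx0.ne'
        have h4 : 1 / ((x : ℂ) - w.getD j 0) - 1 / x =
            w.getD j 0 / (((x : ℂ) - w.getD j 0) * x) := by
          field_simp
          ring
        rw [h4, norm_div, norm_mul, Complex.norm_real, Real.norm_of_nonneg hx0.le,
          Real.rpow_neg hx0.le, ← div_eq_mul_inv, div_div, Real.rpow_two]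
        refine div_le_div₀ hM (hb _ hmem) (by positivity) ?_
        calc c * x ^ 2 = (c * x) * x := by ring
          _ ≤ _ := mul_le_mul_of_nonneg_right (hcone x hx0) hx0.le
      have hx4 : √(√x) * (√x * x ^ (-2 : ℝ)) = x ^ (-(5 / 4) : ℝ) := by
        rw [Real.sqrt_eq_rpow, Real.sqrt_eq_rpow, ← Real.rpow_mul hx0.le, ← Real.rpow_add hx0,
          ← Real.rpow_add hx0]
        norm_num
      calc _ ≤ (E * √(√x)) * ((C * √x) * (M / c * x ^ (-2 : ℝ))) := by
            rw [norm_mul, norm_mul]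
            exact mul_le_mul h1 (mul_le_mul h2 h3 (norm_nonneg _) (by positivity))
              (by positivity) (by positivity)
        _ = E * (C * (M / c)) * (√(√x) * (√x * x ^ (-2 : ℝ))) := by ring
        _ = _ := by rw [hx4]
    refine (norm_sum_le_of_le _ hterm).trans ?_
    rw [Finset.sum_const, Finset.card_range, nsmul_eq_mul, hK, ← mul_assoc]
    gcongr
  have key := image_norm_le_of_norm_deriv_right_le_deriv_boundary'
    (f := fun x => regHyperlog w x - regHyperlog w z)
    (f' := fun x => ∑ j ∈ Finset.range w.length, dividedPow (-(Real.log x : ℂ)) j *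
        (hyperlogWord (w.drop (j + 1)) x * (1 / ((x : ℂ) - w.getD j 0) - 1 / x)))
    (a := z) (b := z') (B := fun x => 4 * K * (z ^ (-(1 / 4) : ℝ) - x ^ (-(1 / 4) : ℝ)))
    (B' := fun x => K * x ^ (-(5 / 4) : ℝ)) ?_ ?_ ?_ ?_ ?_ ?_
    (Set.right_mem_Icc.2 hzz')
  · refine key.trans ?_
    have : 0 ≤ z' ^ (-(1 / 4) : ℝ) := Real.rpow_nonneg (by linarith) _
    nlinarith
  · intro x hx
    exact ((hasDerivAt_regHyperlog hadm (hpos x hx)).sub_const _).continuousAt.continuousWithinAt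
  · intro x hx
    exact ((hasDerivAt_regHyperlog hadm (hpos x ⟨hx.1, hx.2.le⟩)).sub_const _).hasDerivWithinAt
  · simp
  · exact continuousOn_const.mul (continuousOn_const.sub
      (continuousOn_id.rpow_const fun x hx => Or.inl (hpos x hx).ne'))
  · intro x hx
    have hx0 := hpos x ⟨hx.1, hx.2.le⟩
    have h1 := ((Real.hasDerivAt_rpow_const (p := -(1 / 4)) (Or.inl hx0.ne')).const_sub
      (z ^ (-(1 / 4) : ℝ))).const_mul (4 * K)
    refine (h1.congr_deriv ?_).hasDerivWithinAt
    norm_num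
    ring
  · intro x hx
    exact hbound x (hz.trans hx.1)

theorem tendsto_rpow_neg_quarter : Tendsto (fun z : ℝ => z ^ (-(1 / 4) : ℝ)) atTop (𝓝 0) :=
  tendsto_rpow_neg_atTop (by norm_num)

theorem exists_norm_le_of_mem (w : List ℂ) : ∃ M, 0 ≤ M ∧ ∀ a ∈ w, ‖a‖ ≤ M := by
  induction w with
  | nil => exact ⟨0, le_rfl, by simp⟩
  | cons b w ih =>
    obtain ⟨M, hM, h⟩ := ih
    refine ⟨max ‖b‖ M, le_max_of_le_right hM, fun a ha => ?_⟩
    rcases List.mem_cons.1 ha with rfl | ha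
    · exact le_max_left _ _
    · exact (h a ha).trans (le_max_right _ _)

theorem tendsto_regHyperlog {w : List ℂ} (hw : ∀ a ∈ w, Admissible a) :
    Tendsto (regHyperlog w) atTop (𝓝 (regValue w)) := by
  obtain ⟨c, hc, hc1, h⟩ := exists_nonzeroWord hw
  obtain ⟨M, hM, hMw⟩ := exists_norm_le_of_mem w
  obtain ⟨K, hK0, hK⟩ := exists_regHyperlog_sub_le hc hc1 M hM w.length
  have hcauchy : CauchySeq (regHyperlog w) := by
    rw [Metric.cauchySeq_iff']
    intro ε hε
    have h0 : Tendsto (fun z : ℝ => K * z ^ (-(1 / 4) : ℝ)) atTop (𝓝 0) := by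
      simpa using tendsto_rpow_neg_quarter.const_mul K
    obtain ⟨N, hN1, hN⟩ := ((eventually_ge_atTop (1 : ℝ)).and (h0.eventually_lt_const hε)).exists
    refine ⟨N, fun z hz => ?_⟩
    rw [dist_eq_norm]
    exact (hK w le_rfl h hMw N z hN1 hz).trans_lt hN
  obtain ⟨l, hl⟩ := cauchySeq_tendsto_of_complete hcauchy
  have h1 : Tendsto (fun s : ℝ => regHyperlog w (1 / s)) (𝓝[>] 0) (𝓝 l) := by
    simp only [one_div]
    exact hl.comp tendsto_inv_nhdsGT_zero
  rwa [(hasRegLimAtZero_regHyperlog_inv hw).eq_of_tendsto h1]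

/-- Convergence to the regularized value is uniform. -/
theorem exists_regHyperlog_sub_regValue_le {c : ℝ} (hc : 0 < c) (hc1 : c ≤ 1) (M : ℝ)
    (hM : 0 ≤ M) (n : ℕ) : ∃ K : ℝ, 0 ≤ K ∧ ∀ w : List ℂ, w.length ≤ n → Tame c w →
      (∀ a ∈ w, ‖a‖ ≤ M) → ∀ z : ℝ, 1 ≤ z →
        ‖regValue w - regHyperlog w z‖ ≤ K * z ^ (-(1 / 4) : ℝ) := by
  obtain ⟨K, hK0, hK⟩ := exists_regHyperlog_sub_le hc hc1 M hM n
  refine ⟨K, hK0, fun w hw ht hb z hz => ?_⟩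
  have h1 := ((tendsto_regHyperlog (ht.admissible hc hc1)).sub_const (regHyperlog w z)).norm
  refine le_of_tendsto h1 ?_
  filter_upwards [eventually_ge_atTop z] with z' hz' using hK w hw ht hb z z' hz hz'

/-! ### Scaling -/

theorem hyperlogWord_scale {s : ℝ} (hs : 0 < s) (u : List ℂ) {b : ℂ} (hb : b ≠ 0) (z : ℝ) :
    hyperlogWord ((u ++ [b]).map (s * ·)) (s * z) = hyperlogWord (u ++ [b]) z := by
  have hs0 : (s : ℂ) ≠ 0 := by exact_mod_cast hs.ne'
  have key : ∀ (a : ℂ) (w : List ℂ), (∃ τ ∈ a :: w, τ ≠ 0) →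
      (∀ z : ℝ, hyperlogWord (w.map (s * ·)) (s * z) = hyperlogWord w z) → ∀ z : ℝ,
      hyperlogWord ((a :: w).map (s * ·)) (s * z) = hyperlogWord (a :: w) z := by
    intro a w hne h z
    rw [List.map_cons, hyperlogWord_cons hne, hyperlogWord_cons]
    · have := intervalIntegral.smul_integral_comp_mul_left (a := 0) (b := z)
        (f := fun x : ℝ => hyperlogWord (w.map ((s : ℂ) * ·)) x / ((x : ℂ) - s * a)) s
      rw [mul_zero] at this
      rw [← this, Complex.real_smul, ← intervalIntegral.integral_const_mul]
      refine intervalIntegral.integral_congr fun x _ => ?_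
      simp only [h]
      push_cast
      rw [← mul_sub, ← mul_div_assoc, mul_div_mul_left _ _ hs0]
    · obtain ⟨τ, hτ, h0⟩ := hne
      rw [← List.map_cons (f := fun x : ℂ => (s : ℂ) * x)]
      exact ⟨s * τ, List.mem_map_of_mem hτ, mul_ne_zero hs0 h0⟩
  induction u generalizing z with
  | nil =>
    refine key b [] ⟨b, by simp, hb⟩ ?_ z
    intro z
    simp [hyperlogWord_nil]
  | cons a u ih => exact key a (u ++ [b]) ⟨b, by simp, hb⟩ ih z

theorem regHyperlog_scale {s : ℝ} (hs : 0 < s) (u : List ℂ) {b : ℂ} (hb : b ≠ 0) {z : ℝ}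
    (hz : 0 < z) :
    regHyperlog ((u ++ [b]).map (s * ·)) (s * z) =
      suffixSum (fun v => regHyperlog v z) (dividedPow (-(Real.log s : ℂ))) (u ++ [b]) := by
  have h1 : ∀ j, hyperlogWord (((u ++ [b]).map ((s : ℂ) * ·)).drop j) (s * z) =
      hyperlogWord ((u ++ [b]).drop j) z := by
    intro j
    rw [← List.map_drop]
    rcases le_or_gt j u.length with hj | hj
    · rw [List.drop_append_of_le_length hj, hyperlogWord_scale hs _ hb]
    · rw [List.drop_eq_nil_of_le (by simpa using hj)]
      rfl
  rw [regHyperlog, suffixSum, suffixSum, List.length_map]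
  simp only [h1]
  set w := u ++ [b]
  have h2 : (-(Real.log (s * z) : ℂ)) = -(Real.log s : ℂ) + -(Real.log z : ℂ) := by
    rw [Real.log_mul hs.ne' hz.ne']
    push_cast
    ring
  have h3 : ∀ j ∈ Finset.range (w.length + 1),
      dividedPow (-(Real.log (s * z) : ℂ)) j * hyperlogWord (w.drop j) z =
      ∑ k ∈ Finset.range (j + 1), (fun k i => dividedPow (-(Real.log s : ℂ)) k *
        (dividedPow (-(Real.log z : ℂ)) i * hyperlogWord (w.drop (k + i)) z)) k (j - k) := by
    intro j _
    rw [h2, dividedPow_add, Finset.sum_mul]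
    refine Finset.sum_congr rfl fun k hk => ?_
    have hk : k ≤ j := by simpa [Nat.lt_succ_iff] using hk
    simp only [Nat.add_sub_cancel' hk]
    ring
  refine (Finset.sum_congr rfl h3).trans ((Finset.sum_range_diag_flip _
    (fun k i => dividedPow (-(Real.log s : ℂ)) k *
      (dividedPow (-(Real.log z : ℂ)) i * hyperlogWord (w.drop (k + i)) z))).trans ?_)
  refine Finset.sum_congr rfl fun k hk => ?_
  have hk : k ≤ w.length := by simpa [Nat.lt_succ_iff] using hk
  rw [regHyperlog, suffixSum, Finset.mul_sum, List.length_drop]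
  simp only [List.drop_drop, Nat.sub_add_comm hk]

theorem regValue_scale {s : ℝ} (hs : 0 < s) (u : List ℂ) {b : ℂ} (hb : b ≠ 0)
    (hw : ∀ a ∈ u ++ [b], Admissible a) :
    regValue ((u ++ [b]).map (s * ·)) =
      suffixSum regValue (dividedPow (-(Real.log s : ℂ))) (u ++ [b]) := by
  have hw' : ∀ a ∈ (u ++ [b]).map ((s : ℂ) * ·), Admissible a := by
    intro a ha
    obtain ⟨a', ha', rfl⟩ := List.mem_map.1 ha
    intro x hx h
    have hs0 : (s : ℂ) ≠ 0 := by exact_mod_cast hs.ne'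
    refine hw a' ha' (x / s) (by positivity) ?_
    push_cast
    rw [eq_div_iff hs0, ← h]
    ring
  have h1 : Tendsto (fun z : ℝ => regHyperlog ((u ++ [b]).map ((s : ℂ) * ·)) (s * z)) atTop
      (𝓝 (regValue ((u ++ [b]).map ((s : ℂ) * ·)))) :=
    (tendsto_regHyperlog hw').comp (tendsto_id.const_mul_atTop hs)
  have h2 : Tendsto (fun z : ℝ => suffixSum (fun v => regHyperlog v z)
      (dividedPow (-(Real.log s : ℂ))) (u ++ [b])) atTop
      (𝓝 (suffixSum regValue (dividedPow (-(Real.log s : ℂ))) (u ++ [b]))) := by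
    refine tendsto_finsetSum _ fun j _ => ?_
    exact (tendsto_regHyperlog (admissible_drop hw j)).const_mul _
  refine tendsto_nhds_unique h1 (h2.congr' ?_)
  filter_upwards [eventually_gt_atTop 0] with z hz using (regHyperlog_scale hs u hb hz).symm

/-! ### Continuity in the letters -/

theorem nonzeroWord_snoc {c : ℝ} {u : List ℂ} {b : ℂ} (hu : ∀ a ∈ u, Cone c a) (hb : Good c b) :
    NonzeroWord c (u ++ [b]) := by
  induction u with
  | nil => exact .base 0 hb
  | cons a u ih => exact .cons (hu a (by simp)) (ih fun a' ha' => hu a' (by simp [ha']))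

theorem tendsto_hyperlogWord {ι : Type*} {l : Filter ℝ} [l.IsCountablyGenerated] {c : ℝ}
    (hc : 0 < c) (hc1 : c ≤ 1) {ev : ℝ → ι → ℂ} {ev₀ : ι → ℂ} {u : List ι} {b : ι}
    (hlim : ∀ a ∈ u ++ [b], Tendsto (fun t => ev t a) l (𝓝 (ev₀ a)))
    (hu : ∀ᶠ t in l, ∀ a ∈ u, Cone c (ev t a)) (hb : ∀ᶠ t in l, Good c (ev t b))
    (hu₀ : ∀ a ∈ u, Cone c (ev₀ a)) (hb₀ : Good c (ev₀ b)) {x : ℝ} (hx : 0 < x) :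
    Tendsto (fun t => hyperlogWord ((u ++ [b]).map (ev t)) x) l
      (𝓝 (hyperlogWord ((u ++ [b]).map ev₀) x)) := by
  have key : ∀ (a : ι) (w : List ι) (K : ℝ),
      Tendsto (fun t => ev t a) l (𝓝 (ev₀ a)) → Cone c (ev₀ a) →
      (∀ᶠ t in l, NonzeroWord c ((a :: w).map (ev t))) → NonzeroWord c ((a :: w).map ev₀) →
      (∀ᶠ t in l, ∀ x : ℝ, 0 < x →
        ‖hyperlogWord (w.map (ev t)) x / ((x : ℂ) - ev t a)‖ ≤ K / √x) →
      (∀ x : ℝ, 0 < x → Tendsto (fun t => hyperlogWord (w.map (ev t)) x) l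
        (𝓝 (hyperlogWord (w.map ev₀) x))) →
      ∀ x : ℝ, 0 < x → Tendsto (fun t => hyperlogWord ((a :: w).map (ev t)) x) l
        (𝓝 (hyperlogWord ((a :: w).map ev₀) x)) := by
    intro a w K ha ha₀ hnz hnz₀ hbd hw x hx
    simp only [List.map_cons] at hnz hnz₀ ⊢
    rw [hyperlogWord_cons (hnz₀.exists_ne_zero hc)]
    refine Tendsto.congr' (f₁ := fun t => ∫ y in (0 : ℝ)..x,
      hyperlogWord (w.map (ev t)) y / ((y : ℂ) - ev t a)) ?_ ?_
    · filter_upwards [hnz] with t ht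
      rw [hyperlogWord_cons (ht.exists_ne_zero hc)]
    refine intervalIntegral.tendsto_integral_filter_of_dominated_convergence (fun y => K / √y)
      ?_ ?_ (intervalIntegrable_div_sqrt K) ?_
    · filter_upwards [hnz] with t ht
      have hcone := ht.cone hc hc1
      have hcont := continuousOn_div_sub hc (hcone (ev t a) (by simp)) (continuousOn_hyperlogWord
        (w := w.map (ev t)) fun a' ha' => (hcone a' (List.mem_cons_of_mem _ ha')).admissible hc)
      rw [Set.uIoc_of_le hx.le]
      exact (hcont.mono fun y hy => hy.1).aestronglyMeasurable measurableSet_Ioc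
    · filter_upwards [hbd] with t ht
      refine Eventually.of_forall fun y hy => ht y ?_
      rw [Set.uIoc_of_le hx.le] at hy
      exact hy.1
    · refine Eventually.of_forall fun y hy => ?_
      rw [Set.uIoc_of_le hx.le] at hy
      exact (hw y hy.1).div (tendsto_const_nhds.sub ha) (ha₀.ne hc hy.1)
  induction u generalizing x with
  | nil =>
    obtain ⟨D, hD0, hD⟩ := exists_norm_hyperlogWord_replicate_le 0
    refine key b [] (D / c) (hlim b (by simp)) (hb₀.cone hc) ?_ (.base 0 hb₀) ?_ ?_ x hx
    · filter_upwards [hb] with t ht using .base 0 ht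
    · filter_upwards [hb] with t ht x hx
      exact norm_div_sub_le_of_good hc hx ht hD0 (hD 0 le_rfl x hx)
    · intro x _
      exact tendsto_const_nhds
  | cons a u ih =>
    obtain ⟨C, hC0, hC⟩ := exists_hyperlogWord_bound hc (u ++ [b]).length
    have hnz : ∀ᶠ t in l, NonzeroWord c ((u ++ [b]).map (ev t)) := by
      filter_upwards [hu, hb] with t h1 h2
      rw [List.map_append]
      refine nonzeroWord_snoc ?_ h2
      intro a' ha'
      obtain ⟨a'', ha'', rfl⟩ := List.mem_map.1 ha'
      exact h1 a'' (by simp [ha''])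
    have hnz₀ : NonzeroWord c ((u ++ [b]).map ev₀) := by
      rw [List.map_append]
      refine nonzeroWord_snoc ?_ hb₀
      intro a' ha'
      obtain ⟨a'', ha'', rfl⟩ := List.mem_map.1 ha'
      exact hu₀ a'' (by simp [ha''])
    refine key a (u ++ [b]) (C / c) (hlim a (by simp)) (hu₀ a (by simp)) ?_
      (.cons (hu₀ a (by simp)) hnz₀) ?_ ?_ x hx
    · filter_upwards [hu, hnz] with t h1 h2 using .cons (h1 a (by simp)) h2
    · filter_upwards [hu, hnz] with t h1 h2 x hx
      exact norm_div_sub_le_of_cone hc hx (h1 a (by simp)) hC0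
        ((hC _ (by simp) h2).2 x hx)
    · intro x hx
      exact ih (fun a' ha' => hlim a' (by
          simp only [List.cons_append, List.mem_cons]; exact Or.inr ha'))
        (by filter_upwards [hu] with t ht a' ha' using ht a' (by simp [ha']))
        (fun a' ha' => hu₀ a' (by simp [ha'])) hx

/-- Regularized values of words that end in a nonzero letter depend continuously on the
letters. -/
theorem tendsto_regValue {ι : Type*} {l : Filter ℝ} [l.IsCountablyGenerated] {c : ℝ}
    (hc : 0 < c) (hc1 : c ≤ 1) {ev : ℝ → ι → ℂ} {ev₀ : ι → ℂ} {u : List ι} {b : ι}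
    (hlim : ∀ a ∈ u ++ [b], Tendsto (fun t => ev t a) l (𝓝 (ev₀ a)))
    (hu : ∀ᶠ t in l, ∀ a ∈ u, Cone c (ev t a)) (hb : ∀ᶠ t in l, Good c (ev t b))
    (hu₀ : ∀ a ∈ u, Cone c (ev₀ a)) (hb₀ : Good c (ev₀ b)) :
    Tendsto (fun t => regValue ((u ++ [b]).map (ev t))) l
      (𝓝 (regValue ((u ++ [b]).map ev₀))) := by
  obtain ⟨M, hM0, hM⟩ := exists_norm_le_of_mem ((u ++ [b]).map ev₀)
  obtain ⟨K, hK0, hK⟩ := exists_regHyperlog_sub_regValue_le hc hc1 (M + 1) (by linarith)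
    (u ++ [b]).length
  have hnz : ∀ {f : ι → ℂ}, (∀ a ∈ u, Cone c (f a)) → Good c (f b) →
      Tame c ((u ++ [b]).map f) := by
    intro f h1 h2
    right
    rw [List.map_append]
    refine nonzeroWord_snoc ?_ h2
    intro a' ha'
    obtain ⟨a'', ha'', rfl⟩ := List.mem_map.1 ha'
    exact h1 a'' ha''
  have hMt : ∀ᶠ t in l, ∀ a ∈ (u ++ [b]).map (ev t), ‖a‖ ≤ M + 1 := by
    have h1 : ∀ᶠ t in l, ∀ a ∈ u ++ [b], ‖ev t a‖ ≤ M + 1 := by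
      have h2 : ∀ v : List ι, (∀ a ∈ v, a ∈ u ++ [b]) → ∀ᶠ t in l, ∀ a ∈ v, ‖ev t a‖ ≤ M + 1 := by
        intro v
        induction v with
        | nil => simp
        | cons a v ih =>
          intro hv
          have h3 : ‖ev₀ a‖ < M + 1 := by
            linarith [hM (ev₀ a) (List.mem_map_of_mem (hv a (by simp)))]
          filter_upwards [ih fun a' ha' => hv a' (by simp [ha']),
            (hlim a (hv a (by simp))).norm.eventually_le_const h3] with t h4 h5 a' ha'
          rcases List.mem_cons.1 ha' with rfl | ha'
          · exact h5
          · exact h4 a' ha'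
      exact h2 _ fun a ha => ha
    filter_upwards [h1] with t ht a ha
    obtain ⟨a', ha', rfl⟩ := List.mem_map.1 ha
    exact ht a' ha'
  have hG : ∀ z : ℝ, 0 < z → Tendsto (fun t => regHyperlog ((u ++ [b]).map (ev t)) z) l
      (𝓝 (regHyperlog ((u ++ [b]).map ev₀) z)) := by
    intro z hz
    simp only [regHyperlog, suffixSum, List.length_map]
    refine tendsto_finsetSum _ fun j _ => Tendsto.const_mul _ ?_
    simp only [← List.map_drop]
    rcases le_or_gt j u.length with hj | hj
    · rw [List.drop_append_of_le_length hj]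
      refine tendsto_hyperlogWord hc hc1 ?_ ?_ hb ?_ hb₀ hz
      · intro a ha
        refine hlim a ?_
        rcases List.mem_append.1 ha with h | h
        · exact List.mem_append_left _ (List.mem_of_mem_drop h)
        · exact List.mem_append_right _ h
      · filter_upwards [hu] with t ht a ha using ht a (List.mem_of_mem_drop ha)
      · exact fun a ha => hu₀ a (List.mem_of_mem_drop ha)
    · rw [List.drop_eq_nil_of_le (by simpa using hj)]
      exact tendsto_const_nhds
  rw [Metric.tendsto_nhds]
  intro ε hε
  have h0 : Tendsto (fun z : ℝ => K * z ^ (-(1 / 4) : ℝ)) atTop (𝓝 0) := by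
    simpa using tendsto_rpow_neg_quarter.const_mul K
  obtain ⟨z, hz1, hz⟩ := ((eventually_ge_atTop (1 : ℝ)).and
    (h0.eventually_lt_const (show 0 < ε / 3 by positivity))).exists
  have hM₀ : ∀ a ∈ (u ++ [b]).map ev₀, ‖a‖ ≤ M + 1 := fun a ha => by linarith [hM a ha]
  filter_upwards [hMt, hu, hb, Metric.tendsto_nhds.1 (hG z (by linarith)) (ε / 3) (by positivity)]
    with t h1 h2 h3 h4
  have h5 := hK ((u ++ [b]).map (ev t)) (by simp) (hnz h2 h3) h1 z hz1
  have h6 := hK ((u ++ [b]).map ev₀) (by simp) (hnz hu₀ hb₀) hM₀ z hz1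
  rw [dist_eq_norm] at h4 ⊢
  calc _ = ‖(regValue ((u ++ [b]).map (ev t)) - regHyperlog ((u ++ [b]).map (ev t)) z) +
        (regHyperlog ((u ++ [b]).map (ev t)) z - regHyperlog ((u ++ [b]).map ev₀) z) -
        (regValue ((u ++ [b]).map ev₀) - regHyperlog ((u ++ [b]).map ev₀) z)‖ := by
        congr 1; ring
    _ ≤ _ := norm_sub_le _ _
    _ ≤ _ := add_le_add_left (norm_add_le _ _) _
    _ < ε := by linarith

end

end Hyperlogarithm

namespace Hyperlogarithm

noncomputable section

open Filter Topology MeasureTheory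

/-! ### The total differential of hyperlogarithms -/

section Differential

variable {ι : Type*}

/-- The sum of `(q σ_{i-1} σ_i - q σ_i σ_{i+1}) * Λ (w ∖ σ_i)` over all letters of a word, without
`q σ_0 σ_1` and with `q σ_n σ_{n+1}` read as `q₀ σ_n`. -/
def letterDifferential (q : ι → ι → ℂ) (q₀ : ι → ℂ) : (List ι → ℂ) → List ι → ℂ
  | _, [] => 0
  | Λ, [i] => -q₀ i * Λ []
  | Λ, i :: j :: v =>
      q i j * (Λ (i :: v) - Λ (j :: v)) + letterDifferential q q₀ (fun x => Λ (i :: x)) (j :: v)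

variable {q : ι → ι → ℂ} {q₀ : ι → ℂ}

theorem letterDifferential_congr {Λ Λ' : List ι → ℂ} {w : List ι}
    (h : ∀ v : List ι, v.length + 1 = w.length → Λ v = Λ' v) :
    letterDifferential q q₀ Λ w = letterDifferential q q₀ Λ' w := by
  induction w generalizing Λ Λ' with
  | nil => rfl
  | cons i w ih =>
    cases w with
    | nil => simp only [letterDifferential, h [] rfl]
    | cons j v =>
      rw [letterDifferential, letterDifferential, h (i :: v) (by simp), h (j :: v) (by simp),
        ih fun x hx => h (i :: x) (by simpa using hx)]

theorem letterDifferential_const_mul (k : ℂ) (Λ : List ι → ℂ) (w : List ι) :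
    letterDifferential q q₀ (fun v => k * Λ v) w = k * letterDifferential q q₀ Λ w := by
  induction w generalizing Λ with
  | nil => simp [letterDifferential]
  | cons i w ih =>
    cases w with
    | nil => simp only [letterDifferential]; ring
    | cons j v => rw [letterDifferential, letterDifferential, ih]; ring

theorem letterDifferential_smul (k : ℂ) (Λ : List ι → ℂ) (w : List ι) :
    letterDifferential (fun i j => k * q i j) (fun i => k * q₀ i) Λ w =
      k * letterDifferential q q₀ Λ w := by
  induction w generalizing Λ with
  | nil => simp [letterDifferential]
  | cons i w ih =>
    cases w with
    | nil => simp only [letterDifferential]; ring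
    | cons j v => rw [letterDifferential, letterDifferential, ih]; ring

theorem letterDifferential_add (Λ Λ' : List ι → ℂ) (w : List ι) :
    letterDifferential q q₀ (fun v => Λ v + Λ' v) w =
      letterDifferential q q₀ Λ w + letterDifferential q q₀ Λ' w := by
  induction w generalizing Λ Λ' with
  | nil => simp [letterDifferential]
  | cons i w ih =>
    cases w with
    | nil => simp only [letterDifferential]; ring
    | cons j v =>
      rw [letterDifferential, letterDifferential, letterDifferential, ih]
      ring

theorem letterDifferential_sub (Λ Λ' : List ι → ℂ) (w : List ι) :
    letterDifferential q q₀ (fun v => Λ v - Λ' v) w =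
      letterDifferential q q₀ Λ w - letterDifferential q q₀ Λ' w := by
  have := letterDifferential_add (q := q) (q₀ := q₀) Λ (fun v => (-1) * Λ' v) w
  rw [letterDifferential_const_mul] at this
  simpa [sub_eq_add_neg] using this

theorem letterDifferential_eq_zero {Λ : List ι → ℂ} {w : List ι}
    (h : ∀ i ∈ w, ∀ j ∈ w, q i j = 0) (h₀ : ∀ i ∈ w, q₀ i = 0) :
    letterDifferential q q₀ Λ w = 0 := by
  induction w generalizing Λ with
  | nil => rfl
  | cons i w ih =>
    cases w with
    | nil => rw [letterDifferential, h₀ i (by simp)]; ring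
    | cons j v =>
      rw [letterDifferential, h i (by simp) j (by simp),
        ih (fun k hk l hl => h k (List.mem_cons_of_mem _ hk) l (List.mem_cons_of_mem _ hl))
          (fun k hk => h₀ k (List.mem_cons_of_mem _ hk))]
      ring

theorem hasDerivAt_letterDifferential {Λ : ℝ → List ι → ℂ} {Λ' : List ι → ℂ} {x : ℝ}
    (h : ∀ v, HasDerivAt (fun x => Λ x v) (Λ' v) x) (w : List ι) :
    HasDerivAt (fun x => letterDifferential q q₀ (Λ x) w) (letterDifferential q q₀ Λ' w) x := by
  induction w generalizing Λ Λ' with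
  | nil => exact hasDerivAt_const x (0 : ℂ)
  | cons i w ih =>
    cases w with
    | nil => exact (h []).const_mul _
    | cons j v =>
      exact (((h (i :: v)).sub (h (j :: v))).const_mul _).add (ih fun y => h (i :: y))

theorem HasRegLimAtZero.letterDifferential {q : ℝ → ι → ι → ℂ} {q₀ : ℝ → ι → ℂ}
    {Λ : ℝ → List ι → ℂ} {q' : ι → ι → ℂ} {q₀' : ι → ℂ} {Λ' : List ι → ℂ}
    (hq : ∀ i j, HasRegLimAtZero (fun t => q t i j) (q' i j))
    (hq₀ : ∀ i, HasRegLimAtZero (fun t => q₀ t i) (q₀' i)) {w : List ι}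
    (h : ∀ v : List ι, v.length + 1 = w.length → HasRegLimAtZero (fun t => Λ t v) (Λ' v)) :
    HasRegLimAtZero (fun t => letterDifferential (q t) (q₀ t) (Λ t) w)
      (letterDifferential q' q₀' Λ' w) := by
  induction w generalizing Λ Λ' with
  | nil => exact HasRegLimAtZero.const 0
  | cons i w ih =>
    cases w with
    | nil => exact (hq₀ i).neg.mul (h [] rfl)
    | cons j v =>
      exact ((hq i j).mul ((h (i :: v) (by simp)).sub (h (j :: v) (by simp)))).add
        (ih fun y hy => h (i :: y) (by simpa using hy))

theorem letterDifferential_counit {i j : ι} {v : List ι} (k : ℂ) :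
    letterDifferential q q₀ (fun x => if x = [] then k else 0) (i :: j :: v) = 0 := by
  rw [letterDifferential_congr (Λ' := fun _ => 0 * 0), letterDifferential_const_mul, zero_mul]
  intro x hx
  rw [if_neg (by rintro rfl; simp at hx), zero_mul]

theorem norm_letterDifferential_le {B δ : ℝ} (hB : 0 ≤ B) (hδ : 0 ≤ δ) (hq : ∀ i j, ‖q i j‖ ≤ B)
    (hq₀ : ∀ i, ‖q₀ i‖ ≤ B) {Λ : List ι → ℂ} {w : List ι}
    (h : ∀ v : List ι, v.length + 1 = w.length → ‖Λ v‖ ≤ δ) :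
    ‖letterDifferential q q₀ Λ w‖ ≤ w.length * (2 * B * δ) := by
  induction w generalizing Λ with
  | nil => simp [letterDifferential]
  | cons i w ih =>
    cases w with
    | nil =>
      rw [letterDifferential, norm_mul, norm_neg]
      have := mul_le_mul (hq₀ i) (h [] rfl) (norm_nonneg _) hB
      simp only [List.length_singleton, Nat.cast_one, one_mul]
      nlinarith [mul_nonneg hB hδ]
    | cons j v =>
      rw [letterDifferential]
      have h1 := ih (Λ := fun x => Λ (i :: x)) fun x hx => h (i :: x) (by simpa using hx)
      have h2 : ‖Λ (i :: v) - Λ (j :: v)‖ ≤ 2 * δ := by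
        refine (norm_sub_le _ _).trans ?_
        linarith [h (i :: v) (by simp), h (j :: v) (by simp)]
      have h3 : ‖q i j * (Λ (i :: v) - Λ (j :: v))‖ ≤ B * (2 * δ) := by
        rw [norm_mul]
        exact mul_le_mul (hq i j) h2 (norm_nonneg _) hB
      refine (norm_add_le _ _).trans ((add_le_add h3 h1).trans (le_of_eq ?_))
      simp only [List.length_cons]
      push_cast
      ring

theorem suffixSum_cons (Λ : List ι → ℂ) (e : ℕ → ℂ) (i : ι) (w : List ι) :
    suffixSum Λ e (i :: w) = e 0 * Λ (i :: w) + suffixSum Λ (fun j => e (j + 1)) w := by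
  rw [suffixSum, suffixSum, List.length_cons, Finset.sum_range_succ', add_comm]
  simp

theorem letterDifferential_suffixSum (Λ : List ι → ℂ) (e : ℕ → ℂ) (w : List ι) :
    letterDifferential q q₀ (suffixSum Λ e) w = suffixSum (letterDifferential q q₀ Λ) e w := by
  induction w generalizing Λ e with
  | nil => simp [letterDifferential, suffixSum]
  | cons i w ih =>
    cases w with
    | nil =>
      rw [suffixSum_cons]
      simp only [letterDifferential, suffixSum, List.length_nil, zero_add, Finset.sum_range_one,
        List.drop_zero]
      ring
    | cons j v =>
      rw [suffixSum_cons, letterDifferential, letterDifferential]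
      simp only [suffixSum_cons Λ e]
      rw [letterDifferential_add, letterDifferential_const_mul, ih]
      ring

end Differential

/-- A finite family of letters depending differentiably on a parameter `t ∈ U`. -/
structure LetterFamily {ι : Type*} (U : Set ℝ) (a a' : ι → ℝ → ℂ) : Prop where
  isOpen : IsOpen U
  hasDerivAt : ∀ i, ∀ t ∈ U, HasDerivAt (a i) (a' i t) t
  continuousOn_deriv : ∀ i, ContinuousOn (a' i) U
  admissible : ∀ i, ∀ t ∈ U, Admissible (a i t)
  zero_or : ∀ i, (∀ t ∈ U, a i t = 0) ∨ ∀ t ∈ U, a i t ≠ 0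
  eq_or : ∀ i j, (∀ t ∈ U, a i t = a j t) ∨ ∀ t ∈ U, a i t ≠ a j t

section Family

variable {ι : Type*} {U : Set ℝ} {a a' : ι → ℝ → ℂ}

/-- The logarithmic derivative of the difference of two letters. -/
def logDiff (a a' : ι → ℝ → ℂ) (t : ℝ) (i j : ι) : ℂ := (a' i t - a' j t) / (a i t - a j t)

/-- The logarithmic derivative of a letter. -/
def logDiffZero (a a' : ι → ℝ → ℂ) (t : ℝ) (i : ι) : ℂ := a' i t / a i t

/-- The derivative of the hyperlogarithm with respect to the parameter of the letters. -/
def paramDeriv (a a' : ι → ℝ → ℂ) (w : List ι) (x t : ℝ) : ℂ :=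
  (match w with
    | [] => 0
    | i :: v => -a' i t / ((x : ℂ) - a i t) * hyperlogWord (v.map (a · t)) x) +
  letterDifferential (logDiff a a' t) (logDiffZero a a' t)
    (fun v => hyperlogWord (v.map (a · t)) x) w

namespace LetterFamily

variable (H : LetterFamily U a a')
include H

theorem deriv_eq_zero {i : ι} {t : ℝ} (ht : t ∈ U) (h : a i t = 0) : a' i t = 0 := by
  have h0 : ∀ s ∈ U, a i s = 0 := (H.zero_or i).resolve_right fun h' => h' t ht h
  have h1 : HasDerivAt (a i) 0 t :=
    (hasDerivAt_const t (0 : ℂ)).congr_of_eventuallyEq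
      (by filter_upwards [H.isOpen.mem_nhds ht] with s hs using h0 s hs)
  exact (H.hasDerivAt i t ht).unique h1

theorem logDiff_mul {i j : ι} {t : ℝ} (ht : t ∈ U) :
    logDiff a a' t i j * (a i t - a j t) = a' i t - a' j t := by
  rcases H.eq_or i j with h | h
  · have h1 : HasDerivAt (a i) (a' j t) t := (H.hasDerivAt j t ht).congr_of_eventuallyEq
      (by filter_upwards [H.isOpen.mem_nhds ht] with s hs using h s hs)
    rw [h t ht, (H.hasDerivAt i t ht).unique h1]
    ring
  · exact div_mul_cancel₀ _ (sub_ne_zero.2 (h t ht))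

theorem map_admissible {t : ℝ} (ht : t ∈ U) (w : List ι) :
    ∀ b ∈ w.map (a · t), Admissible b := by
  intro b hb
  obtain ⟨i, _, rfl⟩ := List.mem_map.1 hb
  exact H.admissible i t ht

theorem hasDerivAt_paramDeriv (i : ι) (v : List ι) {t : ℝ} (ht : t ∈ U) {x : ℝ} (hx : 0 < x) :
    HasDerivAt (fun x => paramDeriv a a' (i :: v) x t)
      (paramDeriv a a' v x t / ((x : ℂ) - a i t) +
        a' i t * (hyperlogWord (v.map (a · t)) x / ((x : ℂ) - a i t)) / ((x : ℂ) - a i t)) x := by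
  have hi := (H.admissible i t ht).sub_ne hx
  have hk : HasDerivAt (fun x : ℝ => -a' i t / ((x : ℂ) - a i t))
      (a' i t / ((x : ℂ) - a i t) ^ 2) x := by
    have h1 : HasDerivAt (fun x : ℝ => (x : ℂ) - a i t) 1 x :=
      (Complex.ofRealCLM.hasDerivAt.sub_const _)
    have h2 := (h1.fun_inv hi).const_mul (-a' i t)
    simp only [← div_eq_mul_inv] at h2
    refine h2.congr_deriv ?_
    field_simp
  have hΛ : ∀ y : List ι, HasDerivAt (fun x => hyperlogWord (y.map (a · t)) x)
      (match y with
        | [] => 0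
        | j :: y => hyperlogWord (y.map (a · t)) x / ((x : ℂ) - a j t)) x := by
    intro y
    cases y with
    | nil => exact hasDerivAt_const x (1 : ℂ)
    | cons j y => exact hasDerivAt_hyperlogWord (H.map_admissible ht (j :: y)) hx
  cases v with
  | nil =>
    refine ((hk.mul (hΛ [])).add (hasDerivAt_letterDifferential hΛ [i])).congr_deriv ?_
    simp only [paramDeriv, letterDifferential, List.map_nil, hyperlogWord_nil]
    field_simp
    ring
  | cons j v =>
    have hj := (H.admissible j t ht).sub_ne hx
    refine ((hk.mul (hΛ (j :: v))).add (hasDerivAt_letterDifferential hΛ (i :: j :: v))).congr_deriv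
      ?_
    have h1 : letterDifferential (logDiff a a' t) (logDiffZero a a' t)
        (fun y => hyperlogWord (y.map (a · t)) x / ((x : ℂ) - a i t)) (j :: v) =
        ((x : ℂ) - a i t)⁻¹ * letterDifferential (logDiff a a' t) (logDiffZero a a' t)
          (fun y => hyperlogWord (y.map (a · t)) x) (j :: v) := by
      rw [← letterDifferential_const_mul]
      exact letterDifferential_congr fun y _ => by ring
    have h2 := H.logDiff_mul (i := i) (j := j) ht
    rw [letterDifferential]
    simp only [h1, paramDeriv]
    generalize letterDifferential (logDiff a a' t) (logDiffZero a a' t)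
      (fun y => hyperlogWord (y.map (a · t)) x) (j :: v) = Q
    have h3 : logDiff a a' t i j * (hyperlogWord (v.map (a · t)) x / ((x : ℂ) - a i t) -
        hyperlogWord (v.map (a · t)) x / ((x : ℂ) - a j t)) =
        (a' i t - a' j t) * hyperlogWord (v.map (a · t)) x /
          (((x : ℂ) - a i t) * ((x : ℂ) - a j t)) := by
      rw [← h2]
      field_simp
      ring
    rw [h3]
    field_simp
    ring

theorem hasRegLimAtZero_paramDeriv (i : ι) (v : List ι) {t : ℝ} (ht : t ∈ U) :
    HasRegLimAtZero (fun x => paramDeriv a a' (i :: v) x t) 0 := by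
  have hΛ : ∀ y : List ι, HasRegLimAtZero (fun x => hyperlogWord (y.map (a · t)) x)
      (if y = [] then 1 else 0) := fun y => by
    simpa using hasRegLimAtZero_hyperlogWord (H.map_admissible ht y)
  have hD := HasRegLimAtZero.letterDifferential
    (q := fun _ => logDiff a a' t) (q₀ := fun _ => logDiffZero a a' t)
    (fun i j => HasRegLimAtZero.const (logDiff a a' t i j))
    (fun i => HasRegLimAtZero.const (logDiffZero a a' t i)) (w := i :: v)
    (Λ := fun x y => hyperlogWord (y.map (a · t)) x) (fun y _ => hΛ y)
  have hk : HasRegLimAtZero (fun x : ℝ => -a' i t / ((x : ℂ) - a i t)) (logDiffZero a a' t i) := by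
    by_cases h0 : a i t = 0
    · rw [logDiffZero, H.deriv_eq_zero ht h0]
      simpa using HasRegLimAtZero.const 0
    · have hA : AnalyticAt ℂ (fun x : ℂ => -a' i t / (x - a i t)) 0 :=
        analyticAt_const.div (analyticAt_id.sub analyticAt_const) (by simpa using h0)
      have := HasRegLimAtZero.of_analytic hA
      rwa [zero_sub, neg_div_neg_eq] at this
  have h := (hk.mul (hΛ v)).add hD
  cases v with
  | nil =>
    simp only [letterDifferential, if_true, mul_one, add_neg_cancel] at h
    exact h
  | cons j v =>
    rw [letterDifferential_counit, if_neg (List.cons_ne_nil j v), mul_zero, add_zero] at h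
    exact h

/-- Integration of a function with a given derivative and regularized limit zero. -/
theorem paramDeriv_eq_integral (i : ι) (v : List ι) {t : ℝ} (ht : t ∈ U) {K : ℝ}
    (hK : ∀ x : ℝ, 0 < x → ‖paramDeriv a a' v x t / ((x : ℂ) - a i t) +
        a' i t * (hyperlogWord (v.map (a · t)) x / ((x : ℂ) - a i t)) / ((x : ℂ) - a i t)‖ ≤
      K / √x)
    (hc : ContinuousOn (fun x : ℝ => paramDeriv a a' v x t / ((x : ℂ) - a i t) +
        a' i t * (hyperlogWord (v.map (a · t)) x / ((x : ℂ) - a i t)) / ((x : ℂ) - a i t))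
      (Set.Ioi 0)) {z : ℝ} (hz : 0 < z) :
    paramDeriv a a' (i :: v) z t = ∫ x in (0 : ℝ)..z, (paramDeriv a a' v x t / ((x : ℂ) - a i t) +
      a' i t * (hyperlogWord (v.map (a · t)) x / ((x : ℂ) - a i t)) / ((x : ℂ) - a i t)) := by
  set g : ℝ → ℂ := fun x => paramDeriv a a' v x t / ((x : ℂ) - a i t) +
    a' i t * (hyperlogWord (v.map (a · t)) x / ((x : ℂ) - a i t)) / ((x : ℂ) - a i t) with hg
  have hconst : ∀ s, 0 < s → paramDeriv a a' (i :: v) s t - ∫ x in (0 : ℝ)..s, g x =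
      paramDeriv a a' (i :: v) z t - ∫ x in (0 : ℝ)..z, g x := by
    intro s hs
    have hd : ∀ s, 0 < s → HasDerivAt (fun s => paramDeriv a a' (i :: v) s t -
        ∫ x in (0 : ℝ)..s, g x) 0 s := fun s hs =>
      ((H.hasDerivAt_paramDeriv i v ht hs).sub
        (hasDerivAt_integral_of_norm_le hc hK hs)).congr_deriv (sub_self _)
    exact isOpen_Ioi.is_const_of_deriv_eq_zero (𝕜 := ℝ)
      (f := fun s => paramDeriv a a' (i :: v) s t - ∫ x in (0 : ℝ)..s, g x)
      isPreconnected_Ioi (s := Set.Ioi 0)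
      (fun s hs => (hd s hs).differentiableAt.differentiableWithinAt)
      (fun s hs => (hd s hs).deriv) hs hz
  have h0 : Tendsto (fun s => ∫ x in (0 : ℝ)..s, g x) (𝓝[>] 0) (𝓝 0) := by
    have h1 : Tendsto (fun t : ℝ => 2 * K * √t) (𝓝[>] 0) (𝓝 0) := by
      have : ContinuousAt (fun t : ℝ => 2 * K * √t) 0 := by fun_prop
      have := this.tendsto
      simp only [Real.sqrt_zero, mul_zero] at this
      exact this.mono_left nhdsWithin_le_nhds
    refine squeeze_zero_norm' ?_ h1
    filter_upwards [self_mem_nhdsWithin] with s hs using norm_integral_le_sqrt hK hs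
  have h1 : Tendsto (fun s => paramDeriv a a' (i :: v) s t) (𝓝[>] 0)
      (𝓝 (paramDeriv a a' (i :: v) z t - ∫ x in (0 : ℝ)..z, g x)) := by
    have h2 := h0.add (tendsto_const_nhds
      (x := paramDeriv a a' (i :: v) z t - ∫ x in (0 : ℝ)..z, g x))
    rw [zero_add] at h2
    refine h2.congr' ?_
    filter_upwards [self_mem_nhdsWithin] with s hs
    rw [← hconst s hs]
    ring
  have h2 := (H.hasRegLimAtZero_paramDeriv i v ht).eq_of_tendsto h1
  exact (sub_eq_zero.1 h2.symm)

theorem paramDeriv_eq_zero {w : List ι} {t : ℝ} (ht : t ∈ U) (hw : ∀ i ∈ w, a i t = 0)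
    (x : ℝ) : paramDeriv a a' w x t = 0 := by
  have h' : ∀ i ∈ w, a' i t = 0 := fun i hi => H.deriv_eq_zero ht (hw i hi)
  have hD : letterDifferential (logDiff a a' t) (logDiffZero a a' t)
      (fun v => hyperlogWord (v.map (a · t)) x) w = 0 :=
    letterDifferential_eq_zero (fun i hi j hj => by simp [logDiff, h' i hi, h' j hj])
      (fun i hi => by simp [logDiffZero, h' i hi])
  rw [paramDeriv.eq_def, hD]
  cases w with
  | nil => simp
  | cons i v => simp [h' i (by simp)]

theorem continuousOn_paramDeriv (w : List ι) {t : ℝ} (ht : t ∈ U) :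
    ContinuousOn (fun x => paramDeriv a a' w x t) (Set.Ioi 0) := by
  cases w with
  | nil => simpa [paramDeriv, letterDifferential] using continuousOn_const
  | cons i v =>
    exact fun x hx => (H.hasDerivAt_paramDeriv i v ht hx).continuousAt.continuousWithinAt

end LetterFamily

/-- Uniform bounds for a family of letters on a set `V` of parameters. -/
structure UniformBounds (a a' : ι → ℝ → ℂ) (V : Set ℝ) (c M : ℝ) : Prop where
  pos : 0 < c
  le_one : c ≤ 1
  zero_or_good : ∀ t ∈ V, ∀ i, a i t = 0 ∨ Good c (a i t)
  norm_le : ∀ t ∈ V, ∀ i, ‖a i t‖ ≤ M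
  norm_deriv_le : ∀ t ∈ V, ∀ i, ‖a' i t‖ ≤ M
  norm_logDiff_le : ∀ t ∈ V, ∀ i j, ‖logDiff a a' t i j‖ ≤ M
  norm_logDiffZero_le : ∀ t ∈ V, ∀ i, ‖logDiffZero a a' t i‖ ≤ M

theorem exists_uniform_norm_le {κ : Type*} [Finite κ] {f : κ → ℝ → ℂ} {t₀ : ℝ}
    (hf : ∀ k, ContinuousAt (f k) t₀) :
    ∃ M₀ : ℝ, ∀ M, M₀ ≤ M → ∀ᶠ t in 𝓝 t₀, ∀ k, ‖f k t‖ ≤ M := by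
  have h1 : ∀ᶠ M : ℝ in atTop, ∀ k, ‖f k t₀‖ < M :=
    eventually_all.2 fun k => eventually_gt_atTop _
  obtain ⟨M₀, hM₀⟩ := h1.exists
  refine ⟨M₀, fun M hM => eventually_all.2 fun k => ?_⟩
  exact ((hf k).norm.eventually_lt_const ((hM₀ k).trans_le hM)).mono fun t ht => ht.le

theorem LetterFamily.exists_uniformBounds [Finite ι] (H : LetterFamily U a a') {t₀ : ℝ}
    (ht₀ : t₀ ∈ U) :
    ∃ (V : Set ℝ) (c M : ℝ), IsOpen V ∧ t₀ ∈ V ∧ V ⊆ U ∧ 0 ≤ M ∧ UniformBounds a a' V c M := by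
  have hca : ∀ i, ContinuousAt (a i) t₀ := fun i => (H.hasDerivAt i t₀ ht₀).continuousAt
  have hca' : ∀ i, ContinuousAt (a' i) t₀ := fun i =>
    (H.continuousOn_deriv i).continuousAt (H.isOpen.mem_nhds ht₀)
  have hU := H.isOpen.mem_nhds ht₀
  have hq : ∀ p : ι × ι, ContinuousAt (fun t => logDiff a a' t p.1 p.2) t₀ := by
    rintro ⟨i, j⟩
    rcases H.eq_or i j with h | h
    · refine (continuousAt_const (y := (0 : ℂ))).congr ?_
      filter_upwards [hU] with t ht
      simp [logDiff, h t ht]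
    · exact ((hca' i).sub (hca' j)).div ((hca i).sub (hca j)) (sub_ne_zero.2 (h t₀ ht₀))
  have hq₀ : ∀ i, ContinuousAt (fun t => logDiffZero a a' t i) t₀ := by
    intro i
    rcases H.zero_or i with h | h
    · refine (continuousAt_const (y := (0 : ℂ))).congr ?_
      filter_upwards [hU] with t ht
      simp [logDiffZero, h t ht]
    · exact (hca' i).div (hca i) (h t₀ ht₀)
  obtain ⟨M₁, h₁⟩ := exists_uniform_norm_le hca
  obtain ⟨M₂, h₂⟩ := exists_uniform_norm_le hca'
  obtain ⟨M₃, h₃⟩ := exists_uniform_norm_le hq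
  obtain ⟨M₄, h₄⟩ := exists_uniform_norm_le hq₀
  obtain ⟨M, hM₁, hM₂, hM₃, hM₄, hM0⟩ := ((eventually_ge_atTop M₁).and
    ((eventually_ge_atTop M₂).and ((eventually_ge_atTop M₃).and
      ((eventually_ge_atTop M₄).and (eventually_ge_atTop (0 : ℝ)))))).exists
  have hgood : ∃ c : ℝ, 0 < c ∧ c ≤ 1 ∧ ∀ i, a i t₀ ≠ 0 → Good (2 * c) (a i t₀) := by
    have h1 : ∀ i, ∃ d : ℝ, 0 < d ∧ (a i t₀ ≠ 0 → Good d (a i t₀)) := by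
      intro i
      by_cases h0 : a i t₀ = 0
      · exact ⟨1, one_pos, fun h => absurd h0 h⟩
      · obtain ⟨d, hd, -, hd'⟩ := (H.admissible i t₀ ht₀).exists_good h0
        exact ⟨d, hd, fun _ => hd'⟩
    choose d hd hd' using h1
    have h2 : ∀ᶠ c : ℝ in 𝓝[>] 0, ∀ i, 2 * c < d i := eventually_all.2 fun i => by
      have : Tendsto (fun c : ℝ => 2 * c) (𝓝[>] 0) (𝓝 0) := by
        have : ContinuousAt (fun c : ℝ => 2 * c) 0 := by fun_prop
        have := this.tendsto
        rw [mul_zero] at this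
        exact this.mono_left nhdsWithin_le_nhds
      exact this.eventually_lt_const (hd i)
    obtain ⟨c, hc, hc', hc1⟩ := (h2.and ((eventually_mem_nhdsWithin
      (s := Set.Ioi (0 : ℝ))).and (Ioc_mem_nhdsGT (zero_lt_one (α := ℝ))))).exists
    exact ⟨c, hc', hc1.2, fun i hi => (hd' i hi).mono (hc i).le⟩
  obtain ⟨c, hc, hc1, hgood⟩ := hgood
  have h₅ : ∀ᶠ t in 𝓝 t₀, ∀ i, a i t = 0 ∨ Good c (a i t) := eventually_all.2 fun i => by
    rcases H.zero_or i with h | h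
    · filter_upwards [hU] with t ht using Or.inl (h t ht)
    · filter_upwards [Metric.tendsto_nhds.1 (hca i).tendsto c hc] with t ht
      rw [dist_eq_norm] at ht
      exact Or.inr ((hgood i (h t₀ ht₀)).of_dist_le hc.le ht.le)
  have hall := (h₁ M hM₁).and ((h₂ M hM₂).and ((h₃ M hM₃).and ((h₄ M hM₄).and (h₅.and hU))))
  obtain ⟨V, hV, hVo, htV⟩ := mem_nhds_iff.1 hall
  refine ⟨V, c, M, hVo, htV, fun t ht => (hV ht).2.2.2.2.2, hM0, hc, hc1,
    fun t ht => (hV ht).2.2.2.2.1, fun t ht => (hV ht).1, fun t ht => (hV ht).2.1,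
    fun t ht i j => (hV ht).2.2.1 (i, j), fun t ht => (hV ht).2.2.2.1⟩

namespace UniformBounds

variable {V : Set ℝ} {c M : ℝ}

theorem tame (B : UniformBounds a a' V c M) {t : ℝ} (ht : t ∈ V) (w : List ι) :
    Tame c (w.map (a · t)) := by
  refine eq_replicate_or_nonzeroWord B.pos B.le_one ?_
  intro b hb
  obtain ⟨i, _, rfl⟩ := List.mem_map.1 hb
  exact B.zero_or_good t ht i

theorem cone (B : UniformBounds a a' V c M) {t : ℝ} (ht : t ∈ V) (i : ι) : Cone c (a i t) := by
  rcases B.zero_or_good t ht i with h | h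
  · rw [h]; exact cone_zero B.le_one
  · exact h.cone B.pos

/-- Differentiation of hyperlogarithms with respect to the parameter. -/
theorem hasDerivAt_hyperlogWord_param (B : UniformBounds a a' V c M) (H : LetterFamily U a a')
    (hVo : IsOpen V) (hVU : V ⊆ U) (hM : 0 ≤ M) (w : List ι)
    (hw : ∃ i ∈ w, ∀ t ∈ U, a i t ≠ 0) :
    ∃ K : ℝ, 0 ≤ K ∧ ∀ t ∈ V, ∀ x : ℝ, 0 < x → ‖paramDeriv a a' w x t‖ ≤ K * √x ∧
      HasDerivAt (fun t => hyperlogWord (w.map (a · t)) x) (paramDeriv a a' w x t) t := by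
  induction w with
  | nil => simp at hw
  | cons i v ih =>
    have hc := B.pos
    have hnz : ∀ t ∈ V, NonzeroWord c ((i :: v).map (a · t)) := by
      intro t ht
      refine (B.tame ht (i :: v)).resolve_left fun h => ?_
      obtain ⟨j, hj, hj0⟩ := hw
      refine hj0 t (hVU ht) ?_
      have : a j t ∈ (i :: v).map (a · t) := List.mem_map.2 ⟨j, hj, rfl⟩
      rw [h] at this
      exact List.eq_of_mem_replicate this
    have hsplit : ∃ K₁ : ℝ, 0 ≤ K₁ ∧ ∀ t ∈ V, ∀ x : ℝ, 0 < x →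
        ‖paramDeriv a a' v x t / ((x : ℂ) - a i t)‖ ≤ K₁ / √x ∧
        ‖hyperlogWord (v.map (a · t)) x / ((x : ℂ) - a i t)‖ ≤ K₁ / √x ∧
        HasDerivAt (fun t => hyperlogWord (v.map (a · t)) x) (paramDeriv a a' v x t) t := by
      by_cases hv : ∃ i ∈ v, ∀ t ∈ U, a i t ≠ 0
      · obtain ⟨K, hK0, hK⟩ := ih hv
        obtain ⟨C, hC0, hC⟩ := exists_hyperlogWord_bound hc v.length
        refine ⟨(K + C) / c, by positivity, fun t ht x hx => ⟨?_, ?_, (hK t ht x hx).2⟩⟩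
        · refine (norm_div_sub_le_of_cone hc hx (B.cone ht i) hK0 (hK t ht x hx).1).trans ?_
          gcongr
          linarith
        · have hnz' : NonzeroWord c (v.map (a · t)) := by
            refine (B.tame ht v).resolve_left fun h => ?_
            obtain ⟨j, hj, hj0⟩ := hv
            refine hj0 t (hVU ht) ?_
            have : a j t ∈ v.map (a · t) := List.mem_map.2 ⟨j, hj, rfl⟩
            rw [h] at this
            exact List.eq_of_mem_replicate this
          refine (norm_div_sub_le_of_cone hc hx (B.cone ht i) hC0
            ((hC _ (by simp) hnz').2 x hx)).trans ?_
          gcongr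
          linarith
      · have hz : ∀ j ∈ v, ∀ t ∈ U, a j t = 0 := fun j hj =>
          (H.zero_or j).resolve_right fun h => hv ⟨j, hj, h⟩
        have hi : ∀ t ∈ U, a i t ≠ 0 := by
          obtain ⟨j, hj, hj0⟩ := hw
          rcases List.mem_cons.1 hj with rfl | hj
          · exact hj0
          · exact absurd ⟨j, hj, hj0⟩ hv
        have hrep : ∀ t ∈ U, v.map (a · t) = List.replicate v.length 0 := by
          intro t ht
          rw [List.eq_replicate_iff]
          refine ⟨by simp, fun b hb => ?_⟩
          obtain ⟨j, hj, rfl⟩ := List.mem_map.1 hb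
          exact hz j hj t ht
        obtain ⟨D, hD0, hD⟩ := exists_norm_hyperlogWord_replicate_le v.length
        refine ⟨D / c, by positivity, fun t ht x hx => ⟨?_, ?_, ?_⟩⟩
        · rw [H.paramDeriv_eq_zero (hVU ht) (fun j hj => hz j hj t (hVU ht)), zero_div, norm_zero]
          positivity
        · rw [hrep t (hVU ht)]
          exact norm_div_sub_le_of_good hc hx
            ((B.zero_or_good t ht i).resolve_left (hi t (hVU ht))) hD0 (hD _ le_rfl x hx)
        · rw [H.paramDeriv_eq_zero (hVU ht) (fun j hj => hz j hj t (hVU ht))]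
          refine (hasDerivAt_const t (hyperlogWord (List.replicate v.length 0) x)).congr_of_eventuallyEq
            ?_
          filter_upwards [hVo.mem_nhds ht] with s hs
          rw [hrep s (hVU hs)]
    obtain ⟨K₁, hK₁0, hK₁⟩ := hsplit
    set g : ℝ → ℝ → ℂ := fun t x => paramDeriv a a' v x t / ((x : ℂ) - a i t) +
      a' i t * (hyperlogWord (v.map (a · t)) x / ((x : ℂ) - a i t)) / ((x : ℂ) - a i t) with hg
    have hratio : ∀ t ∈ V, ∀ x : ℝ, 0 < x → ‖a' i t / ((x : ℂ) - a i t)‖ ≤ M / c := by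
      intro t ht x hx
      rcases B.zero_or_good t ht i with h | h
      · rw [H.deriv_eq_zero (hVU ht) h, zero_div, norm_zero]
        positivity
      · rw [norm_div]
        refine div_le_div₀ hM (B.norm_deriv_le t ht i) hc ?_
        have := h x hx
        nlinarith
    set K₂ := K₁ + M / c * K₁ with hK₂
    have hK₂0 : 0 ≤ K₂ := by positivity
    have hgb : ∀ t ∈ V, ∀ x : ℝ, 0 < x → ‖g t x‖ ≤ K₂ / √x := by
      intro t ht x hx
      obtain ⟨h1, h2, -⟩ := hK₁ t ht x hx
      have h3 : a' i t * (hyperlogWord (v.map (a · t)) x / ((x : ℂ) - a i t)) /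
          ((x : ℂ) - a i t) = a' i t / ((x : ℂ) - a i t) *
            (hyperlogWord (v.map (a · t)) x / ((x : ℂ) - a i t)) := by ring
      rw [hg]
      simp only [h3]
      refine (norm_add_le _ _).trans ?_
      rw [norm_mul, hK₂, add_div, mul_div_assoc]
      exact add_le_add h1 (mul_le_mul (hratio t ht x hx) h2 (norm_nonneg _) (by positivity))
    have hgc : ∀ t ∈ V, ContinuousOn (g t) (Set.Ioi 0) := by
      intro t ht
      have hcone := B.cone ht i
      refine (continuousOn_div_sub hc hcone (H.continuousOn_paramDeriv v (hVU ht))).add ?_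
      refine continuousOn_div_sub hc hcone (continuousOn_const.mul ?_)
      exact continuousOn_div_sub hc hcone
        (continuousOn_hyperlogWord (H.map_admissible (hVU ht) v))
    have hint : ∀ t ∈ V, ∀ x : ℝ, 0 < x →
        paramDeriv a a' (i :: v) x t = ∫ y in (0 : ℝ)..x, g t y := fun t ht x hx =>
      H.paramDeriv_eq_integral i v (hVU ht) (hgb t ht) (hgc t ht) hx
    refine ⟨2 * K₂, by positivity, fun t ht x hx => ⟨?_, ?_⟩⟩
    · rw [hint t ht x hx]
      exact norm_integral_le_sqrt (hgb t ht) hx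
    · rw [hint t ht x hx]
      have hcontF : ∀ s ∈ V, ContinuousOn
          (fun y : ℝ => hyperlogWord (v.map (a · s)) y / ((y : ℂ) - a i s)) (Set.Ioi 0) :=
        fun s hs => continuousOn_div_sub hc (B.cone hs i)
          (continuousOn_hyperlogWord (H.map_admissible (hVU hs) v))
      have hmain := intervalIntegral.hasDerivAt_integral_of_dominated_loc_of_deriv_le
        (μ := volume) (a := 0) (b := x)
        (F := fun s y => hyperlogWord (v.map (a · s)) y / ((y : ℂ) - a i s)) (F' := g)
        (bound := fun y => K₂ / √y) (hVo.mem_nhds ht) ?_ ?_ ?_ ?_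
        (intervalIntegrable_div_sqrt K₂) ?_
      · refine hmain.2.congr_of_eventuallyEq ?_
        filter_upwards [hVo.mem_nhds ht] with s hs
        exact hyperlogWord_cons ((hnz s hs).exists_ne_zero hc) x
      · filter_upwards [hVo.mem_nhds ht] with s hs
        rw [Set.uIoc_of_le hx.le]
        exact ((hcontF s hs).mono fun y hy => hy.1).aestronglyMeasurable measurableSet_Ioc
      · exact intervalIntegrable_of_norm_le (hcontF t ht) (fun y hy => (hK₁ t ht y hy).2.1) hx
      · rw [Set.uIoc_of_le hx.le]
        exact ((hgc t ht).mono fun y hy => hy.1).aestronglyMeasurable measurableSet_Ioc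
      · refine Eventually.of_forall fun y hy s hs => hgb s hs y ?_
        rw [Set.uIoc_of_le hx.le] at hy
        exact hy.1
      · refine Eventually.of_forall fun y hy s hs => ?_
        rw [Set.uIoc_of_le hx.le] at hy
        have hne := (B.cone hs i).ne hc hy.1
        have h1 := (hK₁ s hs y hy.1).2.2.div
          ((H.hasDerivAt i s (hVU hs)).const_sub (y : ℂ)) hne
        refine HasDerivAt.congr_deriv h1 ?_
        rw [hg]
        field_simp
        ring

theorem hasDerivAt_hyperlogWord_param' (B : UniformBounds a a' V c M) (H : LetterFamily U a a')
    (hVo : IsOpen V) (hVU : V ⊆ U) (hM : 0 ≤ M) (w : List ι) {t : ℝ} (ht : t ∈ V) {x : ℝ}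
    (hx : 0 < x) :
    HasDerivAt (fun t => hyperlogWord (w.map (a · t)) x) (paramDeriv a a' w x t) t := by
  by_cases hw : ∃ i ∈ w, ∀ t ∈ U, a i t ≠ 0
  · obtain ⟨K, -, hK⟩ := B.hasDerivAt_hyperlogWord_param H hVo hVU hM w hw
    exact (hK t ht x hx).2
  · have hz : ∀ j ∈ w, ∀ t ∈ U, a j t = 0 := fun j hj =>
      (H.zero_or j).resolve_right fun h => hw ⟨j, hj, h⟩
    rw [H.paramDeriv_eq_zero (hVU ht) (fun j hj => hz j hj t (hVU ht))]
    refine (hasDerivAt_const t (hyperlogWord (w.map (a · t)) x)).congr_of_eventuallyEq ?_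
    filter_upwards [hVo.mem_nhds ht] with s hs
    congr 1
    exact List.map_congr_left fun j hj => by rw [hz j hj s (hVU hs), hz j hj t (hVU ht)]

theorem hasDerivAt_regValue (B : UniformBounds a a' V c M) (H : LetterFamily U a a')
    (hVo : IsOpen V) (hVU : V ⊆ U) (hM : 0 ≤ M) (w : List ι) {t : ℝ} (ht : t ∈ V) :
    HasDerivAt (fun t => regValue (w.map (a · t)))
      (letterDifferential (logDiff a a' t) (logDiffZero a a' t)
        (fun v => regValue (v.map (a · t))) w) t := by
  have hc := B.pos
  obtain ⟨K, hK0, hK⟩ := exists_regHyperlog_sub_regValue_le hc B.le_one M hM w.length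
  obtain ⟨C, hC0, hC⟩ := exists_norm_le_of_tame hc w.length
  obtain ⟨E, hE0, hE⟩ := exists_norm_dividedPow_le w.length
  have hreg : ∀ (v : List ι) (s z : ℝ), regHyperlog (v.map (a · s)) z =
      suffixSum (fun y => hyperlogWord (y.map (a · s)) z) (dividedPow (-(Real.log z : ℂ))) v := by
    intro v s z
    simp only [regHyperlog, suffixSum, List.length_map, List.map_drop]
  refine hasDerivAt_of_tendstoUniformlyOn (l := atTop) hVo
    (f := fun (z : ℝ) t => regHyperlog (w.map (a · t)) z)
    (f' := fun z t => suffixSum (fun v => paramDeriv a a' v z t)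
      (dividedPow (-(Real.log z : ℂ))) w)
    (g' := fun t => letterDifferential (logDiff a a' t) (logDiffZero a a' t)
        (fun v => regValue (v.map (a · t))) w) ?_ ?_ ?_ ht
  · set N : ℝ := w.length * (2 * M * K) + (w.length + 1) * (E * (C * (M / c))) with hN
    have hbound : ∀ z : ℝ, 1 ≤ z → ∀ s ∈ V,
        dist (letterDifferential (logDiff a a' s) (logDiffZero a a' s)
          (fun v => regValue (v.map (a · s))) w)
          (suffixSum (fun v => paramDeriv a a' v z s) (dividedPow (-(Real.log z : ℂ))) w) ≤
        N * z ^ (-(1 / 4) : ℝ) := by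
      intro z hz s hs
      have hz0 : 0 < z := by linarith
      set first : List ι → ℂ := fun v => match v with
        | [] => 0
        | i :: v => -a' i s / ((z : ℂ) - a i s) * hyperlogWord (v.map (a · s)) z with hfirst
      have h1 : suffixSum (fun v => paramDeriv a a' v z s) (dividedPow (-(Real.log z : ℂ))) w =
          suffixSum first (dividedPow (-(Real.log z : ℂ))) w +
          letterDifferential (logDiff a a' s) (logDiffZero a a' s)
            (fun v => regHyperlog (v.map (a · s)) z) w := by
        simp only [hreg]
        rw [letterDifferential_suffixSum]
        simp only [suffixSum, ← Finset.sum_add_distrib, ← mul_add]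
        rfl
      rw [dist_eq_norm, h1, add_comm, ← sub_sub, ← letterDifferential_sub]
      have h2 : ‖letterDifferential (logDiff a a' s) (logDiffZero a a' s)
          (fun v => regValue (v.map (a · s)) - regHyperlog (v.map (a · s)) z) w‖ ≤
          w.length * (2 * M * (K * z ^ (-(1 / 4) : ℝ))) := by
        refine norm_letterDifferential_le hM (by positivity) (B.norm_logDiff_le s hs)
          (B.norm_logDiffZero_le s hs) fun v hv => ?_
        refine hK _ (by rw [List.length_map]; omega) (B.tame hs v) ?_ z hz
        intro b hb
        obtain ⟨i, _, rfl⟩ := List.mem_map.1 hb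
        exact B.norm_le s hs i
      have h3 : ‖suffixSum first (dividedPow (-(Real.log z : ℂ))) w‖ ≤
          (w.length + 1) * ((E * (C * (M / c))) * z ^ (-(1 / 4) : ℝ)) := by
        have hz4 : √(√z) * (z⁻¹ * √z) = z ^ (-(1 / 4) : ℝ) := by
          rw [Real.sqrt_eq_rpow, Real.sqrt_eq_rpow, ← Real.rpow_mul hz0.le, ← Real.rpow_neg_one,
            ← Real.rpow_add hz0, ← Real.rpow_add hz0]
          norm_num
        have h4 : ∀ j ∈ Finset.range (w.length + 1),
            ‖dividedPow (-(Real.log z : ℂ)) j * first (w.drop j)‖ ≤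
            (E * (C * (M / c))) * z ^ (-(1 / 4) : ℝ) := by
          intro j hj
          have hj : j ≤ w.length := by simpa [Nat.lt_succ_iff] using hj
          have h5 : ‖first (w.drop j)‖ ≤ (M / c * z⁻¹) * (C * √z) := by
            rcases hd : w.drop j with _ | ⟨i, v⟩
            · simp only [hfirst, norm_zero]
              positivity
            · simp only [hfirst]
              rw [norm_mul]
              refine mul_le_mul ?_ ?_ (norm_nonneg _) (by positivity)
              · rw [norm_div, norm_neg, ← div_eq_mul_inv, div_div]
                exact div_le_div₀ hM (B.norm_deriv_le s hs i) (by positivity)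
                  (B.cone hs i z hz0)
              · refine hC _ ?_ (B.tame hs v) z hz
                have := congrArg List.length hd
                rw [List.length_drop, List.length_cons] at this
                rw [List.length_map]
                omega
          rw [norm_mul]
          calc _ ≤ (E * √(√z)) * ((M / c * z⁻¹) * (C * √z)) :=
                mul_le_mul (hE j hj z hz) h5 (norm_nonneg _) (by positivity)
            _ = (E * (C * (M / c))) * (√(√z) * (z⁻¹ * √z)) := by ring
            _ = _ := by rw [hz4]
        refine (norm_sum_le_of_le _ h4).trans (le_of_eq ?_)
        rw [Finset.sum_const, Finset.card_range, nsmul_eq_mul]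
        push_cast
        ring
      refine (norm_sub_le _ _).trans ((add_le_add h2 h3).trans (le_of_eq ?_))
      rw [hN]
      ring
    rw [Metric.tendstoUniformlyOn_iff]
    intro ε hε
    have h0 : Tendsto (fun z : ℝ => N * z ^ (-(1 / 4) : ℝ)) atTop (𝓝 0) := by
      simpa using tendsto_rpow_neg_quarter.const_mul N
    filter_upwards [eventually_ge_atTop (1 : ℝ), h0.eventually_lt_const hε] with z hz hzε s hs
    exact (hbound z hz s hs).trans_lt hzε
  · filter_upwards [eventually_gt_atTop (0 : ℝ)] with z hz s hs
    simp only [hreg]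
    exact HasDerivAt.fun_sum fun j _ =>
      (B.hasDerivAt_hyperlogWord_param' H hVo hVU hM (w.drop j) hs hz).const_mul _
  · intro s hs
    exact tendsto_regHyperlog (H.map_admissible (hVU hs) w)

end UniformBounds

/-- The total differential of the regularized value of a word. -/
theorem LetterFamily.hasDerivAt_regValue [Finite ι] (H : LetterFamily U a a') (w : List ι) {t : ℝ}
    (ht : t ∈ U) :
    HasDerivAt (fun t => regValue (w.map (a · t)))
      (letterDifferential (logDiff a a' t) (logDiffZero a a' t)
        (fun v => regValue (v.map (a · t))) w) t := by
  obtain ⟨V, c, M, hVo, htV, hVU, hM, B⟩ := H.exists_uniformBounds ht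
  exact B.hasDerivAt_regValue H hVo hVU hM w htV

/-- Regularized values of words have logarithmic expansions in the parameter, if the logarithmic
derivatives of all letters and their differences do. -/
theorem LetterFamily.exists_hasRegLimAtZero_regValue [Finite ι] {δ : ℝ} (hδ : 0 < δ)
    (H : LetterFamily (Set.Ioo 0 δ) a a')
    (hq : ∀ i j, ∃ d, HasRegLimAtZero (fun t => t * logDiff a a' t i j) d)
    (hq₀ : ∀ i, ∃ d, HasRegLimAtZero (fun t => t * logDiffZero a a' t i) d) (w : List ι) :
    ∃ d, HasRegLimAtZero (fun t => regValue (w.map (a · t))) d := by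
  choose d hd using hq
  choose d₀ hd₀ using hq₀
  have key : ∀ n, ∀ w : List ι, w.length = n →
      ∃ d, HasRegLimAtZero (fun t => regValue (w.map (a · t))) d := by
    intro n
    induction n with
    | zero =>
      intro w hw
      rw [List.length_eq_zero_iff] at hw
      subst hw
      exact ⟨_, HasRegLimAtZero.const (regValue [])⟩
    | succ n ih =>
      intro w hw
      choose e he using ih
      classical
      have h1 := HasRegLimAtZero.letterDifferential hd hd₀ (w := w)
        (Λ := fun t v => regValue (v.map (a · t)))
        (Λ' := fun v => if hv : v.length = n then e v hv else 0) (fun v hv => by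
          have hv' : v.length = n := by omega
          simp only [hv', dif_pos]
          exact he v hv')
      refine exists_hasRegLimAtZero_of_hasDerivAt (F' := fun t =>
        letterDifferential (logDiff a a' t) (logDiffZero a a' t)
          (fun v => regValue (v.map (a · t))) w) ?_ (h1.congr ?_)
      · filter_upwards [Ioo_mem_nhdsGT hδ] with t ht using H.hasDerivAt_regValue w ht
      · exact Eventually.of_forall fun t => letterDifferential_smul _ _ _
  exact key _ w rfl

end Family

end

end Hyperlogarithm

namespace Hyperlogarithm

noncomputable section

open Filter Topology MeasureTheory

/-! ### Meromorphic letters -/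

lemma tendsto_ofReal_nhdsGT_nhdsNE :
    Tendsto (fun t : ℝ => (t : ℂ)) (𝓝[>] 0) (𝓝[≠] 0) :=
  tendsto_nhdsWithin_iff.2 ⟨tendsto_ofReal_nhdsGT_zero, by
    filter_upwards [self_mem_nhdsWithin] with t ht
    exact Complex.ofReal_ne_zero.2 (ne_of_gt ht)⟩

lemma exists_hasRegLimAtZero_mul_logDeriv {f : ℂ → ℂ} (hf : MeromorphicAt f 0) :
    ∃ d, HasRegLimAtZero (fun t : ℝ => t * (deriv f t / f t)) d := by
  rcases eq_or_ne (meromorphicOrderAt f 0) ⊤ with htop | htop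
  · refine ⟨0, (HasRegLimAtZero.of_analytic (g := fun _ => 0) analyticAt_const).congr ?_⟩
    filter_upwards [tendsto_ofReal_nhdsGT_nhdsNE.eventually (meromorphicOrderAt_eq_top_iff.1 htop)]
      with t ht
    simp [ht]
  · lift meromorphicOrderAt f 0 to ℤ using htop with N hN
    obtain ⟨g, hg, hg0, hfg⟩ := (meromorphicOrderAt_eq_int_iff hf).1 hN.symm
    have han : AnalyticAt ℂ (fun z => N + z * (deriv g z / g z)) 0 :=
      analyticAt_const.add (analyticAt_id.mul (hg.deriv.div hg hg0))
    refine ⟨_, (HasRegLimAtZero.of_analytic han).congr ?_⟩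
    have hd := EventuallyEq.nhdsNE_deriv hfg
    filter_upwards [tendsto_ofReal_nhdsGT_nhdsNE.eventually hd,
      tendsto_ofReal_nhdsGT_nhdsNE.eventually hfg,
      tendsto_ofReal_nhdsGT_zero.eventually hg.eventually_analyticAt,
      tendsto_ofReal_nhdsGT_zero.eventually (hg.continuousAt.eventually_ne hg0),
      self_mem_nhdsWithin] with t ht ht' hga hgt h0
    have h0' : (t : ℂ) ≠ 0 := Complex.ofReal_ne_zero.2 (ne_of_gt h0)
    have hder : HasDerivAt (fun z : ℂ => (z - 0) ^ N • g z)
        ((N * (t : ℂ) ^ (N - 1)) * g t + (t : ℂ) ^ N * deriv g t) t := by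
      simp only [sub_zero, smul_eq_mul]
      exact (hasDerivAt_zpow N _ (Or.inl h0')).mul hga.differentiableAt.hasDerivAt
    rw [ht, ht', hder.deriv, sub_zero, smul_eq_mul, zpow_sub_one₀ h0']
    have := zpow_ne_zero N h0'
    field_simp

lemma eventually_forall_Ioo {p : ℝ → Prop} (h : ∀ᶠ t in 𝓝[>] 0, p t) :
    ∀ᶠ δ : ℝ in 𝓝[>] 0, ∀ t ∈ Set.Ioo 0 δ, p t := by
  obtain ⟨u, hu, hsub⟩ := mem_nhdsGT_iff_exists_Ioo_subset.1 h
  filter_upwards [Ioo_mem_nhdsGT hu] with δ hδ t ht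
  exact hsub ⟨ht.1, ht.2.trans hδ.2⟩

theorem exists_hasRegLimAtZero_regValue_of_meromorphicAt {κ : Type*} {g : κ → ℂ → ℂ} {w : List κ}
    (hg : ∀ k ∈ w, MeromorphicAt (g k) 0)
    (hadm : ∀ k ∈ w, ∀ᶠ t : ℝ in 𝓝[>] 0, Admissible (g k t)) :
    ∃ d, HasRegLimAtZero (fun t => regValue (w.map (g · t))) d := by
  let ι := {k // k ∈ w}
  have : Finite ι := List.finite_toSet w
  have hor : ∀ f : ℂ → ℂ, MeromorphicAt f 0 → ∀ᶠ δ : ℝ in 𝓝[>] 0,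
      (∀ t ∈ Set.Ioo 0 δ, f t = 0) ∨ ∀ t ∈ Set.Ioo 0 δ, f t ≠ 0 := by
    intro f hf
    rcases hf.eventually_eq_zero_or_eventually_ne_zero with h | h
    · exact (eventually_forall_Ioo
        (tendsto_ofReal_nhdsGT_nhdsNE.eventually h)).mono fun δ h => Or.inl h
    · exact (eventually_forall_Ioo
        (tendsto_ofReal_nhdsGT_nhdsNE.eventually h)).mono fun δ h => Or.inr h
  have hδ : ∀ᶠ δ : ℝ in 𝓝[>] 0, 0 < δ ∧
      (∀ i : ι, ∀ t ∈ Set.Ioo 0 δ, AnalyticAt ℂ (g i) (t : ℂ)) ∧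
      (∀ i : ι, ∀ t ∈ Set.Ioo 0 δ, Admissible (g i t)) ∧
      (∀ i : ι, (∀ t ∈ Set.Ioo 0 δ, g i t = 0) ∨ ∀ t ∈ Set.Ioo 0 δ, g i t ≠ 0) ∧
      ∀ i j : ι, (∀ t ∈ Set.Ioo 0 δ, (g i - g j) t = 0) ∨
        ∀ t ∈ Set.Ioo 0 δ, (g i - g j) t ≠ 0 := by
    refine Eventually.and self_mem_nhdsWithin (Eventually.and ?_ (Eventually.and ?_
      (Eventually.and ?_ ?_)))
    · exact eventually_all.2 fun i => eventually_forall_Ioo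
        (tendsto_ofReal_nhdsGT_nhdsNE.eventually (hg i i.2).eventually_analyticAt)
    · exact eventually_all.2 fun i => eventually_forall_Ioo (hadm i i.2)
    · exact eventually_all.2 fun i => hor _ (hg i i.2)
    · exact eventually_all.2 fun i => eventually_all.2 fun j =>
        hor _ ((hg i i.2).sub (hg j j.2))
  obtain ⟨δ, hδ0, han, had, hz, he⟩ := hδ.exists
  have H : LetterFamily (Set.Ioo 0 δ) (fun (i : ι) (t : ℝ) => g i t)
      (fun (i : ι) (t : ℝ) => deriv (g i) t) :=
    { isOpen := isOpen_Ioo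
      hasDerivAt := fun i t ht => (han i t ht).differentiableAt.hasDerivAt.comp_ofReal
      continuousOn_deriv := fun i t ht =>
        ((han i t ht).deriv.continuousAt.comp (f := fun t : ℝ => (t : ℂ))
          Complex.continuous_ofReal.continuousAt).continuousWithinAt
      admissible := had
      zero_or := hz
      eq_or := fun i j => (he i j).imp (fun h t ht => sub_eq_zero.1 (h t ht))
        (fun h t ht => sub_ne_zero.1 (h t ht)) }
  obtain ⟨d, hd⟩ := H.exists_hasRegLimAtZero_regValue hδ0
    (fun i j => by
      obtain ⟨d, hd⟩ := exists_hasRegLimAtZero_mul_logDeriv ((hg i i.2).sub (hg j j.2))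
      refine ⟨d, hd.congr ?_⟩
      filter_upwards [Ioo_mem_nhdsGT hδ0] with t ht
      rw [deriv_sub (han i t ht).differentiableAt (han j t ht).differentiableAt]
      rfl)
    (fun i => exists_hasRegLimAtZero_mul_logDeriv (hg i i.2)) w.attach
  refine ⟨d, hd.congr (Eventually.of_forall fun t => ?_)⟩
  congr 1
  conv_rhs => rw [← List.attach_map_subtype_val w, List.map_map]
  rfl

/-! ### Rational functions at the origin -/

lemma eval_polynomial_eq_pow_mul {p : Polynomial ℂ} (hp : p ≠ 0) :
    ∃ (n : ℕ) (q : Polynomial ℂ), q.eval 0 ≠ 0 ∧ p = Polynomial.X ^ n * q := by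
  obtain ⟨q, hq, hd⟩ := p.exists_eq_pow_rootMultiplicity_mul_and_not_dvd hp 0
  refine ⟨_, q, fun h => hd (Polynomial.dvd_iff_isRoot.2 h), by simpa using hq⟩

lemma algebraMap_polynomial_laurent (q : Polynomial ℂ) (hq : q.eval 0 ≠ 0) :
    (laurent (algebraMap _ _ q)).orderTop = (0 : ℤ) ∧
      (laurent (algebraMap _ _ q)).leadingCoeff = q.eval 0 := by
  have h : laurent (algebraMap _ _ q) = HahnSeries.ofPowerSeries ℤ ℂ q :=
    (RatFunc.coe_coe q).symm
  have h0 : (laurent (algebraMap _ _ q)).coeff 0 = q.eval 0 := by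
    rw [h]
    have := HahnSeries.ofPowerSeries_apply_coeff (Γ := ℤ) (q : PowerSeries ℂ) 0
    simpa [Polynomial.coeff_zero_eq_eval_zero] using this
  have hord : (laurent (algebraMap _ _ q)).orderTop = (0 : ℤ) := by
    refine le_antisymm (HahnSeries.orderTop_le_of_coeff_ne_zero (by rwa [h0])) ?_
    rw [h, HahnSeries.ofPowerSeries_apply, HahnSeries.orderTop_embDomain]
    cases (HahnSeries.toPowerSeries.symm (q : PowerSeries ℂ)).orderTop with
    | top => exact le_top
    | coe n => exact WithTop.coe_le_coe.2 (Int.natCast_nonneg n)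
  refine ⟨hord, ?_⟩
  rw [HahnSeries.leadingCoeff, hord]
  exact h0

lemma laurent_mul (σ τ : RatFunc ℂ) : laurent (σ * τ) = laurent σ * laurent τ :=
  map_mul _ σ τ

lemma laurent_X_pow (n : ℕ) : laurent (algebraMap (Polynomial ℂ) _ (Polynomial.X ^ n)) =
    HahnSeries.single (n : ℤ) 1 := by
  rw [laurent, map_pow, map_pow, RatFunc.algebraMap_X, RatFunc.coe_X, HahnSeries.single_pow]
  simp

lemma vanishingDeg_zero : vanishingDeg 0 = ⊤ := by
  simp [vanishingDeg, laurent]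

lemma vanishingDeg_eq_top_iff {σ : RatFunc ℂ} : vanishingDeg σ = ⊤ ↔ σ = 0 := by
  rw [vanishingDeg, HahnSeries.orderTop_eq_top, laurent, map_eq_zero]

lemma vanishingDeg_leadingCoeff_X_pow_mul (n : ℕ) {q : Polynomial ℂ} (hq : q.eval 0 ≠ 0) :
    vanishingDeg (algebraMap _ _ (Polynomial.X ^ n * q)) = (n : ℤ) ∧
      leadingCoeff (algebraMap _ _ (Polynomial.X ^ n * q)) = q.eval 0 := by
  obtain ⟨h₁, h₂⟩ := algebraMap_polynomial_laurent q hq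
  rw [vanishingDeg, leadingCoeff, map_mul, laurent_mul, HahnSeries.orderTop_mul,
    HahnSeries.leadingCoeff_mul, h₁, h₂, laurent_X_pow, HahnSeries.orderTop_single one_ne_zero,
    HahnSeries.leadingCoeff_of_single]
  exact ⟨by rw [← WithTop.coe_add, add_zero], one_mul _⟩

/-- A nonzero rational function of vanishing degree `N` is `z ^ N * h z` near the origin with `h`
holomorphic and `h 0` its leading coefficient. -/
lemma exists_eval_eq_zpow_mul {σ : RatFunc ℂ} (hσ : σ ≠ 0) :
    ∃ (N : ℤ) (h : ℂ → ℂ), vanishingDeg σ = N ∧ AnalyticAt ℂ h 0 ∧ h 0 ≠ 0 ∧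
      h 0 = leadingCoeff σ ∧
      ∀ᶠ z in 𝓝[≠] 0, RatFunc.eval (RingHom.id ℂ) z σ = z ^ N * h z := by
  obtain ⟨m, p, hp, hnum⟩ := eval_polynomial_eq_pow_mul (RatFunc.num_ne_zero hσ)
  obtain ⟨n, q, hq, hden⟩ := eval_polynomial_eq_pow_mul (RatFunc.denom_ne_zero σ)
  obtain ⟨hp₁, hp₂⟩ := vanishingDeg_leadingCoeff_X_pow_mul m hp
  obtain ⟨hq₁, hq₂⟩ := vanishingDeg_leadingCoeff_X_pow_mul n hq
  have hmul : σ * algebraMap _ _ (Polynomial.X ^ n * q) =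
      algebraMap _ _ (Polynomial.X ^ m * p) := by
    rw [← hnum, ← hden]
    conv_lhs => rw [← RatFunc.num_div_denom σ]
    rw [RatFunc.num_div_denom]
    exact (eq_div_iff (RatFunc.algebraMap_ne_zero σ.denom_ne_zero)).1 σ.num_div_denom.symm
  have hdeg : vanishingDeg σ + (n : ℤ) = (m : ℤ) := by
    rw [← hp₁, ← hmul, ← hq₁]
    simp only [vanishingDeg, laurent_mul, HahnSeries.orderTop_mul]
  have hlc : leadingCoeff σ * q.eval 0 = p.eval 0 := by
    rw [← hp₂, ← hmul, ← hq₂]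
    simp only [leadingCoeff, laurent_mul, HahnSeries.leadingCoeff_mul]
  have han : ∀ r : Polynomial ℂ, AnalyticAt ℂ (fun z => r.eval z) 0 := fun r =>
    r.differentiable.analyticAt 0
  refine ⟨m - n, fun z => p.eval z / q.eval z, ?_, (han p).div (han q) hq, div_ne_zero hp hq,
    (div_eq_iff hq).2 hlc.symm, ?_⟩
  · have hne : vanishingDeg σ ≠ ⊤ := vanishingDeg_eq_top_iff.not.2 hσ
    lift vanishingDeg σ to ℤ using hne with N
    rw [← WithTop.coe_add, WithTop.coe_inj] at hdeg
    rw [WithTop.coe_inj]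
    omega
  · filter_upwards [self_mem_nhdsWithin] with z hz
    have hz' : z ≠ 0 := hz
    rw [RatFunc.eval, hnum, hden]
    simp only [Polynomial.eval₂_id, Polynomial.eval_mul, Polynomial.eval_pow, Polynomial.eval_X]
    rw [zpow_sub₀ hz', zpow_natCast, zpow_natCast, mul_div_mul_comm]

lemma meromorphicAt_eval (σ : RatFunc ℂ) :
    MeromorphicAt (fun z => RatFunc.eval (RingHom.id ℂ) z σ) 0 := by
  have han : ∀ r : Polynomial ℂ, MeromorphicAt (fun z => r.eval z) 0 := fun r =>
    (r.differentiable.analyticAt 0).meromorphicAt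
  simp only [RatFunc.eval, Polynomial.eval₂_id]
  exact (han σ.num).div (han σ.denom)

lemma rescaledLimit_of_eq {σ : RatFunc ℂ} {d : ℤ} (h : vanishingDeg σ = d) :
    rescaledLimit d σ = leadingCoeff σ := by
  rw [leadingCoeff, HahnSeries.leadingCoeff, ← vanishingDeg, h]
  rfl

lemma rescaledLimit_of_lt {σ : RatFunc ℂ} {d : ℤ} (h : d < vanishingDeg σ) :
    rescaledLimit d σ = 0 :=
  HahnSeries.coeff_eq_zero_of_lt_orderTop h

lemma wordDeg_le {w : List (RatFunc ℂ)} {σ : RatFunc ℂ} (h : σ ∈ w) :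
    wordDeg w ≤ vanishingDeg σ := by
  induction w with
  | nil => simp at h
  | cons τ w ih =>
    rcases List.mem_cons.1 h with rfl | h
    · exact min_le_left _ _
    · exact (min_le_right _ _).trans (ih h)

lemma le_wordDeg {w : List (RatFunc ℂ)} {d : WithTop ℤ} (h : ∀ σ ∈ w, d ≤ vanishingDeg σ) :
    d ≤ wordDeg w := by
  induction w with
  | nil => exact le_top
  | cons τ w ih =>
    exact le_min (h τ List.mem_cons_self) (ih fun σ hσ => h σ (List.mem_cons_of_mem _ hσ))

/-! ### Letters rescaled by a power of `t` -/

/-- The value at `t` of the rescaled letter `t ^ (-d) * σ`. -/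
def rescaledEval (d : ℤ) (t : ℂ) (σ : RatFunc ℂ) : ℂ :=
  t ^ (-d) * RatFunc.eval (RingHom.id ℂ) t σ

lemma meromorphicAt_rescaledEval (d : ℤ) (σ : RatFunc ℂ) :
    MeromorphicAt (fun z => rescaledEval d z σ) 0 :=
  ((MeromorphicAt.id 0).zpow _).mul (meromorphicAt_eval σ)

lemma tendsto_rescaledEval {σ : RatFunc ℂ} {d : ℤ} (h : d ≤ vanishingDeg σ) :
    Tendsto (fun t : ℝ => rescaledEval d t σ) (𝓝[>] 0) (𝓝 (rescaledLimit d σ)) := by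
  rcases eq_or_ne σ 0 with rfl | hσ
  · have : rescaledLimit d 0 = 0 := by simp [rescaledLimit, laurent]
    simp [rescaledEval, this]
  obtain ⟨N, g, hN, hg, hg0, hlc, he⟩ := exists_eval_eq_zpow_mul hσ
  have key : ∀ᶠ t : ℝ in 𝓝[>] 0, (t : ℂ) ^ (N - d).toNat * g t = rescaledEval d t σ := by
    filter_upwards [tendsto_ofReal_nhdsGT_nhdsNE.eventually he, self_mem_nhdsWithin] with t ht h0
    have h0' : (t : ℂ) ≠ 0 := Complex.ofReal_ne_zero.2 (ne_of_gt h0)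
    have hd : d ≤ N := by rw [hN] at h; exact_mod_cast h
    rw [rescaledEval, ht, ← zpow_natCast, Int.toNat_of_nonneg (by omega), ← mul_assoc,
      ← zpow_add₀ h0']
    congr 2
    ring
  refine Tendsto.congr' key ?_
  have hlim : Tendsto (fun t : ℝ => (t : ℂ) ^ (N - d).toNat * g t) (𝓝[>] 0)
      (𝓝 (0 ^ (N - d).toNat * g 0)) :=
    (tendsto_ofReal_nhdsGT_zero.pow _).mul (hg.continuousAt.tendsto.comp tendsto_ofReal_nhdsGT_zero)
  have hd : d ≤ N := by rw [hN] at h; exact_mod_cast h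
  rcases hd.eq_or_lt with rfl | hlt
  · rw [rescaledLimit_of_eq hN, ← hlc]
    simpa using hlim
  · rw [rescaledLimit_of_lt (by rw [hN]; exact_mod_cast hlt)]
    rwa [zero_pow (by omega), zero_mul] at hlim

end

end Hyperlogarithm

namespace Hyperlogarithm

noncomputable section

open Filter Topology MeasureTheory

/-! ### Regularized values as a character of the shuffle algebra -/

section RegL

variable {α : Type*}

/-- The linear extension of `regValue`, with letters read through `ev`. -/
def regL (ev : α → ℂ) : WordSpace α →ₗ[ℚ] ℂ :=
  Finsupp.linearCombination ℚ fun w => regValue (w.map ev)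

theorem regL_ofWord (ev : α → ℂ) (w : List α) : regL ev (ofWord w) = regValue (w.map ev) := by
  simp [regL, ofWord]

theorem regL_mapDomain {β : Type*} (f : α → β) (ev : β → ℂ) (x : WordSpace α) :
    regL ev (Finsupp.mapDomain (List.map f) x) = regL (ev ∘ f) x := by
  rw [regL, Finsupp.linearCombination_mapDomain, regL]
  congr 2
  funext w
  simp

theorem regValue_zero : regValue [0] = 0 := by
  refine HasRegLimAtTop.regLimAtTop_eq
    ⟨1, fun i _ => if i = 0 then 0 else 1, fun i => analyticAt_const, Eventually.of_forall ?_, rfl⟩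
  intro z
  rw [show ([0] : List ℂ) = List.replicate 1 0 from rfl, hyperlogWord_replicate]
  simp [Finset.sum_range_succ]

variable {ev : α → ℂ}

theorem hasRegLimAtTop_hyperlogL {x : WordSpace α} (hx : x ∈ admissibleSpan ev) :
    HasRegLimAtTop (fun z => hyperlogL ev z x) (regL ev x) := by
  induction hx using Submodule.span_induction with
  | mem x hx =>
    obtain ⟨w, hw, rfl⟩ := hx
    simp only [hyperlogL_ofWord, regL_ofWord]
    exact hasRegLimAtTop_regValue (by simpa using hw)
  | zero =>
    simp only [map_zero]
    exact hasRegLimAtTop_iff.2 (HasRegLimAtZero.const 0)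
  | add x y _ _ hx hy =>
    simp only [map_add]
    exact hasRegLimAtTop_iff.2 ((hasRegLimAtTop_iff.1 hx).add (hasRegLimAtTop_iff.1 hy))
  | smul q x _ hx =>
    simp only [map_smul, Rat.smul_def]
    exact hasRegLimAtTop_iff.2 ((hasRegLimAtTop_iff.1 hx).const_mul _)

theorem hasRegLimAtTop_hyperlog {x : WordSpace α} (hx : x ∈ admissibleSpan ev) :
    HasRegLimAtTop (hyperlog ev x) (regL ev x) := by
  simpa only [← hyperlog_eq] using hasRegLimAtTop_hyperlogL hx

theorem regL_shuffleL {x y : WordSpace α} (hx : x ∈ admissibleSpan ev)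
    (hy : y ∈ admissibleSpan ev) : regL ev (shuffleL x y) = regL ev x * regL ev y := by
  induction hx, hy using Submodule.span_induction₂ with
  | mem_mem x y hx hy =>
    obtain ⟨u, hu, rfl⟩ := hx
    obtain ⟨v, hv, rfl⟩ := hy
    rw [shuffleL_ofWord, regL_ofWord, regL_ofWord]
    refine (hasRegLimAtTop_iff.1 (hasRegLimAtTop_hyperlogL
      (shuffleWord_mem_admissibleSpan hu hv))).unique
      (((hasRegLimAtTop_iff.1 (hasRegLimAtTop_regValue (w := u.map ev) (by simpa using hu))).mul
        (hasRegLimAtTop_iff.1 (hasRegLimAtTop_regValue (w := v.map ev)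
          (by simpa using hv)))).congr ?_)
    filter_upwards [self_mem_nhdsWithin] with s hs
    exact (hyperlogL_shuffleWord hu hv (one_div_pos.2 hs)).symm
  | zero_left => simp
  | zero_right => simp
  | add_left x y z _ _ _ h₁ h₂ => simp [h₁, h₂, add_mul]
  | add_right x y z _ _ _ h₁ h₂ => simp [h₁, h₂, mul_add]
  | smul_left q x y _ _ h => simp [h]
  | smul_right q x y _ _ h => simp [h]

theorem eventually_mem_admissibleSpan {l : Filter ℝ} {e : ℝ → α → ℂ}
    (he : ∀ a, ∀ᶠ t in l, Admissible (e t a)) (x : WordSpace α) :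
    ∀ᶠ t in l, x ∈ admissibleSpan (e t) := by
  induction x using Finsupp.induction_linear with
  | zero => exact Eventually.of_forall fun _ => Submodule.zero_mem _
  | add x y hx hy => exact (hx.and hy).mono fun _ h => Submodule.add_mem _ h.1 h.2
  | single w q =>
    have h : ∀ᶠ t in l, ∀ a ∈ w, Admissible (e t a) :=
      (List.finite_toSet w).eventually_all.2 fun a _ => he a
    filter_upwards [h] with t ht
    rw [show Finsupp.single w q = q • ofWord w by simp [ofWord]]
    exact Submodule.smul_mem _ _ (Submodule.subset_span ⟨w, ht, rfl⟩)

end RegL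

/-! ### Words whose last letter has minimal degree -/

/-- The leading coefficient of `σ` is not a nonnegative real, unless `σ` vanishes. -/
def LeadingAdmissible (σ : RatFunc ℂ) : Prop :=
  σ ≠ 0 → ∀ x : ℝ, 0 ≤ x → leadingCoeff σ ≠ x

lemma LeadingAdmissible.exists_cone {σ : RatFunc ℂ} (h : LeadingAdmissible σ) :
    ∃ c, 0 < c ∧ c ≤ 1 ∧ ∀ d : ℤ, (∀ᶠ t : ℝ in 𝓝[>] 0, Cone c (rescaledEval d t σ)) ∧
      (d ≤ vanishingDeg σ → Cone c (rescaledLimit d σ)) := by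
  rcases eq_or_ne σ 0 with rfl | hσ
  · refine ⟨1, one_pos, le_rfl, fun d => ⟨Eventually.of_forall fun t => ?_, fun _ => ?_⟩⟩
    · simpa [rescaledEval] using cone_zero le_rfl
    · simpa [rescaledLimit, laurent] using cone_zero le_rfl
  obtain ⟨c, hc, hc1, hgood⟩ := exists_good (h hσ)
  obtain ⟨N, g, hN, hg, hg0, hlc, he⟩ := exists_eval_eq_zpow_mul hσ
  refine ⟨c / 2, by positivity, by linarith, fun d => ⟨?_, fun hd => ?_⟩⟩
  · have hlim : Tendsto (fun t : ℝ => g t) (𝓝[>] 0) (𝓝 (g 0)) :=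
      hg.continuousAt.tendsto.comp tendsto_ofReal_nhdsGT_zero
    filter_upwards [tendsto_ofReal_nhdsGT_nhdsNE.eventually he, self_mem_nhdsWithin,
      (Metric.tendsto_nhds.1 hlim) (c / 2) (by positivity)] with t ht h0 hdist
    have h0' : (t : ℂ) ≠ 0 := Complex.ofReal_ne_zero.2 (ne_of_gt h0)
    have hcone : Cone (c / 2) (g t) :=
      (Good.of_dist_le (a := leadingCoeff σ) (by positivity) (by convert hgood using 1; ring)
        (by rw [← hlc, ← dist_eq_norm]; exact hdist.le)).cone (by positivity)
    have := hcone.mul_left (s := t ^ (-d + N)) (zpow_pos h0 _)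
    rwa [Complex.ofReal_zpow, zpow_add₀ h0', mul_assoc, ← ht] at this
  · rcases hd.eq_or_lt with heq | hlt
    · rw [rescaledLimit_of_eq heq.symm]
      exact (hgood.cone hc).mono (by linarith)
    · rw [rescaledLimit_of_lt hlt]
      exact cone_zero (by linarith)

lemma exists_common_cone {u : List (RatFunc ℂ)} (h : ∀ σ ∈ u, LeadingAdmissible σ) :
    ∃ c, 0 < c ∧ c ≤ 1 ∧ ∀ σ ∈ u, ∀ d : ℤ,
      (∀ᶠ t : ℝ in 𝓝[>] 0, Cone c (rescaledEval d t σ)) ∧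
      (d ≤ vanishingDeg σ → Cone c (rescaledLimit d σ)) := by
  induction u with
  | nil => exact ⟨1, one_pos, le_rfl, by simp⟩
  | cons σ u ih =>
    obtain ⟨c, hc, hc1, H⟩ := (h σ List.mem_cons_self).exists_cone
    obtain ⟨c', hc', -, H'⟩ := ih fun τ hτ => h τ (List.mem_cons_of_mem _ hτ)
    refine ⟨min c c', lt_min hc hc', (min_le_left _ _).trans hc1, fun τ hτ d => ?_⟩
    rcases List.mem_cons.1 hτ with rfl | hτ
    · exact ⟨(H d).1.mono fun t ht => ht.mono (min_le_left _ _),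
        fun hd => ((H d).2 hd).mono (min_le_left _ _)⟩
    · exact ⟨(H' τ hτ d).1.mono fun t ht => ht.mono (min_le_right _ _),
        fun hd => ((H' τ hτ d).2 hd).mono (min_le_right _ _)⟩

lemma LeadingAdmissible.eventually_admissible {σ : RatFunc ℂ} (h : LeadingAdmissible σ) (d : ℤ) :
    ∀ᶠ t : ℝ in 𝓝[>] 0, Admissible (rescaledEval d t σ) := by
  obtain ⟨c, hc, -, H⟩ := h.exists_cone
  exact (H d).1.mono fun t ht => ht.admissible hc

lemma tendsto_regValue_rescaledEval {u : List (RatFunc ℂ)} {σ : RatFunc ℂ} {d : ℤ}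
    (hadm : ∀ τ ∈ u ++ [σ], LeadingAdmissible τ) (hσ : vanishingDeg σ = d)
    (hu : ∀ τ ∈ u, d ≤ vanishingDeg τ) :
    Tendsto (fun t : ℝ => regValue ((u ++ [σ]).map (rescaledEval d t))) (𝓝[>] 0)
      (𝓝 (regValue ((u ++ [σ]).map (rescaledLimit d)))) := by
  have hσ0 : σ ≠ 0 := fun h => by simp [h, vanishingDeg_zero] at hσ
  obtain ⟨c, hc, hc1, H⟩ := exists_common_cone fun τ hτ => hadm τ (List.mem_append_left _ hτ)
  obtain ⟨c', hc', hc1', hgood⟩ := exists_good (hadm σ (by simp) hσ0)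
  have hσlim := tendsto_rescaledEval hσ.ge
  have hm : 0 < min c (c' / 2) := lt_min hc (by positivity)
  refine tendsto_regValue (c := min c (c' / 2)) (ev := fun (t : ℝ) => rescaledEval d t) hm
    ((min_le_left _ _).trans hc1) ?_ ?_ ?_ ?_ ?_
  · intro τ hτ
    refine tendsto_rescaledEval ?_
    rcases List.mem_append.1 hτ with h | h
    · exact hu τ h
    · rw [List.mem_singleton.1 h, hσ]
  · refine (List.finite_toSet u).eventually_all.2 fun τ hτ => ?_
    exact (H τ hτ d).1.mono fun t ht => ht.mono (min_le_left _ _)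
  · filter_upwards [(Metric.tendsto_nhds.1 hσlim) (c' / 2) (by positivity)] with t ht
    rw [rescaledLimit_of_eq hσ, dist_eq_norm] at ht
    exact (Good.of_dist_le (by positivity) (by convert hgood using 1; ring) ht.le).mono
      (min_le_right _ _)
  · exact fun τ hτ => ((H τ hτ d).2 (hu τ hτ)).mono (min_le_left _ _)
  · rw [rescaledLimit_of_eq hσ]
    exact hgood.mono ((min_le_right _ _).trans (by linarith))

/-- The regularized value of a word whose last letter has minimal degree `d` has at `t → 0` the
regularized value of the limit of the rescaled word as regularized limit. -/
theorem hasRegLimAtZero_regValue_minimal {u : List (RatFunc ℂ)} {σ : RatFunc ℂ} {d : ℤ}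
    (hadm : ∀ τ ∈ u ++ [σ], LeadingAdmissible τ) (hσ : vanishingDeg σ = d)
    (hu : ∀ τ ∈ u, d ≤ vanishingDeg τ) :
    HasRegLimAtZero (fun t : ℝ => regValue ((u ++ [σ]).map (RatFunc.eval (RingHom.id ℂ) (t : ℂ))))
      (regValue ((u ++ [σ]).map (rescaledLimit d))) := by
  have hσ0 : σ ≠ 0 := fun h => by simp [h, vanishingDeg_zero] at hσ
  set w := u ++ [σ] with hw
  have hex : ∀ j : ℕ, ∃ c, HasRegLimAtZero
      (fun t : ℝ => regValue ((w.drop j).map (rescaledEval d t))) c := fun j =>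
    exists_hasRegLimAtZero_regValue_of_meromorphicAt (g := fun τ z => rescaledEval d z τ)
      (fun τ _ => meromorphicAt_rescaledEval d τ)
      fun τ hτ => (hadm τ (List.mem_of_mem_drop hτ)).eventually_admissible d
  choose D hD using hex
  have hD0 : D 0 = regValue (w.map (rescaledLimit d)) :=
    (hD 0).eq_of_tendsto (tendsto_regValue_rescaledEval hadm hσ hu)
  have hsum := HasRegLimAtZero.sum (Finset.range (w.length + 1)) fun j _ =>
    ((hD j).log_pow_mul j).const_mul ((-(d : ℂ)) ^ j / j.factorial)
  rw [Finset.sum_eq_single_of_mem 0 (by simp) (fun j _ hj => by simp [hj])] at hsum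
  simp only [if_true, pow_zero, Nat.factorial_zero, Nat.cast_one, div_one, one_mul, hD0] at hsum
  refine hsum.congr ?_
  have hadm' : ∀ᶠ t : ℝ in 𝓝[>] 0, ∀ τ ∈ w, Admissible (rescaledEval d t τ) :=
    (List.finite_toSet w).eventually_all.2 fun τ hτ => (hadm τ hτ).eventually_admissible d
  obtain ⟨N, g, hN, hg, hg0, -, he⟩ := exists_eval_eq_zpow_mul hσ0
  have hne : ∀ᶠ t : ℝ in 𝓝[>] 0, g t ≠ 0 :=
    tendsto_ofReal_nhdsGT_zero.eventually (hg.continuousAt.eventually_ne hg0)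
  filter_upwards [hadm', hne, tendsto_ofReal_nhdsGT_nhdsNE.eventually he, self_mem_nhdsWithin]
    with t hadm hne he h0
  have h0' : (t : ℂ) ≠ 0 := Complex.ofReal_ne_zero.2 (ne_of_gt h0)
  have hscale := regValue_scale (s := t ^ d) (zpow_pos h0 _) (u.map (rescaledEval d t))
    (b := rescaledEval d t σ)
    (by rw [rescaledEval, he]; exact mul_ne_zero (zpow_ne_zero _ h0')
          (mul_ne_zero (zpow_ne_zero _ h0') hne))
    (by
      have : u.map (rescaledEval d t) ++ [rescaledEval d t σ] = w.map (rescaledEval d t) := by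
        simp [hw]
      rw [this]
      simpa using hadm)
  have hwe : u.map (rescaledEval d t) ++ [rescaledEval d t σ] = w.map (rescaledEval d t) := by
    simp [hw]
  rw [hwe] at hscale
  have hback : (w.map (rescaledEval d t)).map (((t ^ d : ℝ) : ℂ) * ·) =
      w.map (RatFunc.eval (RingHom.id ℂ) (t : ℂ)) := by
    rw [List.map_map]
    refine List.map_congr_left fun τ _ => ?_
    simp only [Function.comp, rescaledEval, Complex.ofReal_zpow]
    rw [← mul_assoc, ← zpow_add₀ h0', add_neg_cancel, zpow_zero, one_mul]
  rw [hback] at hscale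
  rw [hscale, suffixSum, List.length_map]
  refine Finset.sum_congr rfl fun j _ => ?_
  rw [dividedPow, Real.log_zpow, ← List.map_drop, Complex.ofReal_mul, Complex.ofReal_intCast,
    ← neg_mul, mul_pow]
  ring

end

end Hyperlogarithm

namespace Hyperlogarithm

noncomputable section

open Filter Topology MeasureTheory

/-! ### The regularized limit of words -/

section ReglimWord

variable {S : Set (RatFunc ℂ)}

lemma eq_of_vanishingDeg_eq_top {a b : S} (ha : vanishingDeg (a : RatFunc ℂ) = ⊤)
    (hb : vanishingDeg (b : RatFunc ℂ) = ⊤) : a = b :=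
  Subtype.ext ((vanishingDeg_eq_top_iff.1 ha).trans (vanishingDeg_eq_top_iff.1 hb).symm)

lemma wordDeg_eq_of_minimal {u : List S} {a : S} {d : ℤ} (ha : vanishingDeg (a : RatFunc ℂ) = d)
    (hu : ∀ b ∈ u, vanishingDeg (a : RatFunc ℂ) ≤ vanishingDeg (b : RatFunc ℂ)) :
    wordDeg ((u ++ [a]).map Subtype.val) = d := by
  refine le_antisymm (ha ▸ wordDeg_le (by simp)) (le_wordDeg fun σ hσ => ?_)
  obtain ⟨b, hb, rfl⟩ := List.mem_map.1 hσ
  rcases List.mem_append.1 hb with h | h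
  · exact ha ▸ hu b h
  · rw [List.mem_singleton.1 h, ha]

theorem IsReglimWord.ext {ℓ ℓ' : WordSpace S →ₗ[ℚ] WordSpace (leadingAlphabet S)}
    (h : IsReglimWord ℓ) (h' : IsReglimWord ℓ') : ℓ = ℓ' := by
  have hinj : Function.Injective
      (Finsupp.mapDomain (M := ℚ) (List.map (Subtype.val : leadingAlphabet S → ℂ))) :=
    Finsupp.mapDomain_injective (List.map_injective_iff.2 Subtype.val_injective)
  have htop : LinearMap.eqLocus ℓ ℓ' = ⊤ := by
    refine eq_top_of_minimal_mem (fun a : S => vanishingDeg a)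
      (fun a b => eq_of_vanishingDeg_eq_top) _ ?_ ?_ ?_ ?_
    · exact h.map_one.trans h'.map_one.symm
    · intro a ha
      have ha0 := vanishingDeg_eq_top_iff.1 ha
      exact (h.map_zero_letter a ha0).trans (h'.map_zero_letter a ha0).symm
    · intro u a d ha hu
      have hd := wordDeg_eq_of_minimal ha hu
      exact hinj ((h.map_minimal u a d ha hd).trans (h'.map_minimal u a d ha hd).symm)
    · intro x hx y hy
      rw [LinearMap.mem_eqLocus] at hx hy ⊢
      rw [shuffleL_apply, h.map_shuffle, h'.map_shuffle, hx, hy]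
  exact LinearMap.eqLocus_eq_top.1 htop

open Classical in
/-- The leading coefficient of a letter, as a letter of the alphabet of leading coefficients. -/
def leadingLetter (a : S) : leadingAlphabet S :=
  if h : (a : RatFunc ℂ) = 0 then ⟨0, Or.inl rfl⟩
  else ⟨leadingCoeff a, Or.inr ⟨a, ⟨a.2, h⟩, rfl⟩⟩

lemma leadingLetter_coe {a : S} (h : (a : RatFunc ℂ) ≠ 0) :
    (leadingLetter a : ℂ) = leadingCoeff a := by
  rw [leadingLetter, dif_neg h]

theorem IsShuffleHom.map_shuffleL {α β : Type*} {f : WordSpace α →ₗ[ℚ] WordSpace β}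
    (hf : IsShuffleHom f) (x y : WordSpace α) : f (shuffleL x y) = shuffleL (f x) (f y) := by
  have : shuffleL.compr₂ f = shuffleL.compl₁₂ f f := by
    refine wordSpace_hom_ext fun u => wordSpace_hom_ext fun v => ?_
    simp [shuffleL_ofWord, hf.map_shuffleWord]
  exact LinearMap.congr_fun₂ this x y

theorem isReglimWord_leadingHom : IsReglimWord
    (leadingHom (fun a : S => vanishingDeg a) leadingLetter
      (⟨0, Or.inl rfl⟩ : leadingAlphabet S)) where
  map_one := (isShuffleHom_leadingHom _ _ _).map_one
  map_shuffle x y := by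
    rw [← shuffleL_apply, ← shuffleL_apply, (isShuffleHom_leadingHom _ _ _).map_shuffleL]
  map_zero_letter a ha := leadingHom_of_top _ _ _ (vanishingDeg_eq_top_iff.2 ha)
  map_minimal u a d ha hd := by
    have hle : ∀ b ∈ u ++ [a], (d : WithTop ℤ) ≤ vanishingDeg (b : RatFunc ℂ) := fun b hb =>
      hd ▸ wordDeg_le (List.mem_map_of_mem hb)
    rw [leadingHom_minimal (fun a : S => vanishingDeg a) _ _ ha fun b hb => ha ▸ hle b (List.mem_append_left _ hb), ofWord,
      Finsupp.mapDomain_single, ← ofWord, List.map_map]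
    simp only [bind_pure_comp, List.map_eq_map, List.map_map]
    congr 1
    refine List.map_congr_left fun b hb => ?_
    simp only [Function.comp]
    split_ifs with h
    · have hb0 : (b : RatFunc ℂ) ≠ 0 := fun h0 => by simp [h0, vanishingDeg_zero] at h
      rw [leadingLetter_coe hb0, rescaledLimit_of_eq h]
    · rw [rescaledLimit_of_lt (lt_of_le_of_ne (hle b hb) (Ne.symm h))]

lemma admissible_of_mem_leadingAlphabet
    (hlead : Disjoint (leadingAlphabet S) ((fun r : ℝ => (r : ℂ)) '' Set.Ioi 0)) {a : ℂ}
    (ha : a ∈ leadingAlphabet S) : Admissible a :=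
  fun x hx hax => Set.disjoint_left.1 hlead ha ⟨x, hx, hax.symm⟩

lemma leadingCoeff_ne_zero {σ : RatFunc ℂ} (h : σ ≠ 0) : leadingCoeff σ ≠ 0 := by
  obtain ⟨_, _, _, _, h0, hlc, _⟩ := exists_eval_eq_zpow_mul h
  rwa [← hlc]

lemma leadingAdmissible_of_mem
    (hlead : Disjoint (leadingAlphabet S) ((fun r : ℝ => (r : ℂ)) '' Set.Ioi 0)) (a : S) :
    LeadingAdmissible (a : RatFunc ℂ) := by
  intro h x hx heq
  rcases hx.eq_or_lt with rfl | hx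
  · exact leadingCoeff_ne_zero h (by simpa using heq)
  · exact admissible_of_mem_leadingAlphabet hlead (Or.inr ⟨a, ⟨a.2, h⟩, rfl⟩) x hx heq

lemma eventually_admissible_evalAt
    (hlead : Disjoint (leadingAlphabet S) ((fun r : ℝ => (r : ℂ)) '' Set.Ioi 0)) (a : S) :
    ∀ᶠ t : ℝ in 𝓝[>] 0, Admissible (evalAt t a) := by
  have := (leadingAdmissible_of_mem hlead a).eventually_admissible 0
  simpa [rescaledEval, evalAt] using this

lemma mem_admissibleSpan_leadingAlphabet
    (hlead : Disjoint (leadingAlphabet S) ((fun r : ℝ => (r : ℂ)) '' Set.Ioi 0))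
    (x : WordSpace (leadingAlphabet S)) : x ∈ admissibleSpan Subtype.val :=
  (eventually_mem_admissibleSpan (l := 𝓝[>] 0) (e := fun _ => Subtype.val)
    (fun a => Eventually.of_forall fun _ => admissible_of_mem_leadingAlphabet hlead a.2)
    x).exists.choose_spec

theorem IsReglimWord.hasRegLimAtZero_regL
    {ℓ : WordSpace S →ₗ[ℚ] WordSpace (leadingAlphabet S)} (hℓ : IsReglimWord ℓ)
    (hlead : Disjoint (leadingAlphabet S) ((fun r : ℝ => (r : ℂ)) '' Set.Ioi 0))
    (x : WordSpace S) :
    HasRegLimAtZero (fun t => regL (evalAt t) x) (regL Subtype.val (ℓ x)) := by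
  let p : Submodule ℚ (WordSpace S) :=
    { carrier := {x | HasRegLimAtZero (fun t => regL (evalAt t) x) (regL Subtype.val (ℓ x))}
      add_mem' := fun hx hy => by
        simp only [Set.mem_ofPred_eq, map_add] at hx hy ⊢
        exact hx.add hy
      zero_mem' := by
        simp only [Set.mem_ofPred_eq, map_zero]
        exact HasRegLimAtZero.const 0
      smul_mem' := fun q x hx => by
        simp only [Set.mem_ofPred_eq, map_smul, Rat.smul_def] at hx ⊢
        exact hx.const_mul _ }
  suffices hp : p = ⊤ from (hp ▸ Submodule.mem_top : x ∈ p)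
  refine eq_top_of_minimal_mem (fun a : S => vanishingDeg a)
    (fun a b => eq_of_vanishingDeg_eq_top) _ ?_ ?_ ?_ ?_
  · change HasRegLimAtZero _ _
    simp only [hℓ.map_one, regL_ofWord, List.map_nil]
    exact HasRegLimAtZero.const _
  · intro a ha
    have ha0 := vanishingDeg_eq_top_iff.1 ha
    change HasRegLimAtZero _ _
    simp only [hℓ.map_zero_letter a ha0, regL_ofWord, List.map_cons, List.map_nil, evalAt, ha0,
      RatFunc.eval_zero, regValue_zero, map_zero]
    exact HasRegLimAtZero.const 0
  · intro u a d ha hu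
    change HasRegLimAtZero _ _
    have hval : regL Subtype.val (ℓ (ofWord (u ++ [a]))) =
        regValue ((u.map Subtype.val ++ [(a : RatFunc ℂ)]).map (rescaledLimit d)) := by
      have h := congrArg (regL id) (hℓ.map_minimal u a d ha (wordDeg_eq_of_minimal ha hu))
      rw [regL_mapDomain, regL_ofWord] at h
      simpa using h
    rw [hval]
    refine (hasRegLimAtZero_regValue_minimal ?_ ha ?_).congr (Eventually.of_forall fun t => ?_)
    · intro τ hτ
      obtain ⟨b, rfl⟩ : ∃ b : S, (b : RatFunc ℂ) = τ := by
        rcases List.mem_append.1 hτ with h | h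
        · obtain ⟨b, -, rfl⟩ := List.mem_map.1 h
          exact ⟨b, rfl⟩
        · exact ⟨a, (List.mem_singleton.1 h).symm⟩
      exact leadingAdmissible_of_mem hlead b
    · intro τ hτ
      obtain ⟨b, hb, rfl⟩ := List.mem_map.1 hτ
      exact ha ▸ hu b hb
    · rw [regL_ofWord]
      congr 1
      simp [evalAt]
  · intro x hx y hy
    change HasRegLimAtZero _ _
    have hmap : ℓ (shuffleL x y) = shuffleL (ℓ x) (ℓ y) := by
      rw [shuffleL_apply, hℓ.map_shuffle, shuffleL_apply]
    rw [hmap, regL_shuffleL (mem_admissibleSpan_leadingAlphabet hlead _)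
      (mem_admissibleSpan_leadingAlphabet hlead _)]
    refine (HasRegLimAtZero.mul hx hy).congr ?_
    filter_upwards [eventually_mem_admissibleSpan (eventually_admissible_evalAt hlead) x,
      eventually_mem_admissibleSpan (eventually_admissible_evalAt hlead) y] with t ht ht'
    exact (regL_shuffleL ht ht').symm

end ReglimWord

end

end Hyperlogarithm

theorem mainTheorem1 (S : Set (RatFunc ℂ))
    (hS : Disjoint S ((fun r : ℝ => RatFunc.C (r : ℂ)) '' Set.Ioi 0))
    (hlead : Disjoint (Hyperlogarithm.leadingAlphabet S) ((fun r : ℝ => (r : ℂ)) '' Set.Ioi 0)) :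
    ∃ ℓ : Hyperlogarithm.WordSpace S →ₗ[ℚ]
        Hyperlogarithm.WordSpace (Hyperlogarithm.leadingAlphabet S),
      Hyperlogarithm.IsReglimWord ℓ ∧
      (∀ ℓ', Hyperlogarithm.IsReglimWord ℓ' → ℓ' = ℓ) ∧
      ∀ w : Hyperlogarithm.WordSpace S,
        (∀ᶠ t : ℝ in nhdsWithin 0 (Set.Ioi 0),
          ∃ c, Hyperlogarithm.HasRegLimAtTop
            (Hyperlogarithm.hyperlog (Hyperlogarithm.evalAt t) w) c) ∧
        (∃ c, Hyperlogarithm.HasRegLimAtZero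
          (fun t => Hyperlogarithm.regLimAtTop
            (Hyperlogarithm.hyperlog (Hyperlogarithm.evalAt t) w)) c) ∧
        (∃ c, Hyperlogarithm.HasRegLimAtTop (Hyperlogarithm.hyperlog Subtype.val (ℓ w)) c) ∧
        Hyperlogarithm.regLimAtZero
            (fun t => Hyperlogarithm.regLimAtTop
              (Hyperlogarithm.hyperlog (Hyperlogarithm.evalAt t) w)) =
          Hyperlogarithm.regLimAtTop (Hyperlogarithm.hyperlog Subtype.val (ℓ w)) := by
  refine ⟨_, Hyperlogarithm.isReglimWord_leadingHom,
    fun ℓ' h' => h'.ext Hyperlogarithm.isReglimWord_leadingHom, fun w => ?_⟩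
  have hreg := Hyperlogarithm.isReglimWord_leadingHom.hasRegLimAtZero_regL hlead w
  have hmem := Hyperlogarithm.eventually_mem_admissibleSpan
    (Hyperlogarithm.eventually_admissible_evalAt hlead) w
  have hzero := hreg.congr (hmem.mono fun t ht =>
    (Hyperlogarithm.hasRegLimAtTop_hyperlog ht).regLimAtTop_eq.symm)
  have htop := Hyperlogarithm.hasRegLimAtTop_hyperlog
    (Hyperlogarithm.mem_admissibleSpan_leadingAlphabet hlead
      (Hyperlogarithm.leadingHom (fun a : S => Hyperlogarithm.vanishingDeg a)
        Hyperlogarithm.leadingLetter ⟨0, Or.inl rfl⟩ w))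
  exact ⟨hmem.mono fun t ht => ⟨_, Hyperlogarithm.hasRegLimAtTop_hyperlog ht⟩, ⟨_, hzero⟩,
    ⟨_, htop⟩, by rw [hzero.regLimAtZero_eq, htop.regLimAtTop_eq]⟩
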